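/- Let $\|f\|_{H^1(\mathbb{R}^5)}^2=(2\pi)^{-5}\int_{\mathbb{R}^5}(1+|\xi|^2)|\widehat f(\xi)|^2\,d\xi$, where $\widehat f(\xi)=\int f(x)e^{-ix\cdot\xi}\,dx$; equivalently $\|f\|_{H^1}^2=\|f\|_{L^2}^2+\|\nabla f\|_{L^2}^2$. Let $u:\mathbb{R}\times\mathbb{R}^5\to\mathbb{C}$ be any solution of the Klein--Gordon equation $\partial_{tt}u-\Delta u+u=0$ with initial data $(u(0),\partial_tu(0))\in H^1(\mathbb{R}^5)\times L^2(\mathbb{R}^5)$; here a solution is a measurable function $u$ on space-time with $t\mapsto u(t)$ in $C^1(\mathbb{R};L^2(\mathbb{R}^5))$ such that $\partial_t(\partial_t u)=\Delta u-u$ holds at every time in the sense of tempered distributions on $\mathbb{R}^5$. Then $$\|u\|_{L^4(\mathbb{R}\times\mathbb{R}^5)}\le\Bigl(\frac{1}{8\pi}\Bigr)^{1/2}\Bigl(\|u(0)\|_{H^1(\mathbb{R}^5)}^2+\|\partial_tu(0)\|_{L^2(\mathbb{R}^5)}^2\Bigr)^{1/2}.$$ The constant $(1/(8\pi))^{1/2}$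 is sharp: if $C\in\mathbb{R}$ is such that the inequality holds for all such solutions with $C$ in place of $(1/(8\pi))^{1/2}$, then $C\ge(1/(8\pi))^{1/2}$. There is no nontrivial solution with equality: if equality holds for such a solution $u$, then for every $t$ one has $u(t)=0$ almost everywhere on $\mathbb{R}^5$. -/

import Mathlib

open MeasureTheory
open scoped SchwartzMap FourierTransform Laplacian Real ENNReal

noncomputable section

/-- Five-dimensional Euclidean space. -/
abbrev Space5 : Type := EuclideanSpace ℝ (Fin 5)

/-- The complex Hilbert space `L²(ℝ⁵)`. -/
abbrev L2Space5 : Type := Lp ℂ 2 (volume : Measure Space5)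

/-- The function `ξ ↦ (1 + |2πξ|²)^{1/2} 𝓕f(ξ)` for `f ∈ L²(ℝ⁵)`.  Mathlib's transform is
`𝓕f(ξ) = ∫ f(x) e^{-2πi x·ξ} dx`, so that `𝓕f(ξ)` is the transform with kernel `e^{-i x·η}`
taken at the frequency `η = 2πξ`. -/
def besselFourier (f : L2Space5) (ξ : Space5) : ℂ :=
  (√(1 + (2 * π * ‖ξ‖) ^ 2) : ℂ) * (𝓕 f : L2Space5) ξ

/-- `f ∈ H¹(ℝ⁵)`. -/
def MemH1 (f : L2Space5) : Prop :=
  MemLp (besselFourier f) 2 (volume : Measure Space5)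

/-- The norm of `H¹(ℝ⁵)`, normalised by Plancherel's theorem, that is
`‖f‖²_{H¹} = ‖f‖²_{L²} + ‖∇f‖²_{L²}`. -/
def h1Norm (f : L2Space5) : ℝ :=
  (eLpNorm (besselFourier f) 2 (volume : Measure Space5)).toReal

/-- The curve `t ↦ u(t, ·)` in `L²(ℝ⁵)` of a function all of whose time slices are in `L²`. -/
def sliceCurve (u : ℝ → Space5 → ℂ) (hu : ∀ t, MemLp (u t) 2 (volume : Measure Space5))
    (t : ℝ) : L2Space5 :=
  (hu t).toLp (u t)

/-- `u` is a solution of `∂ₜₜu - Δu + u = 0` on `ℝ × ℝ⁵` with initial data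
`(u(0), ∂ₜu(0)) ∈ H¹ × L²`: the function `u` is measurable on space-time, `t ↦ u(t)` is
continuously differentiable with values in `L²(ℝ⁵)`, one has `u(0) ∈ H¹(ℝ⁵)`, and
`∂ₜ(∂ₜu) = Δu - u` holds at every time in the sense of (tempered) distributions on `ℝ⁵`. -/
structure IsKleinGordonSolution (u : ℝ → Space5 → ℂ) : Prop where
  aestronglyMeasurable :
    AEStronglyMeasurable (fun p : ℝ × Space5 => u p.1 p.2) volume
  memLp : ∀ t, MemLp (u t) 2 (volume : Measure Space5)
  contDiff : ContDiff ℝ 1 (sliceCurve u memLp)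
  memH1_zero : MemH1 (sliceCurve u memLp 0)
  weak_eq : ∀ (φ : 𝓢(Space5, ℂ)) (t : ℝ),
    HasDerivAt (fun s : ℝ => ∫ x, (deriv (sliceCurve u memLp) s : L2Space5) x * φ x)
      (∫ x, u t x * ((Δ φ : 𝓢(Space5, ℂ)) x - φ x)) t

/-- The initial position `u(0)`, as an element of `L²(ℝ⁵)`. -/
def IsKleinGordonSolution.initialPosition {u : ℝ → Space5 → ℂ}
    (hu : IsKleinGordonSolution u) : L2Space5 :=
  sliceCurve u hu.memLp 0

/-- The initial velocity `∂ₜu(0)`, the derivative at time `0` of the curve `t ↦ u(t)` in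
`L²(ℝ⁵)`. -/
def IsKleinGordonSolution.initialVelocity {u : ℝ → Space5 → ℂ}
    (hu : IsKleinGordonSolution u) : L2Space5 :=
  deriv (sliceCurve u hu.memLp) 0

/-- The quantity `(‖u(0)‖²_{H¹} + ‖∂ₜu(0)‖²_{L²})^{1/2}`. -/
def IsKleinGordonSolution.dataNorm {u : ℝ → Space5 → ℂ}
    (hu : IsKleinGordonSolution u) : ℝ :=
  √(h1Norm hu.initialPosition ^ 2 + ‖hu.initialVelocity‖ ^ 2)

/-- The norm of `u` in `L⁴(ℝ × ℝ⁵)`. -/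
def spaceTimeL4Norm (u : ℝ → Space5 → ℂ) : ℝ≥0∞ :=
  eLpNorm (fun p : ℝ × Space5 => u p.1 p.2) 4 (volume : Measure (ℝ × Space5))

end

/-! Write `E = jap`. On the Fourier side a solution is `exp(itE) F + exp(-itE) G`, and the energies
of `F` and `G` (squared `H¹` norms) add up to half the squared data norm `D²`
(`IsKleinGordonSolution.exists_amplitudes`).

One half wave. Plancherel in `x` turns the fourth power of its `L⁴` norm into the `L²(dt dk)` norm
squared of the self-convolution of the evolved amplitude. For fixed total momentum `k`, a Lorentz
boost to the centre of mass frame makes the phase a function of `‖ζ‖` alone. Plancherel in time and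
Cauchy-Schwarz on the spheres then give a quadratic bound (`lintegral_radialPhase_sq_eq`), whose
weight is at most a constant times `jap y * jap z * (lorentzProd y z - 1)` (`pairWeight_le`). This
weight is a combination of products, so its double integral is explicit: `energy² - 4π²‖momentum‖² -
halfOrderEnergy²`, with constant `c = 1/(24π²)`.

Two half waves `a`, `b`. In `∫ |a+b|⁴` every cross term except `4∫ |a|²|b|²` oscillates with
nonnegative frequency and integrates to zero (`integral_quartic_eq_zero`). Cauchy-Schwarz and `x² +
4xy + y² ≤ (3/2)(x+y)²` bound the whole by `c (3/2)(D²/2)² = D⁴/(64π²)`, minus `c` times the squared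
half-order energies. Truncation and Fatou extend this to all finite-energy data.

The subtracted term vanishes only for the zero solution, so equality forces `u = 0`. For sharpness,
take `F = G = exp(-aE)/E`: the boosted amplitude is radial, so Cauchy-Schwarz loses nothing, the
momentum is zero, and replacing `1` by `3` in the weight gives a lower bound (`le_pairWeight`). As
`a` tends to `0` the half-order energy becomes negligible against the energy. -/

noncomputable section FourierPreliminaries

/-! ### Fourier transform on `L¹ ∩ L²`, Parseval's identity and convolution. -/

variable {V : Type*} [NormedAddCommGroup V] [InnerProductSpace ℝ V] [FiniteDimensional ℝ V]
  [MeasurableSpace V] [BorelSpace V]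

/-- The multiplication formula for integrable functions. -/
theorem integral_fourier_mul_eq_flip {f g : V → ℂ} (hf : Integrable f) (hg : Integrable g) :
    ∫ x, 𝓕 f x * g x = ∫ x, f x * 𝓕 g x := by
  have := VectorFourier.integral_fourierIntegral_smul_eq_flip (μ := (volume : Measure V))
    (ν := (volume : Measure V)) (L := innerₗ V) (f := f) (g := g)
    Real.continuous_fourierChar (by exact continuous_inner) hf hg
  simp only [flip_innerₗ, smul_eq_mul] at this
  exact this

/-- The multiplication formula for `L²` against Schwartz functions. -/
theorem integral_fourier_Lp_mul (f : Lp ℂ 2 (volume : Measure V)) (ψ : 𝓢(V, ℂ)) :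
    ∫ x, (𝓕 f : Lp ℂ 2 (volume : Measure V)) x * ψ x = ∫ x, f x * (𝓕 ψ) x := by
  have h := congrArg (fun T : 𝓢'(V, ℂ) => T ψ) (Lp.fourier_toTemperedDistribution_eq f)
  simp only [TemperedDistribution.fourier_apply, Lp.toTemperedDistribution_apply] at h
  simpa [mul_comm] using h.symm

theorem continuous_fourier_of_integrable {f : V → ℂ} (hf : Integrable f) : Continuous (𝓕 f) :=
  VectorFourier.fourierIntegral_continuous Real.continuous_fourierChar
    (by exact continuous_inner) hf

theorem continuous_fourierInv_of_integrable {f : V → ℂ} (hf : Integrable f) :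
    Continuous (𝓕⁻ f) := by
  have : 𝓕⁻ f = fun x => 𝓕 f (-x) := by
    ext x; exact Real.fourierInv_eq_fourier_neg f x
  rw [this]
  exact (continuous_fourier_of_integrable hf).comp continuous_neg

/-- Two functions which are square integrable or locally integrable coincide almost everywhere
when they act in the same way on Schwartz functions. -/
theorem ae_eq_of_integral_mul_schwartz {f g : V → ℂ} (hf : LocallyIntegrable f)
    (hg : LocallyIntegrable g)
    (h : ∀ ψ : 𝓢(V, ℂ), HasCompactSupport ψ → ∫ x, f x * ψ x = ∫ x, g x * ψ x) : f =ᵐ[volume] g := by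
  refine ae_eq_of_integral_contDiff_smul_eq hf hg fun χ hχ hχs => ?_
  have h1 : ContDiff ℝ (⊤ : ℕ∞) (fun x => (χ x : ℂ)) := Complex.ofRealCLM.contDiff.comp hχ
  have h2 : HasCompactSupport (fun x => (χ x : ℂ)) := hχs.comp_left (g := fun r : ℝ => (r : ℂ)) (by simp)
  have := h (h2.toSchwartzMap h1) h2
  simpa [mul_comm] using this

/-- The `L²` Fourier transform of an integrable function is given by the Fourier integral. -/
theorem fourier_toLp_ae {f : V → ℂ} (hf : Integrable f) (hf2 : MemLp f 2) :
    (𝓕 (hf2.toLp f) : Lp ℂ 2 (volume : Measure V)) =ᵐ[volume] 𝓕 f := by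
  refine ae_eq_of_integral_mul_schwartz ?_ (continuous_fourier_of_integrable hf).locallyIntegrable
    fun ψ _ => ?_
  · exact (Lp.memLp _).locallyIntegrable (by norm_num)
  · rw [integral_fourier_Lp_mul, integral_fourier_mul_eq_flip hf ψ.integrable]
    refine integral_congr_ae ?_
    filter_upwards [hf2.coeFn_toLp] with x hx
    rw [hx, SchwartzMap.fourier_coe]

theorem eLpNorm_fourier {f : V → ℂ} (hf : Integrable f) (hf2 : MemLp f 2) :
    eLpNorm (𝓕 f) 2 volume = eLpNorm f 2 volume := by
  rw [← eLpNorm_congr_ae (fourier_toLp_ae hf hf2), ← eLpNorm_congr_ae hf2.coeFn_toLp,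
    ← Lp.enorm_def, ← Lp.enorm_def, ← ofReal_norm, ← ofReal_norm, Lp.norm_fourier_eq]

theorem eLpNorm_two_sq {α : Type*} [MeasurableSpace α] {μ : Measure α} (f : α → ℂ) :
    eLpNorm f 2 μ ^ 2 = ∫⁻ x, ‖f x‖ₑ ^ 2 ∂μ := by
  have := eLpNorm_nnreal_pow_eq_lintegral (f := f) (p := 2) (μ := μ) (by norm_num)
  simpa using this

/-- Plancherel's theorem on `L¹ ∩ L²`. -/
theorem lintegral_fourier_sq {f : V → ℂ} (hf : Integrable f) (hf2 : MemLp f 2) :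
    ∫⁻ x, ‖𝓕 f x‖ₑ ^ 2 = ∫⁻ x, ‖f x‖ₑ ^ 2 := by
  rw [← eLpNorm_two_sq, ← eLpNorm_two_sq, eLpNorm_fourier hf hf2]

theorem lintegral_fourierInv_sq {f : V → ℂ} (hf : Integrable f) (hf2 : MemLp f 2) :
    ∫⁻ x, ‖𝓕⁻ f x‖ₑ ^ 2 = ∫⁻ x, ‖f x‖ₑ ^ 2 := by
  rw [← lintegral_fourier_sq hf hf2,
    ← lintegral_neg_eq_self (fun x => ‖𝓕 f x‖ₑ ^ 2)]
  simp_rw [Real.fourierInv_eq_fourier_neg]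

/-- The inverse `L²` Fourier transform of an integrable function is given by the integral. -/
theorem fourierInv_toLp_ae {f : V → ℂ} (hf : Integrable f) (hf2 : MemLp f 2) :
    (𝓕⁻ (hf2.toLp f) : Lp ℂ 2 (volume : Measure V)) =ᵐ[volume] 𝓕⁻ f := by
  have hn : Integrable (fun x => f (-x)) := hf.comp_neg
  have hn2 : MemLp (fun x => f (-x)) 2 :=
    hf2.comp_measurePreserving (Measure.measurePreserving_neg _)
  have hinv : 𝓕⁻ f = 𝓕 (fun x => f (-x)) := Real.fourierInv_eq_fourier_comp_neg f
  refine ae_eq_of_integral_mul_schwartz ((Lp.memLp _).locallyIntegrable (by norm_num))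
    (continuous_fourierInv_of_integrable hf).locallyIntegrable fun ψ _ => ?_
  -- The multiplication formula for `𝓕⁻` is the one for `𝓕`, applied to the two inverse transforms.
  have h := integral_fourier_Lp_mul (𝓕⁻ (hf2.toLp f)) (𝓕⁻ ψ)
  rw [FourierTransform.fourier_fourierInv_eq, FourierTransform.fourier_fourierInv_eq] at h
  rw [← h, hinv, integral_fourier_mul_eq_flip hn ψ.integrable,
    ← integral_neg_eq_self (fun x => f (-x) * 𝓕 (ψ : V → ℂ) x)]
  refine integral_congr_ae ?_
  filter_upwards [hf2.coeFn_toLp] with x hx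
  rw [hx, neg_neg, SchwartzMap.fourierInv_coe, Real.fourierInv_eq_fourier_neg]

/-- Parseval's identity on `L¹ ∩ L²`. -/
theorem integral_fourierInv_mul_conj {f g : V → ℂ} (hf : Integrable f) (hf2 : MemLp f 2)
    (hg : Integrable g) (hg2 : MemLp g 2) :
    ∫ x, 𝓕⁻ f x * (starRingEnd ℂ) (𝓕⁻ g x) = ∫ x, f x * (starRingEnd ℂ) (g x) := by
  have h : inner ℂ (𝓕⁻ (hg2.toLp g) : Lp ℂ 2 (volume : Measure V)) (𝓕⁻ (hf2.toLp f)) =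
      inner ℂ (hg2.toLp g) (hf2.toLp f) := by
    exact (Lp.fourierTransformₗᵢ V ℂ).symm.inner_map_map _ _
  rw [L2.inner_def, L2.inner_def] at h
  calc _ = ∫ x, inner ℂ ((𝓕⁻ (hg2.toLp g) : Lp ℂ 2 (volume : Measure V)) x)
        ((𝓕⁻ (hf2.toLp f) : Lp ℂ 2 (volume : Measure V)) x) := by
        refine integral_congr_ae ?_
        filter_upwards [fourierInv_toLp_ae hf hf2, fourierInv_toLp_ae hg hg2] with x h1 h2
        rw [h1, h2]; simp
    _ = _ := h
    _ = _ := by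
        refine integral_congr_ae ?_
        filter_upwards [hf2.coeFn_toLp, hg2.coeFn_toLp] with x h1 h2
        rw [h1, h2]; simp

/-- The convolution of two complex valued functions on a Euclidean space. -/
def fconv (f g : V → ℂ) (x : V) : ℂ := ∫ y, f y * g (x - y)

theorem integrable_fconv_integrand {f g : V → ℂ} (hf : Integrable f) (hg : Integrable g) :
    Integrable (fun p : V × V => f p.2 * g (p.1 - p.2)) (volume.prod volume) :=
  hf.convolution_integrand (ContinuousLinearMap.mul ℂ ℂ) hg

theorem integrable_fconv {f g : V → ℂ} (hf : Integrable f) (hg : Integrable g) :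
    Integrable (fconv f g) :=
  hf.integrable_convolution (ContinuousLinearMap.mul ℂ ℂ) hg

theorem fourierInv_fconv {f g : V → ℂ} (hf : Integrable f) (hg : Integrable g) (x : V) :
    𝓕⁻ (fconv f g) x = 𝓕⁻ f x * 𝓕⁻ g x := by
  simp_rw [Real.fourierInv_eq_fourier_neg]
  exact Real.fourier_mul_convolution_eq hf hg (-x)

/-- Young's inequality with exponents `1` and `∞`. Being both integrable and bounded, the
convolutions used below lie in `L²`, where Plancherel applies. -/
theorem norm_fconv_le {f g : V → ℂ} (hf : Integrable f) {C : ℝ} (hg : ∀ x, ‖g x‖ ≤ C) (x : V) :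
    ‖fconv f g x‖ ≤ (∫ y, ‖f y‖) * C := by
  rw [← integral_mul_const]
  refine (norm_integral_le_integral_norm _).trans ?_
  refine integral_mono_of_nonneg (Filter.Eventually.of_forall fun y => norm_nonneg _)
    (hf.norm.mul_const C) (Filter.Eventually.of_forall fun y => ?_)
  simp only [norm_mul]
  exact mul_le_mul_of_nonneg_left (hg _) (norm_nonneg _)

theorem memLp_two_of_integrable_of_bound {α : Type*} [MeasurableSpace α] {μ : Measure α}
    {f : α → ℂ} (hf : Integrable f μ) {C : ℝ} (hC : ∀ x, ‖f x‖ ≤ C) : MemLp f 2 μ := by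
  rw [memLp_two_iff_integrable_sq_norm hf.1]
  refine (hf.norm.mul_const C).mono (hf.1.norm.pow 2) (Filter.Eventually.of_forall fun x => ?_)
  have h0 : 0 ≤ C := (norm_nonneg _).trans (hC x)
  rw [norm_pow, norm_norm, norm_mul, norm_norm, Real.norm_of_nonneg h0, sq]
  exact mul_le_mul_of_nonneg_left (hC x) (norm_nonneg _)

end FourierPreliminaries

/-! ### Polar coordinates and Plancherel in time for radial phases. -/

noncomputable section RadialPlancherel

open Set

/-- Plancherel's theorem for an oscillatory integral with increasing phase on the half line. -/
theorem lintegral_oscillatory_halfLine_sq {φ φ' : ℝ → ℝ} {G : ℝ → ℂ}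
    (hφ : ∀ r ∈ Ioi (0 : ℝ), HasDerivAt φ (φ' r) r) (hφ' : ∀ r ∈ Ioi (0 : ℝ), 0 < φ' r)
    (hG : IntegrableOn G (Ioi 0))
    (hfin : ∫⁻ r in Ioi (0 : ℝ), ‖G r‖ₑ ^ 2 / ENNReal.ofReal (φ' r) ≠ ∞) :
    ∫⁻ t : ℝ, ‖∫ r in Ioi (0 : ℝ), Complex.exp ((2 * π * t * φ r : ℝ) * Complex.I) * G r‖ₑ ^ 2 =
      ∫⁻ r in Ioi (0 : ℝ), ‖G r‖ₑ ^ 2 / ENNReal.ofReal (φ' r) := by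
  have hd : ∀ r ∈ Ioi (0 : ℝ), HasDerivWithinAt φ (φ' r) (Ioi 0) r := fun r hr =>
    (hφ r hr).hasDerivWithinAt
  have hinj : InjOn φ (Ioi 0) := by
    refine (strictMonoOn_of_deriv_pos (convex_Ioi 0)
      (fun r hr => (hd r hr).continuousWithinAt) fun r hr => ?_).injOn
    rw [interior_Ioi] at hr
    rw [(hφ r hr).deriv]; exact hφ' r hr
  set S := φ '' Ioi 0 with hS
  have hSm : MeasurableSet S := by
    refine measurableSet_Ioi.image_of_continuousOn_injOn ?_ hinj
    exact fun r hr => (hd r hr).continuousWithinAt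
  -- The substitution `τ = φ r` makes the oscillatory integral the inverse Fourier transform of `H`,
  -- the amplitude divided by `φ'`. In `∫ |H|²` one factor `1/φ'` is cancelled by the Jacobian and
  -- one survives.
  let H : ℝ → ℂ := S.indicator fun τ =>
    (φ' (Function.invFunOn φ (Ioi 0) τ) : ℂ)⁻¹ * G (Function.invFunOn φ (Ioi 0) τ)
  have hH : ∀ r ∈ Ioi (0 : ℝ), H (φ r) = (φ' r : ℂ)⁻¹ * G r := by
    intro r hr
    simp only [H]
    rw [indicator_of_mem (mem_image_of_mem φ hr), hinj.leftInvOn_invFunOn hr]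
  have hHI : Integrable H := by
    have : IntegrableOn H S := by
      rw [integrableOn_image_iff_integrableOn_abs_deriv_smul measurableSet_Ioi hd hinj]
      refine hG.congr_fun (fun r hr => ?_) measurableSet_Ioi
      have h0 : (φ' r : ℂ) ≠ 0 := by exact_mod_cast (hφ' r hr).ne'
      simp only [hH r hr, abs_of_pos (hφ' r hr), Complex.real_smul]
      field_simp
    have h2 := (integrable_indicator_iff hSm).2 this
    rwa [show S.indicator H = H from by simp [H]] at h2
  have hsq : ∫⁻ τ, ‖H τ‖ₑ ^ 2 = ∫⁻ r in Ioi (0 : ℝ), ‖G r‖ₑ ^ 2 / ENNReal.ofReal (φ' r) := by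
    have h1 : ∫⁻ τ, ‖H τ‖ₑ ^ 2 = ∫⁻ τ in S, ‖H τ‖ₑ ^ 2 := by
      rw [← lintegral_indicator hSm]
      refine lintegral_congr fun τ => ?_
      by_cases h : τ ∈ S <;> simp [H, h]
    rw [h1, lintegral_image_eq_lintegral_abs_deriv_mul measurableSet_Ioi hd hinj]
    refine setLIntegral_congr_fun measurableSet_Ioi fun r hr => ?_
    have hp := hφ' r hr
    have h0 : ENNReal.ofReal (φ' r) ≠ 0 := by simpa using hp
    have henorm : ‖((φ' r : ℂ))⁻¹‖ₑ = (ENNReal.ofReal (φ' r))⁻¹ := by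
      rw [enorm_inv (by exact_mod_cast hp.ne'), ← ofReal_norm, Complex.norm_real,
        Real.norm_of_nonneg hp.le]
    simp only [hH r hr, abs_of_pos hp]
    rw [enorm_mul, mul_pow, henorm, ENNReal.div_eq_inv_mul, sq (ENNReal.ofReal (φ' r))⁻¹,
      ← mul_assoc, ← mul_assoc, ENNReal.mul_inv_cancel h0 ENNReal.ofReal_ne_top, one_mul]
  have hH2 : MemLp H 2 := by
    refine ⟨hHI.1, ?_⟩
    have := eLpNorm_two_sq (μ := volume) H
    rw [hsq] at this
    refine lt_top_iff_ne_top.2 fun h => hfin ?_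
    rw [← this, h]; simp
  rw [← hsq, ← lintegral_fourierInv_sq hHI hH2]
  refine lintegral_congr fun t => ?_
  congr 2
  rw [Real.fourierInv_eq]
  have h1 : ∫ v, 𝐞 (inner ℝ v t) • H v = ∫ v in S, 𝐞 (inner ℝ v t) • H v := by
    rw [← integral_indicator hSm]
    refine integral_congr_ae (Filter.Eventually.of_forall fun τ => ?_)
    by_cases h : τ ∈ S <;> simp [H, h]
  rw [h1, integral_image_eq_integral_abs_deriv_smul measurableSet_Ioi hd hinj]
  refine setIntegral_congr_fun measurableSet_Ioi fun r hr => ?_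
  have h0 : (φ' r : ℂ) ≠ 0 := by exact_mod_cast (hφ' r hr).ne'
  simp only [hH r hr, abs_of_pos (hφ' r hr), Complex.real_smul, Circle.smul_def,
    Real.fourierChar_apply, smul_eq_mul]
  have : inner ℝ (φ r) t = t * φ r := by simp
  rw [this]
  field_simp

/-- The surface measure of the unit sphere of `ℝ⁵`. -/
def surf : Measure (Metric.sphere (0 : Space5) 1) := (volume : Measure Space5).toSphere

instance : IsFiniteMeasure surf := inferInstanceAs (IsFiniteMeasure (Measure.toSphere _))

/-- The area of the sphere is five times the volume `π^(5/2) / Γ(7/2)` of the ball, and `Γ(7/2) =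
15√π/8`. -/
theorem surf_univ : surf univ = ENNReal.ofReal (8 * π ^ 2 / 3) := by
  rw [surf, Measure.toSphere_apply_univ, EuclideanSpace.volume_ball]
  have hG : Real.Gamma (((5 : ℕ) : ℝ) / 2 + 1) = 15 / 8 * √π := by
    rw [show ((5 : ℕ) : ℝ) / 2 + 1 = (5 / 2 : ℝ) + 1 by norm_num, Real.Gamma_add_one (by norm_num),
      show (5 / 2 : ℝ) = 3 / 2 + 1 by norm_num, Real.Gamma_add_one (by norm_num),
      show (3 / 2 : ℝ) = 1 / 2 + 1 by norm_num, Real.Gamma_add_one (by norm_num),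
      Real.Gamma_one_half_eq]
    ring
  simp only [Fintype.card_fin, hG, finrank_euclideanSpace, ENNReal.ofReal_one, one_pow, one_mul]
  rw [← ENNReal.ofReal_natCast, ← ENNReal.ofReal_mul (by norm_num)]
  congr 1
  have h : √π ≠ 0 := (Real.sqrt_pos.2 Real.pi_pos).ne'
  have h2 : √π ^ 2 = π := Real.sq_sqrt Real.pi_pos.le
  have : √π ^ 5 = π ^ 2 * √π := by
    calc √π ^ 5 = (√π ^ 2) ^ 2 * √π := by ring
      _ = _ := by rw [h2]
  rw [this]; push_cast; field_simp; norm_num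

/-- Polar coordinates parametrise the punctured space; the missing origin is a null set. -/
theorem measurePreserving_polar :
    MeasurePreserving (fun p : Metric.sphere (0 : Space5) 1 × Ioi (0 : ℝ) =>
      (p.2 : ℝ) • (p.1 : Space5)) (surf.prod (Measure.volumeIoiPow 4)) volume := by
  have h := (volume : Measure Space5).measurePreserving_homeomorphUnitSphereProd
  have hdim : Module.finrank ℝ Space5 - 1 = 4 := by simp
  rw [hdim] at h
  have h' : MeasurePreserving (homeomorphUnitSphereProd Space5).symm
      (surf.prod (Measure.volumeIoiPow 4)) ((volume : Measure Space5).comap (↑)) :=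
    MeasurePreserving.symm (homeomorphUnitSphereProd Space5).toMeasurableEquiv h
  have h3 : MeasurePreserving (Subtype.val : ({(0 : Space5)}ᶜ : Set Space5) → Space5)
      ((volume : Measure Space5).comap (↑)) volume := by
    refine ⟨measurable_subtype_coe, ?_⟩
    rw [map_comap_subtype_coe (measurableSet_singleton _).compl, restrict_compl_singleton]
  have := h3.comp h'
  exact this

theorem lintegral_volumeIoiPow (n : ℕ) {f : ℝ → ℝ≥0∞} (hf : Measurable f) :
    ∫⁻ r : Ioi (0 : ℝ), f r ∂(Measure.volumeIoiPow n) =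
      ∫⁻ r in Ioi (0 : ℝ), ENNReal.ofReal (r ^ n) * f r := by
  rw [Measure.volumeIoiPow, lintegral_withDensity_eq_lintegral_mul _ (by fun_prop)
    (g := fun r : Ioi (0 : ℝ) => f r) (hf.comp measurable_subtype_coe)]
  exact lintegral_subtype_comap measurableSet_Ioi fun r => ENNReal.ofReal (r ^ n) * f r

theorem lintegral_polar {f : Space5 → ℝ≥0∞} (hf : Measurable f) :
    ∫⁻ ζ, f ζ = ∫⁻ r in Ioi (0 : ℝ),
      ENNReal.ofReal (r ^ 4) * ∫⁻ ω, f (r • (ω : Space5)) ∂surf := by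
  rw [← measurePreserving_polar.lintegral_comp hf, lintegral_prod_symm _ (by fun_prop)]
  exact lintegral_volumeIoiPow 4 (f := fun r : ℝ => ∫⁻ ω, f (r • (ω : Space5)) ∂surf)
    (Measurable.lintegral_prod_right' (f := fun p : ℝ × Metric.sphere (0 : Space5) 1 =>
      f (p.1 • (p.2 : Space5))) (by fun_prop))

theorem integral_volumeIoiPow (n : ℕ) (f : ℝ → ℂ) :
    ∫ r : Ioi (0 : ℝ), f r ∂(Measure.volumeIoiPow n) =
      ∫ r in Ioi (0 : ℝ), (r ^ n : ℝ) • f r := by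
  rw [Measure.volumeIoiPow, integral_withDensity_eq_integral_toReal_smul (by fun_prop) (by simp),
    ← integral_subtype_comap measurableSet_Ioi fun r : ℝ => (r ^ n : ℝ) • f r]
  refine integral_congr_ae (Filter.Eventually.of_forall fun r => ?_)
  simp only
  rw [ENNReal.toReal_ofReal (pow_nonneg r.2.out.le _)]

theorem integrable_volumeIoiPow_iff (n : ℕ) (f : ℝ → ℂ) :
    Integrable (fun r : Ioi (0 : ℝ) => f r) (Measure.volumeIoiPow n) ↔
      IntegrableOn (fun r => (r ^ n : ℝ) • f r) (Ioi (0 : ℝ)) := by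
  rw [Measure.volumeIoiPow, integrable_withDensity_iff_integrable_smul' (by fun_prop) (by simp),
    integrableOn_iff_comap_subtypeVal measurableSet_Ioi]
  refine integrable_congr (Filter.Eventually.of_forall fun r => ?_)
  simp only [Function.comp]
  rw [ENNReal.toReal_ofReal (pow_nonneg r.2.out.le _)]

theorem integrableOn_polar {f : Space5 → ℂ} (hf : Integrable f) :
    IntegrableOn (fun r : ℝ => (r ^ 4 : ℝ) • ∫ ω, f (r • (ω : Space5)) ∂surf) (Ioi 0) := by
  rw [← integrable_volumeIoiPow_iff 4 fun r : ℝ => ∫ ω, f (r • (ω : Space5)) ∂surf]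
  exact (measurePreserving_polar.integrable_comp_of_integrable hf).integral_prod_right

theorem integral_polar {f : Space5 → ℂ} (hf : Integrable f) :
    ∫ ζ, f ζ = ∫ r in Ioi (0 : ℝ), (r ^ 4 : ℝ) • ∫ ω, f (r • (ω : Space5)) ∂surf := by
  rw [← integral_volumeIoiPow 4 fun r : ℝ => ∫ ω, f (r • (ω : Space5)) ∂surf]
  have h := integral_prod_symm _ (measurePreserving_polar.integrable_comp_of_integrable hf)
  have h2 := measurePreserving_polar.map_eq
  calc ∫ ζ, f ζ = ∫ p, f ((p.2 : ℝ) • (p.1 : Space5)) ∂(surf.prod (Measure.volumeIoiPow 4)) := by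
        conv_lhs => rw [← h2]
        rw [integral_map measurePreserving_polar.measurable.aemeasurable (by rw [h2]; exact hf.1)]
    _ = _ := h

/-- Cauchy-Schwarz against the constant `1`. Used on the unit sphere, it is the only loss in the
time Plancherel estimate, and it costs nothing for radial amplitudes. -/
theorem enorm_integral_sq_le {α : Type*} [MeasurableSpace α] (μ : Measure α) {f : α → ℂ}
    (hf : Measurable f) : ‖∫ x, f x ∂μ‖ₑ ^ 2 ≤ μ univ * ∫⁻ x, ‖f x‖ₑ ^ 2 ∂μ := by
  have h1 : ‖∫ x, f x ∂μ‖ₑ ≤ eLpNorm f 1 μ := by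
    rw [eLpNorm_one_eq_lintegral_enorm]; exact enorm_integral_le_lintegral_enorm _
  have h2 := eLpNorm_le_eLpNorm_mul_rpow_measure_univ (μ := μ) (p := 1) (q := 2) (f := f)
    (by norm_num) hf.aestronglyMeasurable
  have h3 : (μ univ ^ (1 / (1 : ℝ≥0∞).toReal - 1 / (2 : ℝ≥0∞).toReal)) ^ 2 = μ univ := by
    rw [← ENNReal.rpow_natCast, ← ENNReal.rpow_mul]; norm_num
  calc ‖∫ x, f x ∂μ‖ₑ ^ 2 ≤ _ := pow_le_pow_left' (h1.trans h2) 2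
    _ = _ := by rw [mul_pow, h3, eLpNorm_two_sq, mul_comm]

/-- The phase is constant on each sphere and factors out of the angular integral, which leaves a
one-dimensional oscillatory integral. -/
theorem integral_radialPhase {φ : ℝ → ℝ} (hφm : Measurable φ)
    {g : Space5 → ℂ} (hg : Integrable g) (t : ℝ) :
    ∫ ζ, Complex.exp ((2 * π * t * φ ‖ζ‖ : ℝ) * Complex.I) * g ζ =
      ∫ r in Ioi (0 : ℝ), Complex.exp ((2 * π * t * φ r : ℝ) * Complex.I) *
        ((r ^ 4 : ℝ) • ∫ ω, g (r • (ω : Space5)) ∂surf) := by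
  rw [integral_polar]
  · refine setIntegral_congr_fun measurableSet_Ioi fun r hr => ?_
    have hr' : 0 ≤ r := le_of_lt hr
    simp only [norm_smul, norm_eq_of_mem_sphere, mul_one, Real.norm_of_nonneg hr',
      integral_const_mul, Complex.real_smul]
    ring
  · refine hg.bdd_mul (c := 1) (Measurable.aestronglyMeasurable (by fun_prop)) (Filter.Eventually.of_forall fun ζ => ?_)
    rw [Complex.norm_exp_ofReal_mul_I]

/-- Plancherel's theorem in time for an integral over `ℝ⁵` with a radial phase. -/
theorem lintegral_radialPhase_sq_eq {φ φ' : ℝ → ℝ} (hφm : Measurable φ) (hφ'm : Measurable φ')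
    (hφ : ∀ r ∈ Ioi (0 : ℝ), HasDerivAt φ (φ' r) r) (hφ' : ∀ r ∈ Ioi (0 : ℝ), 0 < φ' r)
    {g : Space5 → ℂ} (hgm : Measurable g) (hg : Integrable g)
    (hfin : ∫⁻ ζ, ENNReal.ofReal (‖ζ‖ ^ 4 / φ' ‖ζ‖) * ‖g ζ‖ₑ ^ 2 ≠ ∞) :
    ∫⁻ t : ℝ, ‖∫ ζ, Complex.exp ((2 * π * t * φ ‖ζ‖ : ℝ) * Complex.I) * g ζ‖ₑ ^ 2 =
      ∫⁻ r in Ioi (0 : ℝ), ENNReal.ofReal (r ^ 4) * (ENNReal.ofReal (r ^ 4 / φ' r) *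
        ‖∫ ω, g (r • (ω : Space5)) ∂surf‖ₑ ^ 2) ∧
    ∫⁻ t : ℝ, ‖∫ ζ, Complex.exp ((2 * π * t * φ ‖ζ‖ : ℝ) * Complex.I) * g ζ‖ₑ ^ 2 ≤
      surf univ * ∫⁻ ζ, ENNReal.ofReal (‖ζ‖ ^ 4 / φ' ‖ζ‖) * ‖g ζ‖ₑ ^ 2 := by
  have hpt : ∀ r ∈ Ioi (0 : ℝ), ‖(r ^ 4 : ℝ) • ∫ ω, g (r • (ω : Space5)) ∂surf‖ₑ ^ 2 /
      ENNReal.ofReal (φ' r) = ENNReal.ofReal (r ^ 4) * (ENNReal.ofReal (r ^ 4 / φ' r) *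
        ‖∫ ω, g (r • (ω : Space5)) ∂surf‖ₑ ^ 2) := by
    intro r hr
    have h4 : (0 : ℝ) ≤ r ^ 4 := by positivity
    rw [enorm_smul, Real.enorm_of_nonneg h4, ENNReal.ofReal_div_of_pos (hφ' r hr), mul_pow,
      ENNReal.div_eq_inv_mul, ENNReal.div_eq_inv_mul]
    ring
  have hle : ∫⁻ r in Ioi (0 : ℝ), ENNReal.ofReal (r ^ 4) * (ENNReal.ofReal (r ^ 4 / φ' r) *
        ‖∫ ω, g (r • (ω : Space5)) ∂surf‖ₑ ^ 2) ≤
      surf univ * ∫⁻ ζ, ENNReal.ofReal (‖ζ‖ ^ 4 / φ' ‖ζ‖) * ‖g ζ‖ₑ ^ 2 := by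
    rw [lintegral_polar (by fun_prop), ← lintegral_const_mul' _ _ (measure_ne_top _ _)]
    refine setLIntegral_mono' measurableSet_Ioi fun r hr => ?_
    have hr' : 0 ≤ r := le_of_lt hr
    simp only [norm_smul, norm_eq_of_mem_sphere, mul_one, Real.norm_of_nonneg hr']
    rw [lintegral_const_mul _ (by fun_prop)]
    calc _ ≤ ENNReal.ofReal (r ^ 4) * (ENNReal.ofReal (r ^ 4 / φ' r) *
        (surf univ * ∫⁻ ω, ‖g (r • (ω : Space5))‖ₑ ^ 2 ∂surf)) := by
          gcongr
          exact enorm_integral_sq_le surf (by fun_prop)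
      _ = _ := by ring
  have heq : ∫⁻ t : ℝ, ‖∫ ζ, Complex.exp ((2 * π * t * φ ‖ζ‖ : ℝ) * Complex.I) * g ζ‖ₑ ^ 2 =
      ∫⁻ r in Ioi (0 : ℝ), ENNReal.ofReal (r ^ 4) * (ENNReal.ofReal (r ^ 4 / φ' r) *
        ‖∫ ω, g (r • (ω : Space5)) ∂surf‖ₑ ^ 2) := by
    simp_rw [integral_radialPhase hφm hg]
    rw [lintegral_oscillatory_halfLine_sq hφ hφ' (integrableOn_polar hg),
      setLIntegral_congr_fun measurableSet_Ioi hpt]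
    rw [setLIntegral_congr_fun measurableSet_Ioi hpt]
    -- Plancherel on the half line asks for finiteness, which the Cauchy-Schwarz bound `hle`
    -- supplies.
    exact ne_top_of_le_ne_top (ENNReal.mul_ne_top (measure_ne_top _ _) hfin) hle
  exact ⟨heq, heq ▸ hle⟩

/-- For a radial amplitude the time Plancherel estimate is an identity. -/
theorem lintegral_radialPhase_sq_eq_of_radial {φ φ' : ℝ → ℝ} (hφm : Measurable φ)
    (hφ'm : Measurable φ')
    (hφ : ∀ r ∈ Ioi (0 : ℝ), HasDerivAt φ (φ' r) r) (hφ' : ∀ r ∈ Ioi (0 : ℝ), 0 < φ' r)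
    {g : ℝ → ℂ} (hgm : Measurable g) (hg : Integrable fun ζ : Space5 => g ‖ζ‖)
    (hfin : ∫⁻ ζ : Space5, ENNReal.ofReal (‖ζ‖ ^ 4 / φ' ‖ζ‖) * ‖g ‖ζ‖‖ₑ ^ 2 ≠ ∞) :
    ∫⁻ t : ℝ, ‖∫ ζ : Space5, Complex.exp ((2 * π * t * φ ‖ζ‖ : ℝ) * Complex.I) * g ‖ζ‖‖ₑ ^ 2 =
      surf univ * ∫⁻ ζ : Space5, ENNReal.ofReal (‖ζ‖ ^ 4 / φ' ‖ζ‖) * ‖g ‖ζ‖‖ₑ ^ 2 := by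
  rw [(lintegral_radialPhase_sq_eq hφm hφ'm hφ hφ' (by fun_prop) hg hfin).1,
    lintegral_polar (by fun_prop), ← lintegral_const_mul' _ _ (measure_ne_top _ _)]
  refine setLIntegral_congr_fun measurableSet_Ioi fun r hr => ?_
  have hr' : 0 ≤ r := le_of_lt hr
  simp only [norm_smul, norm_eq_of_mem_sphere, mul_one, Real.norm_of_nonneg hr',
    integral_const, lintegral_const]
  rw [enorm_smul, ← ofReal_norm, Real.norm_of_nonneg measureReal_nonneg, Measure.real,
    ENNReal.ofReal_toReal (measure_ne_top _ _), mul_pow]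
  ring

end RadialPlancherel

/-! ### The Lorentz boost between the centre of mass frame and total momentum `k`. -/

noncomputable section LorentzBoost

open Set

/-- The symbol `√(1 + |2πξ|²)`. -/
def jap (ξ : Space5) : ℝ := √(1 + (2 * π * ‖ξ‖) ^ 2)

theorem jap_sq (ξ : Space5) : jap ξ ^ 2 = 1 + 4 * π ^ 2 * ‖ξ‖ ^ 2 := by
  rw [jap, Real.sq_sqrt (by positivity)]; ring

theorem one_le_jap (ξ : Space5) : 1 ≤ jap ξ := by
  rw [jap, Real.one_le_sqrt]; nlinarith [sq_nonneg (2 * π * ‖ξ‖)]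

theorem jap_pos (ξ : Space5) : 0 < jap ξ := one_pos.trans_le (one_le_jap ξ)

theorem continuous_jap : Continuous jap := by unfold jap; fun_prop

@[fun_prop]
theorem measurable_jap : Measurable jap := continuous_jap.measurable

theorem jap_neg (ξ : Space5) : jap (-ξ) = jap ξ := by simp [jap]

theorem two_pi_norm_lt_jap (ξ : Space5) : 2 * π * ‖ξ‖ < jap ξ := by
  have := jap_sq ξ
  have := jap_pos ξ
  have : 0 ≤ 2 * π * ‖ξ‖ := by positivity
  nlinarith

/-- Half of the total energy of two particles with relative momentum `ζ` in their centre of mass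
frame and total momentum `k`. -/
def halfEnergy (k ζ : Space5) : ℝ := √(jap ζ ^ 2 + π ^ 2 * ‖k‖ ^ 2)

theorem halfEnergy_sq (k ζ : Space5) : halfEnergy k ζ ^ 2 = jap ζ ^ 2 + π ^ 2 * ‖k‖ ^ 2 :=
  Real.sq_sqrt (by positivity)

theorem halfEnergy_pos (k ζ : Space5) : 0 < halfEnergy k ζ :=
  Real.sqrt_pos.2 (by have := jap_pos ζ; positivity)

/-- The coefficient of the Lorentz boost. -/
def boostCoeff (k ζ : Space5) : ℝ := π ^ 2 / (jap ζ * (jap ζ + halfEnergy k ζ))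

/-- The relative momentum in the frame with total momentum `k`, as a function of the relative
momentum in the centre of mass frame. -/
def boost (k ζ : Space5) : Space5 := ζ + (boostCoeff k ζ * inner ℝ k ζ) • k

/-- With `E = jap ζ` and `T = halfEnergy k ζ`, factor `π²‖k‖² = T² - E²` as `(T - E)(T + E)`. So the
boost stretches the component along `k` by the Lorentz factor `T / E` and fixes the orthogonal
components. -/
theorem one_add_boostCoeff_mul (k ζ : Space5) :
    boostCoeff k ζ * ‖k‖ ^ 2 = halfEnergy k ζ / jap ζ - 1 := by
  have h1 := jap_pos ζ
  have h2 := halfEnergy_pos k ζ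
  have h3 := halfEnergy_sq k ζ
  rw [boostCoeff]
  field_simp
  linarith

theorem inner_boost (k ζ : Space5) :
    inner ℝ k (boost k ζ) = inner ℝ k ζ * halfEnergy k ζ / jap ζ := by
  have h := one_add_boostCoeff_mul k ζ
  rw [boost, inner_add_right, inner_smul_right, real_inner_self_eq_norm_sq]
  linear_combination (inner ℝ k ζ) * h

theorem norm_boost_sq (k ζ : Space5) :
    ‖boost k ζ‖ ^ 2 = ‖ζ‖ ^ 2 + π ^ 2 * (inner ℝ k ζ) ^ 2 / jap ζ ^ 2 := by
  have h1 := jap_pos ζ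
  have h2 := halfEnergy_pos k ζ
  have h := one_add_boostCoeff_mul k ζ
  have hc : boostCoeff k ζ * (halfEnergy k ζ / jap ζ + 1) = π ^ 2 / jap ζ ^ 2 := by
    rw [boostCoeff]; field_simp; ring
  rw [boost, norm_add_sq_real, inner_smul_right, norm_smul, mul_pow, Real.norm_eq_abs, sq_abs,
    real_inner_comm k ζ]
  linear_combination (boostCoeff k ζ * (inner ℝ k ζ) ^ 2) * h + (inner ℝ k ζ) ^ 2 * hc

/-- Cauchy-Schwarz together with `4π²‖ζ‖² = jap ζ ^ 2 - 1`. It makes the candidate energies of both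
particles positive, so they can be identified by comparing squares. -/
theorem abs_two_pi_inner_div_lt (k ζ : Space5) :
    |2 * π ^ 2 * inner ℝ k ζ / jap ζ| < halfEnergy k ζ := by
  have h1 := jap_pos ζ
  have h2 := halfEnergy_pos k ζ
  refine abs_lt_of_sq_lt_sq ?_ h2.le
  have hcs : (inner ℝ k ζ) ^ 2 ≤ ‖k‖ ^ 2 * ‖ζ‖ ^ 2 := by
    rw [← mul_pow, ← sq_abs]
    exact pow_le_pow_left₀ (abs_nonneg _) (abs_real_inner_le_norm k ζ) 2
  rw [halfEnergy_sq, div_pow, div_lt_iff₀ (by positivity), mul_pow]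
  have h3 := jap_sq ζ
  have h4 : 4 * π ^ 4 * (inner ℝ k ζ) ^ 2 ≤ 4 * π ^ 4 * (‖k‖ ^ 2 * ‖ζ‖ ^ 2) := by gcongr
  have h5 : 4 * π ^ 4 * (‖k‖ ^ 2 * ‖ζ‖ ^ 2) = π ^ 2 * ‖k‖ ^ 2 * (jap ζ ^ 2 - 1) := by
    rw [h3]; ring
  nlinarith [sq_nonneg (π * ‖k‖), pow_pos h1 4]

theorem jap_sq_half_add (k η : Space5) :
    jap ((1 / 2 : ℝ) • k + η) ^ 2 = 1 + π ^ 2 * ‖k‖ ^ 2 + 4 * π ^ 2 * inner ℝ k η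
      + 4 * π ^ 2 * ‖η‖ ^ 2 := by
  rw [jap_sq, norm_add_sq_real, inner_smul_left, norm_smul, mul_pow]
  simp only [map_div₀, map_one, map_ofNat, Real.norm_eq_abs, sq_abs]
  norm_num; ring

theorem jap_sq_half_sub (k η : Space5) :
    jap ((1 / 2 : ℝ) • k - η) ^ 2 = 1 + π ^ 2 * ‖k‖ ^ 2 - 4 * π ^ 2 * inner ℝ k η
      + 4 * π ^ 2 * ‖η‖ ^ 2 := by
  rw [sub_eq_add_neg, jap_sq_half_add, inner_neg_right, norm_neg]; ring

/-- The two energies differ from `halfEnergy` by opposite amounts, so their sum depends on `ζ` only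
through `‖ζ‖`. This is what the change of variables is for. -/
theorem jap_half_add_boost (k ζ : Space5) :
    jap ((1 / 2 : ℝ) • k + boost k ζ) =
      halfEnergy k ζ + 2 * π ^ 2 * inner ℝ k ζ / jap ζ := by
  have h1 := jap_pos ζ
  have h2 := abs_lt.1 (abs_two_pi_inner_div_lt k ζ)
  refine (pow_left_inj₀ (jap_pos _).le (by linarith) two_ne_zero).1 ?_
  rw [jap_sq_half_add, inner_boost, norm_boost_sq, add_sq, halfEnergy_sq]
  linear_combination -jap_sq ζ

theorem jap_half_sub_boost (k ζ : Space5) :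
    jap ((1 / 2 : ℝ) • k - boost k ζ) =
      halfEnergy k ζ - 2 * π ^ 2 * inner ℝ k ζ / jap ζ := by
  have h1 := jap_pos ζ
  have h2 := abs_lt.1 (abs_two_pi_inner_div_lt k ζ)
  refine (pow_left_inj₀ (jap_pos _).le (by linarith) two_ne_zero).1 ?_
  rw [jap_sq_half_sub, inner_boost, norm_boost_sq, sub_sq, halfEnergy_sq]
  linear_combination -jap_sq ζ

/-- The sum of the two energies determines `halfEnergy`, hence `jap ζ`; their difference then
determines `inner ℝ k ζ`. So the multiple of `k` that was added to `ζ` is known and can be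
subtracted. -/
theorem boost_injective (k : Space5) : Function.Injective (boost k) := by
  intro ζ₁ ζ₂ h
  have ha := jap_half_add_boost k ζ₁
  have hb := jap_half_sub_boost k ζ₁
  rw [h, jap_half_add_boost] at ha
  rw [h, jap_half_sub_boost] at hb
  have hT : halfEnergy k ζ₂ = halfEnergy k ζ₁ := by linarith
  have hE : jap ζ₂ = jap ζ₁ := by
    refine (pow_left_inj₀ (jap_pos _).le (jap_pos _).le two_ne_zero).1 ?_
    have h1 := halfEnergy_sq k ζ₁
    have h2 := halfEnergy_sq k ζ₂
    rw [hT] at h2; linarith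
  have hp : inner ℝ k ζ₂ = inner ℝ k ζ₁ := by
    have h1 := jap_pos ζ₁
    have h3 : 2 * π ^ 2 * inner ℝ k ζ₂ / jap ζ₁ = 2 * π ^ 2 * inner ℝ k ζ₁ / jap ζ₁ := by
      rw [hE] at ha; linarith
    field_simp at h3
    exact h3
  have hc : boostCoeff k ζ₂ = boostCoeff k ζ₁ := by rw [boostCoeff, boostCoeff, hE, hT]
  simp only [boost, hc, hp] at h
  exact add_right_cancel h

/-- Cauchy-Schwarz for the vectors `(1, 2πx)` and `(1, 2πy)`. With `-y` for `y` it says that two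
points of the mass hyperboloid have Lorentz product at least one. -/
theorem one_add_inner_le_jap_mul (x y : Space5) :
    1 + 4 * π ^ 2 * inner ℝ x y ≤ jap x * jap y := by
  have h := real_inner_le_norm x y
  refine le_trans (b := 1 + (2 * π * ‖x‖) * (2 * π * ‖y‖)) ?_ ?_
  · have : 0 < 4 * π ^ 2 := by positivity
    nlinarith
  · refine le_of_sq_le_sq ?_ (mul_pos (jap_pos _) (jap_pos _)).le
    rw [mul_pow, jap_sq, jap_sq]
    nlinarith [sq_nonneg (2 * π * ‖x‖ - 2 * π * ‖y‖)]

theorem boost_surjective (k : Space5) : Function.Surjective (boost k) := by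
  intro η
  set w₁ := jap ((1 / 2 : ℝ) • k + η) with hw₁
  set w₂ := jap ((1 / 2 : ℝ) • k - η) with hw₂
  have h1 : w₁ ^ 2 = _ := jap_sq_half_add k η
  have h2 : w₂ ^ 2 = _ := jap_sq_half_sub k η
  have hp1 : 0 < w₁ := jap_pos _
  have hp2 : 0 < w₂ := jap_pos _
  set T := (w₁ + w₂) / 2 with hT
  have hTp : 0 < T := by positivity
  have h12 : 1 + π ^ 2 * ‖k‖ ^ 2 - 4 * π ^ 2 * ‖η‖ ^ 2 ≤ w₁ * w₂ := by
    have := one_add_inner_le_jap_mul ((1 / 2 : ℝ) • k + η) ((1 / 2 : ℝ) • k - η)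
    rw [inner_add_left, inner_sub_right, inner_sub_right, inner_smul_left, inner_smul_right,
      inner_smul_left, inner_smul_right, real_inner_self_eq_norm_sq, real_inner_self_eq_norm_sq,
      real_inner_comm k η] at this
    simp only [map_div₀, map_one, map_ofNat] at this
    linarith
  -- This keeps the radicand defining `E`, the energy of each particle in the centre of mass frame,
  -- at least one.
  have hTge : 1 + π ^ 2 * ‖k‖ ^ 2 ≤ T ^ 2 := by rw [hT]; nlinarith
  set E := √(T ^ 2 - π ^ 2 * ‖k‖ ^ 2) with hE
  have hEsq : E ^ 2 = T ^ 2 - π ^ 2 * ‖k‖ ^ 2 := Real.sq_sqrt (by linarith)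
  have hEp : 0 < E := Real.sqrt_pos.2 (by linarith)
  -- The value `inner ℝ k ζ` must take at the preimage `ζ`, solved from the formula for the
  -- difference of the two energies.
  set p := (w₁ - w₂) * E / (4 * π ^ 2) with hp
  set c := π ^ 2 / (E * (E + T)) with hc
  have hπ := Real.pi_pos
  have hck : c * ‖k‖ ^ 2 = T / E - 1 := by
    rw [hc]; field_simp; linarith
  have hkη : inner ℝ k η = p * T / E := by
    rw [hp, hT]; field_simp; nlinarith
  have hip : inner ℝ k (η - (c * p) • k) = p := by
    rw [inner_sub_right, inner_smul_right, real_inner_self_eq_norm_sq]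
    linear_combination hkη - p * hck
  have hcT : c * (T / E + 1) = π ^ 2 / E ^ 2 := by rw [hc]; field_simp; ring
  have hn : ‖η - (c * p) • k‖ ^ 2 = ‖η‖ ^ 2 - π ^ 2 * p ^ 2 / E ^ 2 := by
    rw [norm_sub_sq_real, inner_smul_right, norm_smul, mul_pow, Real.norm_eq_abs, sq_abs,
      real_inner_comm]
    linear_combination -2 * c * p * hkη + c * p ^ 2 * hck - p ^ 2 * hcT
  have hd : w₁ - w₂ = 4 * π ^ 2 * p / E := by rw [hp]; field_simp
  have hj : jap (η - (c * p) • k) = E := by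
    refine (pow_left_inj₀ (jap_pos _).le hEp.le two_ne_zero).1 ?_
    rw [jap_sq, hn]
    have hs : (w₁ ^ 2 + w₂ ^ 2) / 2 = T ^ 2 + ((w₁ - w₂) / 2) ^ 2 := by rw [hT]; ring
    rw [hd, h1, h2] at hs
    have : (4 * π ^ 2 * p / E / 2) ^ 2 = 4 * π ^ 2 * (π ^ 2 * p ^ 2 / E ^ 2) := by
      field_simp; ring
    rw [this] at hs
    linarith
  have hh : halfEnergy k (η - (c * p) • k) = T := by
    refine (pow_left_inj₀ (halfEnergy_pos _ _).le hTp.le two_ne_zero).1 ?_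
    rw [halfEnergy_sq, hj, hEsq]; ring
  refine ⟨η - (c * p) • k, ?_⟩
  rw [boost, boostCoeff, hj, hh, hip]
  exact sub_add_cancel _ _

/-- The Jacobian determinant of the boost. -/
def boostJac (k ζ : Space5) : ℝ :=
  (halfEnergy k ζ ^ 2 - (2 * π ^ 2 * inner ℝ k ζ / jap ζ) ^ 2) / (jap ζ * halfEnergy k ζ)

/-- With `w₁`, `w₂` the energies of the pair, this reads `T dη / (w₁ w₂) = dζ / E`. The factor `w₁
w₂` is what later produces the energy weights. -/
theorem boostJac_eq (k ζ : Space5) :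
    boostJac k ζ = jap ((1 / 2 : ℝ) • k + boost k ζ) * jap ((1 / 2 : ℝ) • k - boost k ζ) /
      (jap ζ * halfEnergy k ζ) := by
  rw [jap_half_add_boost, jap_half_sub_boost, boostJac]; ring

theorem boostJac_pos (k ζ : Space5) : 0 < boostJac k ζ := by
  rw [boostJac_eq]
  have := jap_pos ζ
  have := halfEnergy_pos k ζ
  have := jap_pos ((1 / 2 : ℝ) • k + boost k ζ)
  have := jap_pos ((1 / 2 : ℝ) • k - boost k ζ)
  positivity

/-- The gradient of the coefficient of `k` in the boost. -/
def boostGrad (k ζ : Space5) : Space5 :=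
  boostCoeff k ζ • k - (4 * π ^ 4 * inner ℝ k ζ / (jap ζ ^ 3 * halfEnergy k ζ)) • ζ

/-- Only the coefficient of the fixed vector `k` varies nonlinearly, so the differential is a
rank-one perturbation of the identity. -/
theorem hasFDerivAt_boost (k ζ : Space5) :
    HasFDerivAt (boost k) (ContinuousLinearMap.id ℝ Space5 +
      (innerSL ℝ (boostGrad k ζ)).smulRight k) ζ := by
  have hE := jap_pos ζ
  have hT := halfEnergy_pos k ζ
  have hn : HasFDerivAt (fun z : Space5 => ‖z‖ ^ 2) ((2 : ℝ) • innerSL ℝ ζ) ζ := by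
    have := (hasStrictFDerivAt_norm_sq ζ).hasFDerivAt
    refine this.congr_fderiv ?_
    ext v; simp
  -- The coefficient depends on `ζ` only through `s = ‖ζ‖²`, which is smooth at the origin as well.
  have hs : HasDerivAt (fun s : ℝ => π ^ 2 / (√(1 + 4 * π ^ 2 * s) * (√(1 + 4 * π ^ 2 * s) +
      √(1 + 4 * π ^ 2 * s + π ^ 2 * ‖k‖ ^ 2)))) (-(2 * π ^ 4 / (jap ζ ^ 3 * halfEnergy k ζ)))
      (‖ζ‖ ^ 2) := by
    have e1 : √(1 + 4 * π ^ 2 * ‖ζ‖ ^ 2) = jap ζ := by rw [jap]; congr 1; ring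
    have e2 : √(1 + 4 * π ^ 2 * ‖ζ‖ ^ 2 + π ^ 2 * ‖k‖ ^ 2) = halfEnergy k ζ := by
      rw [halfEnergy, jap_sq]
    have d1 : HasDerivAt (fun s : ℝ => 1 + 4 * π ^ 2 * s) (4 * π ^ 2) (‖ζ‖ ^ 2) := by
      simpa using ((hasDerivAt_id (‖ζ‖ ^ 2)).const_mul (4 * π ^ 2)).const_add 1
    have d2 := d1.sqrt (by positivity)
    have d3 := (d1.add_const (π ^ 2 * ‖k‖ ^ 2)).sqrt (by positivity)
    have d4 := (hasDerivAt_const (‖ζ‖ ^ 2) (π ^ 2)).div (d2.mul (d2.add d3))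
      (by
        have : 0 < √(1 + 4 * π ^ 2 * ‖ζ‖ ^ 2) * (√(1 + 4 * π ^ 2 * ‖ζ‖ ^ 2) +
          √(1 + 4 * π ^ 2 * ‖ζ‖ ^ 2 + π ^ 2 * ‖k‖ ^ 2)) := by rw [e1, e2]; positivity
        exact this.ne')
    refine d4.congr_deriv ?_
    simp only [Pi.mul_apply, Pi.add_apply, e1, e2]
    field_simp
    ring
  have hc : HasFDerivAt (boostCoeff k)
      ((-(4 * π ^ 4 / (jap ζ ^ 3 * halfEnergy k ζ))) • innerSL ℝ ζ) ζ := by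
    have := hs.comp_hasFDerivAt ζ hn
    have e : boostCoeff k = (fun s : ℝ => π ^ 2 / (√(1 + 4 * π ^ 2 * s) * (√(1 + 4 * π ^ 2 * s) +
      √(1 + 4 * π ^ 2 * s + π ^ 2 * ‖k‖ ^ 2)))) ∘ fun z : Space5 => ‖z‖ ^ 2 := by
      ext z
      simp only [Function.comp, boostCoeff, halfEnergy, jap_sq]
      have e1 : √(1 + 4 * π ^ 2 * ‖z‖ ^ 2) = jap z := by rw [jap]; congr 1; ring
      rw [e1]
    rw [e]
    refine this.congr_fderiv ?_
    ext v; simp only [smul_apply, smul_eq_mul]; ring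
  have hi : HasFDerivAt (fun z : Space5 => inner ℝ k z) (innerSL ℝ k) ζ :=
    (innerSL ℝ k).hasFDerivAt
  refine ((hasFDerivAt_id ζ).add ((hc.mul hi).smul_const k)).congr_fderiv ?_
  ext1 v
  simp only [boostGrad, add_apply, ContinuousLinearMap.smulRight_apply,
    smul_apply, innerSL_apply_apply, smul_eq_mul, inner_sub_left,
    inner_smul_left, RCLike.conj_to_real]
  congr 2
  ring

theorem det_fderiv_boost (k ζ : Space5) :
    (ContinuousLinearMap.id ℝ Space5 +
      (innerSL ℝ (boostGrad k ζ)).smulRight k : Space5 →L[ℝ] Space5).det = boostJac k ζ := by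
  -- A rank-one perturbation of the identity has determinant `1 + ⟨boostGrad k ζ, k⟩`.
  have h := LinearMap.transvection.det (R := ℝ) (V := Space5)
    ((innerSL ℝ (boostGrad k ζ)) : Space5 →ₗ[ℝ] ℝ) k
  have e : ((ContinuousLinearMap.id ℝ Space5 +
      (innerSL ℝ (boostGrad k ζ)).smulRight k : Space5 →L[ℝ] Space5) : Space5 →ₗ[ℝ] Space5) =
      LinearMap.transvection ((innerSL ℝ (boostGrad k ζ)) : Space5 →ₗ[ℝ] ℝ) k := by
    ext1 v; simp [LinearMap.transvection.apply]
  rw [ContinuousLinearMap.det, e, h]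
  have hE := jap_pos ζ
  have hT := halfEnergy_pos k ζ
  have h1 := one_add_boostCoeff_mul k ζ
  simp only [ContinuousLinearMap.coe_coe, innerSL_apply_apply, boostGrad, inner_sub_left,
    inner_smul_left, real_inner_self_eq_norm_sq, RCLike.conj_to_real, real_inner_comm k ζ]
  rw [h1, boostJac]
  have : inner ℝ k ζ = inner ℝ ζ k := real_inner_comm _ _
  field_simp
  ring_nf

theorem image_boost_univ (k : Space5) : boost k '' univ = univ := by
  rw [image_univ, (boost_surjective k).range_eq]

theorem lintegral_boost (k : Space5) (f : Space5 → ℝ≥0∞) :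
    ∫⁻ η, f η = ∫⁻ ζ, ENNReal.ofReal (boostJac k ζ) * f (boost k ζ) := by
  have := lintegral_image_eq_lintegral_abs_det_fderiv_mul (volume : Measure Space5)
    MeasurableSet.univ (fun ζ _ => (hasFDerivAt_boost k ζ).hasFDerivWithinAt)
    (boost_injective k).injOn f
  rw [image_boost_univ] at this
  simpa only [Measure.restrict_univ, det_fderiv_boost, abs_of_pos (boostJac_pos _ _)] using this

theorem integral_boost (k : Space5) (f : Space5 → ℂ) :
    ∫ η, f η = ∫ ζ, (boostJac k ζ : ℂ) * f (boost k ζ) := by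
  have := integral_image_eq_integral_abs_det_fderiv_smul (volume : Measure Space5)
    MeasurableSet.univ (fun ζ _ => (hasFDerivAt_boost k ζ).hasFDerivWithinAt)
    (boost_injective k).injOn f
  rw [image_boost_univ] at this
  simpa only [Measure.restrict_univ, det_fderiv_boost, abs_of_pos (boostJac_pos _ _),
    Complex.real_smul] using this

theorem integrable_boost (k : Space5) (f : Space5 → ℂ) :
    Integrable f ↔ Integrable fun ζ => (boostJac k ζ : ℂ) * f (boost k ζ) := by
  have := integrableOn_image_iff_integrableOn_abs_det_fderiv_smul (volume : Measure Space5)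
    MeasurableSet.univ (fun ζ _ => (hasFDerivAt_boost k ζ).hasFDerivWithinAt)
    (boost_injective k).injOn f
  rw [image_boost_univ] at this
  simpa only [integrableOn_univ, det_fderiv_boost, abs_of_pos (boostJac_pos _ _),
    Complex.real_smul] using this

end LorentzBoost

/-! ### The bilinear estimate for one half wave. -/

noncomputable section BilinearEstimate

open Set

/-- Amplitudes for which all the oscillatory integrals below converge absolutely. -/
structure NiceAmplitude (F : Space5 → ℂ) : Prop where
  measurable : Measurable F
  bounded : ∃ C : ℝ, ∀ ξ, ‖F ξ‖ ≤ C
  integrable_weighted : Integrable fun ξ => jap ξ ^ 2 * ‖F ξ‖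

/-- The Fourier transform at time `t` of the half wave with amplitude `F`. -/
def evolve (t : ℝ) (F : Space5 → ℂ) (ξ : Space5) : ℂ :=
  Complex.exp ((t * jap ξ : ℝ) * Complex.I) * F ξ

/-- The solution `e^{it√(1-Δ)}f` with `f` of Fourier transform `F`. -/
def halfWave (F : Space5 → ℂ) (t : ℝ) (x : Space5) : ℂ := 𝓕⁻ (evolve t F) x

theorem norm_evolve (t : ℝ) (F : Space5 → ℂ) (ξ : Space5) : ‖evolve t F ξ‖ = ‖F ξ‖ := by
  rw [evolve, norm_mul, Complex.norm_exp_ofReal_mul_I, one_mul]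

theorem measurable_evolve {F : Space5 → ℂ} (hF : Measurable F) (t : ℝ) :
    Measurable (evolve t F) := by
  unfold evolve; fun_prop

namespace NiceAmplitude

variable {F : Space5 → ℂ}

theorem integrable (hF : NiceAmplitude F) : Integrable F := by
  refine hF.integrable_weighted.mono hF.measurable.aestronglyMeasurable
    (Filter.Eventually.of_forall fun ξ => ?_)
  have h := one_le_jap ξ
  rw [Real.norm_of_nonneg (by positivity)]
  nlinarith [norm_nonneg (F ξ), mul_nonneg (norm_nonneg (F ξ)) (sub_nonneg.2 h)]

theorem evolve (hF : NiceAmplitude F) (t : ℝ) : NiceAmplitude (evolve t F) where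
  measurable := measurable_evolve hF.measurable t
  bounded := by simpa only [norm_evolve] using hF.bounded
  integrable_weighted := by simpa only [norm_evolve] using hF.integrable_weighted

theorem memLp_two (hF : NiceAmplitude F) : MemLp F 2 := by
  obtain ⟨C, hC⟩ := hF.bounded
  exact memLp_two_of_integrable_of_bound hF.integrable hC

theorem integrable_fconv {G : Space5 → ℂ} (hF : NiceAmplitude F) (hG : NiceAmplitude G) :
    Integrable (fconv F G) := _root_.integrable_fconv hF.integrable hG.integrable

theorem memLp_fconv {G : Space5 → ℂ} (hF : NiceAmplitude F) (hG : NiceAmplitude G) :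
    MemLp (fconv F G) 2 := by
  obtain ⟨C, hC⟩ := hG.bounded
  exact memLp_two_of_integrable_of_bound (hF.integrable_fconv hG)
    (norm_fconv_le hF.integrable hC)

theorem continuous_halfWave (hF : NiceAmplitude F) :
    Continuous fun p : ℝ × Space5 => halfWave F p.1 p.2 := by
  unfold halfWave
  simp_rw [Real.fourierInv_eq]
  refine continuous_of_dominated (bound := fun ξ => ‖F ξ‖) (fun p => ?_) (fun p => ?_)
    hF.integrable.norm (Filter.Eventually.of_forall fun ξ => ?_)
  · exact ((Real.fourierIntegral_convergent_iff (-p.2)).2 (hF.evolve p.1).integrable).1.congr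
      (Filter.Eventually.of_forall fun ξ => by simp)
  · exact Filter.Eventually.of_forall fun ξ => by rw [Circle.norm_smul, norm_evolve]
  · unfold _root_.evolve
    simp only [Circle.smul_def, Real.fourierChar_apply]
    fun_prop

end NiceAmplitude

/-- The Lorentz product of the two space-time frequencies above `y` and `z`. -/
def lorentzProd (y z : Space5) : ℝ := jap y * jap z - 4 * π ^ 2 * inner ℝ y z

theorem one_le_lorentzProd (y z : Space5) : 1 ≤ lorentzProd y z := by
  have := one_add_inner_le_jap_mul y z
  rw [lorentzProd]; linarith

theorem continuous_lorentzProd : Continuous fun p : Space5 × Space5 => lorentzProd p.1 p.2 := by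
  unfold lorentzProd
  have := continuous_jap
  fun_prop

/-- Lorentz invariance: in the centre of mass frame the momenta are `ζ` and `-ζ` with equal
energies, whose product is `jap ζ ^ 2 + 4π²‖ζ‖²`. -/
theorem lorentzProd_boost (k ζ : Space5) :
    lorentzProd ((1 / 2 : ℝ) • k + boost k ζ) ((1 / 2 : ℝ) • k - boost k ζ) =
      2 * jap ζ ^ 2 - 1 := by
  have h1 := jap_sq_half_add k (boost k ζ)
  have h2 := jap_sq_half_sub k (boost k ζ)
  have h3 := jap_half_add_boost k ζ
  have h4 := jap_half_sub_boost k ζ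
  have h5 := halfEnergy_sq k ζ
  have h6 : (jap ((1 / 2 : ℝ) • k + boost k ζ) + jap ((1 / 2 : ℝ) • k - boost k ζ)) ^ 2 =
    4 * (jap ζ ^ 2 + π ^ 2 * ‖k‖ ^ 2) := by rw [h3, h4, ← h5]; ring
  have h7 : inner ℝ ((1 / 2 : ℝ) • k + boost k ζ) ((1 / 2 : ℝ) • k - boost k ζ) =
      ‖k‖ ^ 2 / 4 - ‖boost k ζ‖ ^ 2 := by
    rw [inner_add_left, inner_sub_right, inner_sub_right, inner_smul_left, inner_smul_right,
      inner_smul_left, inner_smul_right, real_inner_self_eq_norm_sq, real_inner_self_eq_norm_sq,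
      real_inner_comm k (boost k ζ)]
    simp only [map_div₀, map_one, map_ofNat]
    ring
  rw [lorentzProd, h7]
  linear_combination (1 / 2 : ℝ) * h6 - (1 / 2 : ℝ) * h1 - (1 / 2 : ℝ) * h2

/-- The weight which the Cauchy-Schwarz inequality on the spheres of the centre of mass frame
produces. -/
def pairWeight (k ζ : Space5) : ℝ :=
  jap ((1 / 2 : ℝ) • k + boost k ζ) * jap ((1 / 2 : ℝ) • k - boost k ζ) *
    (‖ζ‖ ^ 3 / (4 * π * jap ζ))

/-- By invariance `lorentzProd - 1` is `2 (2π‖ζ‖)²`, so the claim reduces to `2π‖ζ‖ ≤ jap ζ`. The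
ratio of the two sides tends to one at high frequency, so the constant is not lost. -/
theorem pairWeight_le (k ζ : Space5) :
    pairWeight k ζ ≤ jap ((1 / 2 : ℝ) • k + boost k ζ) * jap ((1 / 2 : ℝ) • k - boost k ζ) *
      (lorentzProd ((1 / 2 : ℝ) • k + boost k ζ) ((1 / 2 : ℝ) • k - boost k ζ) - 1) /
        (64 * π ^ 4) := by
  have h1 := jap_pos ((1 / 2 : ℝ) • k + boost k ζ)
  have h2 := jap_pos ((1 / 2 : ℝ) • k - boost k ζ)
  rw [lorentzProd_boost, pairWeight, mul_div_assoc]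
  refine mul_le_mul_of_nonneg_left ?_ (by positivity)
  have h3 := jap_sq ζ
  have h4 := jap_pos ζ
  have h5 := two_pi_norm_lt_jap ζ
  have hπ := Real.pi_pos
  rw [h3, div_le_div_iff₀ (by positivity) (by positivity)]
  have : 0 ≤ 32 * π ^ 3 * ‖ζ‖ ^ 2 := by positivity
  nlinarith [mul_le_mul_of_nonneg_left h5.le this]

/-- The converse for sharpness: lowering `1` to `3` changes the weight by a lower-order term, which
ends up in the negligible half-order energy. -/
theorem le_pairWeight (k ζ : Space5) :
    jap ((1 / 2 : ℝ) • k + boost k ζ) * jap ((1 / 2 : ℝ) • k - boost k ζ) *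
      (lorentzProd ((1 / 2 : ℝ) • k + boost k ζ) ((1 / 2 : ℝ) • k - boost k ζ) - 3) /
        (64 * π ^ 4) ≤ pairWeight k ζ := by
  have h1 := jap_pos ((1 / 2 : ℝ) • k + boost k ζ)
  have h2 := jap_pos ((1 / 2 : ℝ) • k - boost k ζ)
  rw [lorentzProd_boost, pairWeight, mul_div_assoc]
  refine mul_le_mul_of_nonneg_left ?_ (by positivity)
  have h3 := jap_sq ζ
  have h4 := jap_pos ζ
  have h5 := two_pi_norm_lt_jap ζ
  have hπ := Real.pi_pos
  set r := 2 * π * ‖ζ‖ with hr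
  have hr0 : 0 ≤ r := by positivity
  have hE : jap ζ ^ 2 = 1 + r ^ 2 := by rw [h3, hr]; ring
  have hζ : ‖ζ‖ = r / (2 * π) := by rw [hr]; field_simp
  have key : (r ^ 2 - 1) * jap ζ ≤ r ^ 3 := by
    -- For `r² ≤ 1` the left side is nonpositive; otherwise squaring reduces the claim to `1 ≤ r⁴ +
    -- r²`.
    rcases le_or_gt (r ^ 2) 1 with h | h
    · have : (r ^ 2 - 1) * jap ζ ≤ 0 := mul_nonpos_of_nonpos_of_nonneg (by linarith) h4.le
      have : 0 ≤ r ^ 3 := by positivity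
      linarith
    · refine le_of_sq_le_sq ?_ (by positivity)
      rw [mul_pow, hE]
      nlinarith [sq_nonneg r]
  rw [hE, hζ]
  rw [div_le_div_iff₀ (by positivity) (by positivity)]
  have e : (r / (2 * π)) ^ 3 * (64 * π ^ 4) = 8 * π * r ^ 3 := by field_simp; ring
  rw [e]
  nlinarith [mul_le_mul_of_nonneg_left key hπ.le]

/-- The radial phase, with total momentum `k`. -/
def pairPhase (k : Space5) (r : ℝ) : ℝ := √(1 + 4 * π ^ 2 * r ^ 2 + π ^ 2 * ‖k‖ ^ 2) / π

/-- The derivative of the radial phase. -/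
def pairPhaseDeriv (k : Space5) (r : ℝ) : ℝ :=
  4 * π * r / √(1 + 4 * π ^ 2 * r ^ 2 + π ^ 2 * ‖k‖ ^ 2)

theorem pairPhase_norm (k ζ : Space5) : pairPhase k ‖ζ‖ = halfEnergy k ζ / π := by
  rw [pairPhase, halfEnergy, jap_sq]

theorem hasDerivAt_pairPhase (k : Space5) (r : ℝ) :
    HasDerivAt (pairPhase k) (pairPhaseDeriv k r) r := by
  have h : HasDerivAt (fun r : ℝ => 1 + 4 * π ^ 2 * r ^ 2 + π ^ 2 * ‖k‖ ^ 2)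
      (4 * π ^ 2 * (2 * r)) r := by
    simpa using (((hasDerivAt_pow 2 r).const_mul (4 * π ^ 2)).const_add 1).add_const
      (π ^ 2 * ‖k‖ ^ 2)
  have h2 := (h.sqrt (by positivity)).div_const π
  refine h2.congr_deriv ?_
  have : 0 < √(1 + 4 * π ^ 2 * r ^ 2 + π ^ 2 * ‖k‖ ^ 2) := Real.sqrt_pos.2 (by positivity)
  have := Real.pi_pos
  rw [pairPhaseDeriv]
  field_simp

theorem pairPhaseDeriv_pos (k : Space5) {r : ℝ} (hr : 0 < r) : 0 < pairPhaseDeriv k r := by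
  have : 0 < √(1 + 4 * π ^ 2 * r ^ 2 + π ^ 2 * ‖k‖ ^ 2) := Real.sqrt_pos.2 (by positivity)
  rw [pairPhaseDeriv]; positivity

theorem norm_pow_four_div_pairPhaseDeriv (k ζ : Space5) :
    ‖ζ‖ ^ 4 / pairPhaseDeriv k ‖ζ‖ = ‖ζ‖ ^ 3 * halfEnergy k ζ / (4 * π) := by
  have hT := halfEnergy_pos k ζ
  have : √(1 + 4 * π ^ 2 * ‖ζ‖ ^ 2 + π ^ 2 * ‖k‖ ^ 2) = halfEnergy k ζ := by
    rw [halfEnergy, jap_sq]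
  rw [pairPhaseDeriv, this]
  -- At the origin the phase is stationary and both sides are zero.
  rcases eq_or_ne ‖ζ‖ 0 with h | h
  · simp [h]
  · have := Real.pi_pos
    field_simp

/-- The amplitude in the centre of mass frame. -/
def pairAmplitude (F : Space5 → ℂ) (k ζ : Space5) : ℂ :=
  (boostJac k ζ : ℂ) * (F ((1 / 2 : ℝ) • k + boost k ζ) * F ((1 / 2 : ℝ) • k - boost k ζ))

theorem continuous_boost (k : Space5) : Continuous (boost k) :=
  continuous_iff_continuousAt.2 fun ζ => (hasFDerivAt_boost k ζ).continuousAt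

theorem continuous_boostJac (k : Space5) : Continuous (boostJac k) := by
  unfold boostJac halfEnergy
  have := continuous_jap
  refine Continuous.div (by
    refine Continuous.sub (by fun_prop) (Continuous.pow (Continuous.div (by fun_prop) this
      fun ζ => (jap_pos ζ).ne') 2)) (by fun_prop) fun ζ => ?_
  exact (mul_pos (jap_pos ζ) (halfEnergy_pos k ζ)).ne'

theorem measurable_pairAmplitude {F : Space5 → ℂ} (hF : Measurable F) (k : Space5) :
    Measurable (pairAmplitude F k) := by
  have h1 := (continuous_boost k).measurable
  have h2 := (continuous_boostJac k).measurable
  unfold pairAmplitude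
  fun_prop

theorem fconv_eq_integral_half (F G : Space5 → ℂ) (k : Space5) :
    fconv F G k = ∫ η, F ((1 / 2 : ℝ) • k + η) * G ((1 / 2 : ℝ) • k - η) := by
  rw [fconv, ← integral_add_left_eq_self _ ((1 / 2 : ℝ) • k)]
  refine integral_congr_ae (Filter.Eventually.of_forall fun η => ?_)
  have : k - ((1 / 2 : ℝ) • k + η) = (1 / 2 : ℝ) • k - η := by module
  simp only [this]

theorem integrable_pairAmplitude {F : Space5 → ℂ} (hF : NiceAmplitude F) (k : Space5) :
    Integrable (pairAmplitude F k) := by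
  refine (integrable_boost k fun η =>
    F ((1 / 2 : ℝ) • k + η) * F ((1 / 2 : ℝ) • k - η)).1 ?_
  obtain ⟨C, hC⟩ := hF.bounded
  have hm := hF.measurable
  exact (hF.integrable.comp_add_left ((1 / 2 : ℝ) • k)).mul_bdd (c := C)
    (Measurable.aestronglyMeasurable (by fun_prop)) (Filter.Eventually.of_forall fun η => hC _)

/-- The phase is the sum of the two energies; after the boost it is `2 * halfEnergy k ζ`, which is
radial in `ζ`. -/
theorem fconv_evolve (F : Space5 → ℂ) (t : ℝ) (k : Space5) :
    fconv (evolve t F) (evolve t F) k =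
      ∫ ζ, Complex.exp ((2 * π * t * pairPhase k ‖ζ‖ : ℝ) * Complex.I) * pairAmplitude F k ζ := by
  rw [fconv_eq_integral_half, integral_boost k]
  refine integral_congr_ae (Filter.Eventually.of_forall fun ζ => ?_)
  have hπ := Real.pi_pos
  have e : Complex.exp ((2 * π * t * pairPhase k ‖ζ‖ : ℝ) * Complex.I) =
      Complex.exp ((t * jap ((1 / 2 : ℝ) • k + boost k ζ) : ℝ) * Complex.I) *
      Complex.exp ((t * jap ((1 / 2 : ℝ) • k - boost k ζ) : ℝ) * Complex.I) := by
    rw [← Complex.exp_add, ← add_mul, ← Complex.ofReal_add, jap_half_add_boost,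
      jap_half_sub_boost, pairPhase_norm]
    congr 3
    field_simp
    ring
  simp only [pairAmplitude, evolve]
  rw [e]; ring

/-- Squaring the amplitude produces two Jacobians: one is kept to undo the boost, the other is
absorbed into `pairWeight`. -/
theorem ofReal_mul_enorm_pairAmplitude_sq (F : Space5 → ℂ) (k ζ : Space5) :
    ENNReal.ofReal (‖ζ‖ ^ 4 / pairPhaseDeriv k ‖ζ‖) * ‖pairAmplitude F k ζ‖ₑ ^ 2 =
      ENNReal.ofReal (boostJac k ζ) * (ENNReal.ofReal (pairWeight k ζ) *
        (‖F ((1 / 2 : ℝ) • k + boost k ζ)‖ₑ ^ 2 * ‖F ((1 / 2 : ℝ) • k - boost k ζ)‖ₑ ^ 2)) := by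
  have hJ := boostJac_pos k ζ
  have hT := halfEnergy_pos k ζ
  have hE := jap_pos ζ
  have hπ := Real.pi_pos
  have h : ‖ζ‖ ^ 4 / pairPhaseDeriv k ‖ζ‖ * boostJac k ζ = pairWeight k ζ := by
    rw [norm_pow_four_div_pairPhaseDeriv, boostJac_eq, pairWeight]; field_simp
  have h0 : 0 ≤ ‖ζ‖ ^ 4 / pairPhaseDeriv k ‖ζ‖ := by
    rw [norm_pow_four_div_pairPhaseDeriv]; positivity
  have hJe : ‖(boostJac k ζ : ℂ)‖ₑ = ENNReal.ofReal (boostJac k ζ) := by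
    rw [← ofReal_norm, Complex.norm_real, Real.norm_of_nonneg hJ.le]
  rw [← h, ENNReal.ofReal_mul h0, pairAmplitude, enorm_mul, enorm_mul, hJe]
  ring

/-- The energy-momentum weight in the bilinear estimate. -/
def pairDensity (c : ℝ) (F : Space5 → ℂ) (y z : Space5) : ℝ≥0∞ :=
  ENNReal.ofReal (jap y * jap z * (lorentzProd y z - c)) * (‖F y‖ₑ ^ 2 * ‖F z‖ₑ ^ 2)

theorem measurable_pairDensity (c : ℝ) {F : Space5 → ℂ} (hF : Measurable F) :
    Measurable fun p : Space5 × Space5 => pairDensity c F p.1 p.2 := by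
  have := continuous_lorentzProd.measurable
  unfold pairDensity
  fun_prop

theorem surf_const : surf univ * ENNReal.ofReal (1 / (64 * π ^ 4)) =
    ENNReal.ofReal (1 / (24 * π ^ 2)) := by
  rw [surf_univ, ← ENNReal.ofReal_mul (by positivity)]
  congr 1
  have := Real.pi_pos
  field_simp
  norm_num

theorem lintegral_pairWeight_le (F : Space5 → ℂ) (k : Space5) :
    ∫⁻ ζ, ENNReal.ofReal (‖ζ‖ ^ 4 / pairPhaseDeriv k ‖ζ‖) * ‖pairAmplitude F k ζ‖ₑ ^ 2 ≤
      ENNReal.ofReal (1 / (64 * π ^ 4)) *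
        ∫⁻ η, pairDensity 1 F ((1 / 2 : ℝ) • k + η) ((1 / 2 : ℝ) • k - η) := by
  rw [lintegral_boost k (fun η => pairDensity 1 F ((1 / 2 : ℝ) • k + η) ((1 / 2 : ℝ) • k - η)),
    ← lintegral_const_mul' _ _ ENNReal.ofReal_ne_top]
  refine lintegral_mono fun ζ => ?_
  rw [ofReal_mul_enorm_pairAmplitude_sq, pairDensity]
  have h := pairWeight_le k ζ
  rw [div_eq_inv_mul, ← one_div] at h
  calc _ ≤ ENNReal.ofReal (boostJac k ζ) * (ENNReal.ofReal (1 / (64 * π ^ 4) * _) *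
        (‖F ((1 / 2 : ℝ) • k + boost k ζ)‖ₑ ^ 2 * ‖F ((1 / 2 : ℝ) • k - boost k ζ)‖ₑ ^ 2)) := by
        gcongr
    _ = _ := by
        rw [ENNReal.ofReal_mul (by positivity)]
        ring

/-- Where the Lorentz product is below `3`, `ENNReal.ofReal` replaces the negative weight by zero,
so the pointwise bound needs no sign condition. -/
theorem le_lintegral_pairWeight (F : Space5 → ℂ) (k : Space5) :
    ENNReal.ofReal (1 / (64 * π ^ 4)) *
        ∫⁻ η, pairDensity 3 F ((1 / 2 : ℝ) • k + η) ((1 / 2 : ℝ) • k - η) ≤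
    ∫⁻ ζ, ENNReal.ofReal (‖ζ‖ ^ 4 / pairPhaseDeriv k ‖ζ‖) * ‖pairAmplitude F k ζ‖ₑ ^ 2 := by
  rw [lintegral_boost k (fun η => pairDensity 3 F ((1 / 2 : ℝ) • k + η) ((1 / 2 : ℝ) • k - η)),
    ← lintegral_const_mul' _ _ ENNReal.ofReal_ne_top]
  refine lintegral_mono fun ζ => ?_
  rw [ofReal_mul_enorm_pairAmplitude_sq, pairDensity]
  have h := le_pairWeight k ζ
  rw [div_eq_inv_mul, ← one_div] at h
  calc _ = ENNReal.ofReal (boostJac k ζ) * (ENNReal.ofReal (1 / (64 * π ^ 4) *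
        (jap ((1 / 2 : ℝ) • k + boost k ζ) * jap ((1 / 2 : ℝ) • k - boost k ζ) *
        (lorentzProd ((1 / 2 : ℝ) • k + boost k ζ) ((1 / 2 : ℝ) • k - boost k ζ) - 3))) *
        (‖F ((1 / 2 : ℝ) • k + boost k ζ)‖ₑ ^ 2 * ‖F ((1 / 2 : ℝ) • k - boost k ζ)‖ₑ ^ 2)) := by
        rw [ENNReal.ofReal_mul (p := 1 / (64 * π ^ 4)) (by positivity)]
        ring
    _ ≤ _ := by gcongr

theorem lintegral_fconv_evolve_sq_le {F : Space5 → ℂ} (hF : NiceAmplitude F) (k : Space5) :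
    ∫⁻ t, ‖fconv (evolve t F) (evolve t F) k‖ₑ ^ 2 ≤ ENNReal.ofReal (1 / (24 * π ^ 2)) *
      ∫⁻ η, pairDensity 1 F ((1 / 2 : ℝ) • k + η) ((1 / 2 : ℝ) • k - η) := by
  -- Time Plancherel needs a finite right-hand side; if it is infinite there is nothing to prove.
  rcases eq_or_ne (∫⁻ η, pairDensity 1 F ((1 / 2 : ℝ) • k + η) ((1 / 2 : ℝ) • k - η)) ∞
    with h | h
  · rw [h, ENNReal.mul_top (by simp; positivity)]; exact le_top
  · have hle := lintegral_pairWeight_le F k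
    have hmp : Measurable (pairPhase k) := by unfold pairPhase; fun_prop
    have hmd : Measurable (pairPhaseDeriv k) := by unfold pairPhaseDeriv; fun_prop
    simp_rw [fconv_evolve]
    refine ((lintegral_radialPhase_sq_eq hmp hmd (fun r _ => hasDerivAt_pairPhase k r)
      (fun r hr => pairPhaseDeriv_pos k hr) (measurable_pairAmplitude hF.measurable k)
      (integrable_pairAmplitude hF k) ?_).2.trans (mul_le_mul_right hle _)).trans ?_
    · exact ne_top_of_le_ne_top (ENNReal.mul_ne_top ENNReal.ofReal_ne_top h) hle
    · rw [← mul_assoc, surf_const]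

/-- For a radial amplitude Cauchy-Schwarz on the spheres is an equality, so only the weight
comparison loses anything. -/
theorem le_lintegral_fconv_evolve_sq {F : Space5 → ℂ} (hF : NiceAmplitude F) (k : Space5)
    {g : ℝ → ℂ} (hg : Measurable g) (hrad : ∀ ζ, pairAmplitude F k ζ = g ‖ζ‖)
    (h : ∫⁻ η, pairDensity 1 F ((1 / 2 : ℝ) • k + η) ((1 / 2 : ℝ) • k - η) ≠ ∞) :
    ENNReal.ofReal (1 / (24 * π ^ 2)) *
      ∫⁻ η, pairDensity 3 F ((1 / 2 : ℝ) • k + η) ((1 / 2 : ℝ) • k - η) ≤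
    ∫⁻ t, ‖fconv (evolve t F) (evolve t F) k‖ₑ ^ 2 := by
  have hle := lintegral_pairWeight_le F k
  have hge := le_lintegral_pairWeight F k
  have hint := integrable_pairAmplitude hF k
  have hmp : Measurable (pairPhase k) := by unfold pairPhase; fun_prop
  have hmd : Measurable (pairPhaseDeriv k) := by unfold pairPhaseDeriv; fun_prop
  simp_rw [fconv_evolve]
  rw [show pairAmplitude F k = fun ζ => g ‖ζ‖ from funext hrad] at hint
  simp_rw [hrad] at hle hge ⊢
  rw [lintegral_radialPhase_sq_eq_of_radial hmp hmd (fun r _ => hasDerivAt_pairPhase k r)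
      (fun r hr => pairPhaseDeriv_pos k hr) hg hint, ← surf_const, mul_assoc]
  · gcongr
  · exact ne_top_of_le_ne_top (ENNReal.mul_ne_top ENNReal.ofReal_ne_top h) hle

/-- Passing to total and relative momentum preserves measure: Tonelli and two translations. -/
theorem lintegral_lintegral_half {Q : Space5 → Space5 → ℝ≥0∞}
    (hQ : Measurable fun p : Space5 × Space5 => Q p.1 p.2) :
    ∫⁻ k, ∫⁻ η, Q ((1 / 2 : ℝ) • k + η) ((1 / 2 : ℝ) • k - η) = ∫⁻ y, ∫⁻ z, Q y z := by
  have h1 : ∀ k : Space5, ∫⁻ η, Q ((1 / 2 : ℝ) • k + η) ((1 / 2 : ℝ) • k - η) =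
      ∫⁻ y, Q y (k - y) := by
    intro k
    rw [← lintegral_add_left_eq_self (fun y => Q y (k - y)) ((1 / 2 : ℝ) • k)]
    refine lintegral_congr fun η => ?_
    congr 1; module
  simp_rw [h1]
  rw [lintegral_lintegral_swap]
  · exact lintegral_congr fun y => lintegral_sub_right_eq_self (fun z => Q y z) y
  · exact (hQ.comp (by fun_prop : Measurable fun p : Space5 × Space5 =>
      (p.2, p.1 - p.2))).aemeasurable

/-- The fourth power is the squared modulus of the square, whose Fourier transform is a
self-convolution; Plancherel in `x`, then Tonelli to integrate in time first. -/
theorem lintegral_halfWave_pow_four {F : Space5 → ℂ} (hF : NiceAmplitude F) :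
    ∫⁻ t, ∫⁻ x, ‖halfWave F t x‖ₑ ^ 4 =
      ∫⁻ k, ∫⁻ t, ‖fconv (evolve t F) (evolve t F) k‖ₑ ^ 2 := by
  have h1 : ∀ t, ∫⁻ x, ‖halfWave F t x‖ₑ ^ 4 =
      ∫⁻ k, ‖fconv (evolve t F) (evolve t F) k‖ₑ ^ 2 := by
    intro t
    have hE := hF.evolve t
    rw [← lintegral_fourierInv_sq (hE.integrable_fconv hE) (hE.memLp_fconv hE)]
    refine lintegral_congr fun x => ?_
    rw [fourierInv_fconv hE.integrable hE.integrable, enorm_mul, halfWave]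
    ring
  simp_rw [h1]
  refine lintegral_lintegral_swap ?_
  have hm := hF.measurable
  have : StronglyMeasurable fun p : ℝ × Space5 => fconv (evolve p.1 F) (evolve p.1 F) p.2 := by
    unfold fconv
    refine StronglyMeasurable.integral_prod_right (f := fun (p : ℝ × Space5) (y : Space5) =>
      evolve p.1 F y * evolve p.1 F (p.2 - y)) ?_
    unfold evolve
    exact Measurable.stronglyMeasurable (by fun_prop)
  exact (this.measurable.enorm.pow_const 2).aemeasurable

theorem lintegral_halfWave_pow_four_le {F : Space5 → ℂ} (hF : NiceAmplitude F) :
    ∫⁻ t, ∫⁻ x, ‖halfWave F t x‖ₑ ^ 4 ≤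
      ENNReal.ofReal (1 / (24 * π ^ 2)) * ∫⁻ y, ∫⁻ z, pairDensity 1 F y z := by
  rw [lintegral_halfWave_pow_four hF,
    ← lintegral_lintegral_half (measurable_pairDensity 1 hF.measurable),
    ← lintegral_const_mul' _ _ ENNReal.ofReal_ne_top]
  exact lintegral_mono fun k => lintegral_fconv_evolve_sq_le hF k

theorem measurable_lintegral_pairDensity_half (c : ℝ) {F : Space5 → ℂ} (hF : Measurable F) :
    Measurable fun k => ∫⁻ η, pairDensity c F ((1 / 2 : ℝ) • k + η) ((1 / 2 : ℝ) • k - η) := by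
  have h : Measurable fun p : Space5 × Space5 =>
      ((1 / 2 : ℝ) • p.1 + p.2, (1 / 2 : ℝ) • p.1 - p.2) := by fun_prop
  exact ((measurable_pairDensity c hF).comp h).lintegral_prod_right'

theorem le_lintegral_halfWave_pow_four {F : Space5 → ℂ} (hF : NiceAmplitude F)
    {g : Space5 → ℝ → ℂ} (hg : ∀ k, Measurable (g k))
    (hrad : ∀ k ζ, pairAmplitude F k ζ = g k ‖ζ‖)
    (h : ∫⁻ y, ∫⁻ z, pairDensity 1 F y z ≠ ∞) :
    ENNReal.ofReal (1 / (24 * π ^ 2)) * ∫⁻ y, ∫⁻ z, pairDensity 3 F y z ≤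
      ∫⁻ t, ∫⁻ x, ‖halfWave F t x‖ₑ ^ 4 := by
  rw [← lintegral_lintegral_half (measurable_pairDensity 1 hF.measurable)] at h
  rw [lintegral_halfWave_pow_four hF,
    ← lintegral_lintegral_half (measurable_pairDensity 3 hF.measurable),
    ← lintegral_const_mul' _ _ ENNReal.ofReal_ne_top]
  refine lintegral_mono_ae ?_
  -- The estimate at a single `k` needs a finite density, which holds for almost every `k` because
  -- the total is finite.
  filter_upwards [ae_lt_top (measurable_lintegral_pairDensity_half 1 hF.measurable) h] with k hk
  exact le_lintegral_fconv_evolve_sq hF k (hg k) (hrad k) hk.ne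

end BilinearEstimate

/-! ### The bilinear weight in terms of energy and momentum. -/

noncomputable section EnergyBounds

open Set

/-- The squared `H¹` norm of the function with Fourier transform `F`. -/
def energy (F : Space5 → ℂ) : ℝ := ∫ ξ, jap ξ ^ 2 * ‖F ξ‖ ^ 2

/-- The squared `H^{1/2}` norm of the function with Fourier transform `F`. -/
def halfOrderEnergy (F : Space5 → ℂ) : ℝ := ∫ ξ, jap ξ * ‖F ξ‖ ^ 2

/-- The momentum of the half wave with amplitude `F`. -/
def momentum (F : Space5 → ℂ) : Space5 := ∫ ξ, (jap ξ * ‖F ξ‖ ^ 2) • ξ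

theorem energy_nonneg (F : Space5 → ℂ) : 0 ≤ energy F :=
  integral_nonneg fun ξ => by positivity

theorem halfOrderEnergy_nonneg (F : Space5 → ℂ) : 0 ≤ halfOrderEnergy F :=
  integral_nonneg fun ξ => mul_nonneg (jap_pos ξ).le (by positivity)

theorem jap_le_sq (ξ : Space5) : jap ξ ≤ jap ξ ^ 2 := by
  nlinarith [one_le_jap ξ]

section Integrability

variable {F : Space5 → ℂ} (hm : Measurable F) (h : Integrable fun ξ => jap ξ ^ 2 * ‖F ξ‖ ^ 2)
include hm h

theorem integrable_halfOrderEnergy : Integrable fun ξ => jap ξ * ‖F ξ‖ ^ 2 := by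
  refine h.mono (Measurable.aestronglyMeasurable (by fun_prop))
    (Filter.Eventually.of_forall fun ξ => ?_)
  have h1 := jap_pos ξ
  rw [Real.norm_of_nonneg (by positivity), Real.norm_of_nonneg (by positivity)]
  exact mul_le_mul_of_nonneg_right (jap_le_sq ξ) (by positivity)

theorem integrable_momentum : Integrable fun ξ => (jap ξ * ‖F ξ‖ ^ 2) • ξ := by
  refine h.mono (Measurable.aestronglyMeasurable (by fun_prop))
    (Filter.Eventually.of_forall fun ξ => ?_)
  have h1 := jap_pos ξ
  have h3 : ‖ξ‖ ≤ jap ξ := by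
    have := two_pi_norm_lt_jap ξ
    have := Real.pi_gt_three
    nlinarith [norm_nonneg ξ]
  have h2 : 0 ≤ jap ξ * ‖F ξ‖ ^ 2 := by positivity
  rw [norm_smul, Real.norm_of_nonneg h2, Real.norm_of_nonneg (by positivity)]
  nlinarith

/-- The real-valued version of the bilinear weight. -/
theorem integrable_and_integral_pairDensity (c : ℝ) :
    Integrable (fun p : Space5 × Space5 => jap p.1 * jap p.2 * (lorentzProd p.1 p.2 - c) *
      (‖F p.1‖ ^ 2 * ‖F p.2‖ ^ 2)) (volume.prod volume) ∧
    ∫ p : Space5 × Space5, jap p.1 * jap p.2 * (lorentzProd p.1 p.2 - c) *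
      (‖F p.1‖ ^ 2 * ‖F p.2‖ ^ 2) ∂(volume.prod volume) =
      energy F ^ 2 - 4 * π ^ 2 * ‖momentum F‖ ^ 2 - c * halfOrderEnergy F ^ 2 := by
  have hN := integrable_halfOrderEnergy hm h
  have hP := integrable_momentum hm h
  have i1 := h.mul_prod h
  have i2 := hN.mul_prod hN
  have i3 : Integrable (fun p : Space5 × Space5 => inner ℝ ((jap p.1 * ‖F p.1‖ ^ 2) • p.1)
      ((jap p.2 * ‖F p.2‖ ^ 2) • p.2)) (volume.prod volume) := by
    refine (hP.norm.mul_prod hP.norm).mono (Measurable.aestronglyMeasurable (by fun_prop))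
      (Filter.Eventually.of_forall fun p => ?_)
    rw [Real.norm_of_nonneg (mul_nonneg (norm_nonneg _) (norm_nonneg _))]
    exact norm_inner_le_norm _ _
  have e : (fun p : Space5 × Space5 => jap p.1 * jap p.2 * (lorentzProd p.1 p.2 - c) *
      (‖F p.1‖ ^ 2 * ‖F p.2‖ ^ 2)) = fun p =>
      ((jap p.1 ^ 2 * ‖F p.1‖ ^ 2) * (jap p.2 ^ 2 * ‖F p.2‖ ^ 2) -
      4 * π ^ 2 * inner ℝ ((jap p.1 * ‖F p.1‖ ^ 2) • p.1) ((jap p.2 * ‖F p.2‖ ^ 2) • p.2)) -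
      c * ((jap p.1 * ‖F p.1‖ ^ 2) * (jap p.2 * ‖F p.2‖ ^ 2)) := by
    ext p
    rw [lorentzProd, inner_smul_left, inner_smul_right, RCLike.conj_to_real]
    ring
  -- By Fubini the inner product of the two momentum densities integrates to the inner product of
  -- `momentum F` with itself.
  have v3 : ∫ p : Space5 × Space5, inner ℝ ((jap p.1 * ‖F p.1‖ ^ 2) • p.1)
      ((jap p.2 * ‖F p.2‖ ^ 2) • p.2) ∂(volume.prod volume) = ‖momentum F‖ ^ 2 := by
    rw [integral_prod _ i3]
    have : ∀ y : Space5, ∫ z, inner ℝ ((jap y * ‖F y‖ ^ 2) • y) ((jap z * ‖F z‖ ^ 2) • z) =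
        inner ℝ (momentum F) ((jap y * ‖F y‖ ^ 2) • y) := fun y => by
      rw [integral_inner hP, real_inner_comm, momentum]
    simp_rw [this]
    rw [integral_inner hP, ← real_inner_self_eq_norm_sq, momentum]
  rw [e]
  refine ⟨(i1.sub (i3.const_mul _)).sub (i2.const_mul _), ?_⟩
  have j3 := i3.const_mul (4 * π ^ 2)
  have j2 := i2.const_mul c
  have j13 : Integrable (fun p : Space5 × Space5 =>
      (jap p.1 ^ 2 * ‖F p.1‖ ^ 2) * (jap p.2 ^ 2 * ‖F p.2‖ ^ 2) -
      4 * π ^ 2 * inner ℝ ((jap p.1 * ‖F p.1‖ ^ 2) • p.1) ((jap p.2 * ‖F p.2‖ ^ 2) • p.2))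
      (volume.prod volume) := i1.sub j3
  rw [integral_sub j13 j2, integral_sub i1 j3,
    integral_const_mul, integral_const_mul, v3,
    integral_prod_mul (fun ξ => jap ξ ^ 2 * ‖F ξ‖ ^ 2) (fun ξ => jap ξ ^ 2 * ‖F ξ‖ ^ 2),
    integral_prod_mul (fun ξ => jap ξ * ‖F ξ‖ ^ 2) (fun ξ => jap ξ * ‖F ξ‖ ^ 2), energy,
    halfOrderEnergy]
  ring

omit h in
theorem lintegral_pairDensity_eq (c : ℝ) : ∫⁻ y, ∫⁻ z, pairDensity c F y z =
    ∫⁻ p : Space5 × Space5, ENNReal.ofReal (jap p.1 * jap p.2 * (lorentzProd p.1 p.2 - c) *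
      (‖F p.1‖ ^ 2 * ‖F p.2‖ ^ 2)) ∂(volume.prod volume) := by
  rw [← lintegral_prod (fun p : Space5 × Space5 => pairDensity c F p.1 p.2)
    (measurable_pairDensity c hm).aemeasurable]
  refine lintegral_congr fun p => ?_
  rw [pairDensity, ENNReal.ofReal_mul' (q := ‖F p.1‖ ^ 2 * ‖F p.2‖ ^ 2) (by positivity),
    ENNReal.ofReal_mul (p := ‖F p.1‖ ^ 2) (by positivity), ENNReal.ofReal_pow (norm_nonneg _), ENNReal.ofReal_pow (norm_nonneg _), ofReal_norm,
    ofReal_norm]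

theorem lintegral_pairDensity_one : ∫⁻ y, ∫⁻ z, pairDensity 1 F y z =
    ENNReal.ofReal (energy F ^ 2 - 4 * π ^ 2 * ‖momentum F‖ ^ 2 - halfOrderEnergy F ^ 2) := by
  obtain ⟨hi, hv⟩ := integrable_and_integral_pairDensity hm h 1
  rw [lintegral_pairDensity_eq hm, ← ofReal_integral_eq_lintegral_ofReal hi, hv, one_mul]
  refine Filter.Eventually.of_forall fun p => ?_
  have h1 := jap_pos p.1
  have h2 := jap_pos p.2
  have h3 := sub_nonneg.2 (one_le_lorentzProd p.1 p.2)
  simp only [Pi.zero_apply]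
  positivity

/-- For `c > 1` the real weight may be negative; the density retains only its positive part, hence
an inequality. -/
theorem le_lintegral_pairDensity (c : ℝ) :
    ENNReal.ofReal (energy F ^ 2 - 4 * π ^ 2 * ‖momentum F‖ ^ 2 - c * halfOrderEnergy F ^ 2) ≤
      ∫⁻ y, ∫⁻ z, pairDensity c F y z := by
  obtain ⟨hi, hv⟩ := integrable_and_integral_pairDensity hm h c
  rw [lintegral_pairDensity_eq hm, ← hv]
  refine ENNReal.ofReal_le_of_le_toReal ?_
  rw [integral_eq_lintegral_pos_part_sub_lintegral_neg_part hi]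
  linarith [ENNReal.toReal_nonneg (a := ∫⁻ p : Space5 × Space5, ENNReal.ofReal
    (-(jap p.1 * jap p.2 * (lorentzProd p.1 p.2 - c) *
      (‖F p.1‖ ^ 2 * ‖F p.2‖ ^ 2))) ∂(volume.prod volume))]

theorem halfOrderEnergy_le_energy : halfOrderEnergy F ≤ energy F := by
  refine integral_mono (integrable_halfOrderEnergy hm h) h fun ξ => ?_
  exact mul_le_mul_of_nonneg_right (jap_le_sq ξ) (by positivity)

end Integrability

theorem NiceAmplitude.integrable_energy {F : Space5 → ℂ} (hF : NiceAmplitude F) :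
    Integrable fun ξ => jap ξ ^ 2 * ‖F ξ‖ ^ 2 := by
  obtain ⟨C, hC⟩ := hF.bounded
  have hm := hF.measurable
  refine (hF.integrable_weighted.mul_bdd (c := C) (g := fun ξ => ‖F ξ‖)
    (Measurable.aestronglyMeasurable (by fun_prop))
    (Filter.Eventually.of_forall fun ξ => by rw [norm_norm]; exact hC ξ)).congr
    (Filter.Eventually.of_forall fun ξ => ?_)
  simp only
  ring

/-- The sharp Strichartz estimate for a half wave, with its gain. -/
theorem lintegral_halfWave_pow_four_le_energy {F : Space5 → ℂ} (hF : NiceAmplitude F) :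
    ∫⁻ t, ∫⁻ x, ‖halfWave F t x‖ₑ ^ 4 ≤
      ENNReal.ofReal (1 / (24 * π ^ 2) * (energy F ^ 2 - halfOrderEnergy F ^ 2)) := by
  refine (lintegral_halfWave_pow_four_le hF).trans ?_
  rw [lintegral_pairDensity_one hF.measurable hF.integrable_energy,
    ← ENNReal.ofReal_mul (by positivity)]
  refine ENNReal.ofReal_le_ofReal ?_
  gcongr
  -- The momentum term enters with a favourable sign and is dropped.
  have : 0 ≤ 4 * π ^ 2 * ‖momentum F‖ ^ 2 := by positivity
  linarith

end EnergyBounds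

/-! ### Vanishing of quartic interactions with nonnegative total frequency. -/

noncomputable section FrequencyOrthogonality

open Set

/-- An integrable function which is a superposition of oscillations of nonnegative frequency has
vanishing integral. -/
theorem integral_eq_zero_of_nonneg_frequencies {Y : Type*} [MeasurableSpace Y] {μ : Measure Y}
    [SFinite μ] {Ω : Y → ℝ} {M : Y → ℂ} (hΩ : Measurable Ω) (hΩ0 : ∀ y, 0 ≤ Ω y)
    (hM : Integrable M μ) {I : ℝ → ℂ} (hI : Integrable I)
    (hIM : ∀ t, I t = ∫ y, Complex.exp ((t * Ω y : ℝ) * Complex.I) * M y ∂μ) :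
    ∫ t, I t = 0 := by
  have hcont := continuous_fourier_of_integrable hI
  -- Tested against `χ` supported in the negative half line, `𝓕 I` evaluates `χ` at the frequencies
  -- `Ω y / (2π) ≥ 0`, where it vanishes.
  have hae : ∀ᵐ σ : ℝ, σ ∈ Iio (0 : ℝ) → 𝓕 I σ = 0 := by
    refine isOpen_Iio.ae_eq_zero_of_integral_contDiff_smul_eq_zero
      (hcont.locallyIntegrable.locallyIntegrableOn _) fun χ hχ hχs hχ0 => ?_
    have h1 : ContDiff ℝ (⊤ : ℕ∞) (fun x => (χ x : ℂ)) := Complex.ofRealCLM.contDiff.comp hχ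
    have h2 : HasCompactSupport (fun x => (χ x : ℂ)) :=
      hχs.comp_left (g := fun r : ℝ => (r : ℂ)) (by simp)
    set ψ : 𝓢(ℝ, ℂ) := h2.toSchwartzMap h1 with hψ
    have hψχ : ∀ x, ψ x = χ x := fun x => rfl
    have hψint : Integrable (𝓕 (ψ : ℝ → ℂ)) := by
      rw [← SchwartzMap.fourier_coe]; exact (𝓕 ψ).integrable
    calc ∫ σ, χ σ • 𝓕 I σ = ∫ σ, 𝓕 I σ * ψ σ := by
          refine integral_congr_ae (Filter.Eventually.of_forall fun σ => ?_)
          simp only [hψχ, Complex.real_smul]; ring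
      _ = ∫ t, I t * 𝓕 (ψ : ℝ → ℂ) t := integral_fourier_mul_eq_flip hI ψ.integrable
      _ = ∫ t, (∫ y, Complex.exp ((t * Ω y : ℝ) * Complex.I) * (𝓕 (ψ : ℝ → ℂ) t * M y) ∂μ) := by
          refine integral_congr_ae (Filter.Eventually.of_forall fun t => ?_)
          simp only
          rw [hIM, ← integral_mul_const]
          refine integral_congr_ae (Filter.Eventually.of_forall fun y => ?_)
          simp only; ring
      _ = ∫ y, (∫ t, Complex.exp ((t * Ω y : ℝ) * Complex.I) * (𝓕 (ψ : ℝ → ℂ) t * M y)) ∂μ := by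
          refine integral_integral_swap ?_
          refine (hψint.mul_prod hM).bdd_mul (c := 1)
            (Measurable.aestronglyMeasurable (by fun_prop))
            (Filter.Eventually.of_forall fun p => ?_)
          rw [Complex.norm_exp_ofReal_mul_I]
      _ = ∫ y, 0 ∂μ := by
          refine integral_congr_ae (Filter.Eventually.of_forall fun y => ?_)
          simp only
          have hinv : 𝓕⁻ (𝓕 (ψ : ℝ → ℂ)) (Ω y / (2 * π)) = 0 := by
            rw [← SchwartzMap.fourier_coe, ← SchwartzMap.fourierInv_coe,
              FourierTransform.fourierInv_fourier_eq, hψχ]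
            have : Ω y / (2 * π) ∉ tsupport χ := fun h => by
              have h3 := hχ0 h
              have h4 : 0 ≤ Ω y / (2 * π) := div_nonneg (hΩ0 y) (by positivity)
              exact absurd h3 (not_lt.2 h4)
            rw [image_eq_zero_of_notMem_tsupport this, Complex.ofReal_zero]
          rw [Real.fourierInv_eq] at hinv
          rw [← zero_mul (M y), ← hinv, ← integral_mul_const]
          refine integral_congr_ae (Filter.Eventually.of_forall fun t => ?_)
          simp only [Circle.smul_def, Real.fourierChar_apply, smul_eq_mul]
          have : 2 * π * inner ℝ t (Ω y / (2 * π)) = t * Ω y := by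
            have := Real.pi_pos
            simp only [RCLike.inner_apply, RCLike.conj_to_real]
            field_simp
          rw [this]; ring
      _ = 0 := integral_zero _ _
  -- Since `I` is integrable, `𝓕 I` is continuous, so its vanishing extends to the endpoint `0`,
  -- where its value is `∫ I`. The frequency may therefore be zero.
  have h0 : 𝓕 I 0 = 0 := by
    by_contra hne
    have hopen : IsOpen ({σ | 𝓕 I σ ≠ 0} ∩ Iio 0) :=
      (isOpen_ne.preimage hcont).inter isOpen_Iio
    have hnull : volume ({σ | 𝓕 I σ ≠ 0} ∩ Iio 0) = 0 := by
      refine measure_mono_null (fun σ hσ => ?_) (ae_iff.1 hae)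
      exact fun h => hσ.1 (h hσ.2)
    have hempty := (hopen.measure_eq_zero_iff volume).1 hnull
    have hmem : (0 : ℝ) ∈ closure (Iio (0 : ℝ)) := by rw [closure_Iio]; exact self_mem_Iic
    obtain ⟨σ, h1, h2⟩ := mem_closure_iff.1 hmem _ (isOpen_ne.preimage hcont) hne
    exact absurd (show σ ∈ ({σ | 𝓕 I σ ≠ 0} ∩ Iio 0) from ⟨h1, h2⟩) (hempty ▸ notMem_empty σ)
  rw [Real.fourier_eq] at h0
  simpa using h0

/-- After squaring this is Cauchy-Schwarz, with room to spare because the mass is counted twice on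
the right. -/
theorem jap_add_le (x y : Space5) : jap (x + y) ≤ jap x + jap y := by
  refine le_of_sq_le_sq ?_ (add_pos (jap_pos x) (jap_pos y)).le
  rw [jap_sq, norm_add_sq_real, add_sq, jap_sq, jap_sq]
  linarith [one_add_inner_le_jap_mul x y]

section Quartic

variable {F₁ F₂ F₃ F₄ : Space5 → ℂ}

/-- The amplitude of the spatial integral of a quartic product of half waves. -/
def quarticAmplitude (F₁ F₂ F₃ F₄ : Space5 → ℂ) (p : (Space5 × Space5) × Space5) : ℂ :=
  F₁ p.1.2 * F₂ (p.1.1 - p.1.2) * F₃ (p.2 - p.1.1) * (starRingEnd ℂ) (F₄ p.2)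

theorem integrable_quarticAmplitude (h₁ : NiceAmplitude F₁) (h₂ : NiceAmplitude F₂)
    (h₃ : NiceAmplitude F₃) (h₄ : NiceAmplitude F₄) :
    Integrable (quarticAmplitude F₁ F₂ F₃ F₄) := by
  have m₁ := h₁.measurable
  have m₂ := h₂.measurable
  have m₃ := h₃.measurable
  have m₄ := h₄.measurable
  obtain ⟨C, hC⟩ := h₄.bounded
  have hK := integrable_fconv_integrand h₁.integrable h₂.integrable
  have h123 : Integrable (fun p : (Space5 × Space5) × Space5 =>
      F₁ p.1.2 * F₂ (p.1.1 - p.1.2) * F₃ (p.2 - p.1.1)) (volume.prod volume) := by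
    rw [integrable_prod_iff (Measurable.aestronglyMeasurable (by fun_prop))]
    refine ⟨Filter.Eventually.of_forall fun q =>
      (h₃.integrable.comp_sub_right q.1).const_mul (F₁ q.2 * F₂ (q.1 - q.2)), ?_⟩
    have : ∀ q : Space5 × Space5, ∫ k, ‖F₁ q.2 * F₂ (q.1 - q.2) * F₃ (k - q.1)‖ =
        ‖F₁ q.2 * F₂ (q.1 - q.2)‖ * ∫ k, ‖F₃ k‖ := fun q => by
      simp_rw [norm_mul _ (F₃ _)]
      rw [integral_const_mul, integral_sub_right_eq_self (fun k => ‖F₃ k‖)]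
    simp_rw [this]
    exact hK.norm.mul_const _
  refine h123.mul_bdd (c := C) (Measurable.aestronglyMeasurable ?_)
    (Filter.Eventually.of_forall fun p => ?_)
  · exact Complex.continuous_conj.measurable.comp (by fun_prop)
  · rw [RCLike.norm_conj]; exact hC _

/-- Parseval pairs the triple convolution with `F₄`; unfolding it gives an absolutely convergent
integral in which the time dependence is a pure phase. -/
theorem integral_quartic (h₁ : NiceAmplitude F₁) (h₂ : NiceAmplitude F₂)
    (h₃ : NiceAmplitude F₃) (h₄ : NiceAmplitude F₄) :
    ∫ x, 𝓕⁻ F₁ x * 𝓕⁻ F₂ x * 𝓕⁻ F₃ x * (starRingEnd ℂ) (𝓕⁻ F₄ x) =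
      ∫ p, quarticAmplitude F₁ F₂ F₃ F₄ p := by
  have h12 := h₁.integrable_fconv h₂
  obtain ⟨C, hC⟩ := h₃.bounded
  have h123 : Integrable (fconv (fconv F₁ F₂) F₃) := integrable_fconv h12 h₃.integrable
  have h123' : MemLp (fconv (fconv F₁ F₂) F₃) 2 :=
    memLp_two_of_integrable_of_bound h123 (norm_fconv_le h12 hC)
  have hint := integrable_quarticAmplitude h₁ h₂ h₃ h₄
  have e1 : ∀ x, 𝓕⁻ F₁ x * 𝓕⁻ F₂ x * 𝓕⁻ F₃ x * (starRingEnd ℂ) (𝓕⁻ F₄ x) =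
      𝓕⁻ (fconv (fconv F₁ F₂) F₃) x * (starRingEnd ℂ) (𝓕⁻ F₄ x) := fun x => by
    rw [fourierInv_fconv h12 h₃.integrable, fourierInv_fconv h₁.integrable h₂.integrable]
  simp_rw [e1]
  rw [integral_fourierInv_mul_conj h123 h123' h₄.integrable h₄.memLp_two]
  refine Eq.trans ?_ (integral_prod_symm _ hint).symm
  refine integral_congr_ae ?_
  filter_upwards [hint.prod_left_ae] with k hk
  refine Eq.trans ?_ (integral_prod _ hk).symm
  simp only [fconv, quarticAmplitude]
  rw [← integral_mul_const]
  refine integral_congr_ae (Filter.Eventually.of_forall fun η => ?_)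
  simp only
  rw [mul_assoc, ← integral_mul_const]
  refine integral_congr_ae (Filter.Eventually.of_forall fun θ => ?_)
  simp only
  ring

/-- A half wave travelling forward (`s = 1`) or backward (`s = -1`) in time, on space-time. -/
def signedWave (F : Space5 → ℂ) (s : ℝ) (p : ℝ × Space5) : ℂ := halfWave F (s * p.1) p.2

theorem continuous_signedWave {F : Space5 → ℂ} (hF : NiceAmplitude F) (s : ℝ) :
    Continuous (signedWave F s) :=
  hF.continuous_halfWave.comp (by fun_prop : Continuous fun p : ℝ × Space5 => (s * p.1, p.2))

theorem lintegral_signedWave_pow_four {F : Space5 → ℂ} (hF : NiceAmplitude F) {s : ℝ}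
    (hs : s = 1 ∨ s = -1) :
    ∫⁻ p, ‖signedWave F s p‖ₑ ^ 4 = ∫⁻ t, ∫⁻ x, ‖halfWave F t x‖ₑ ^ 4 := by
  have hc := (continuous_signedWave hF s).measurable
  rw [Measure.volume_eq_prod, lintegral_prod _ (by fun_prop)]
  rcases hs with rfl | rfl
  · simp [signedWave]
  · rw [← lintegral_neg_eq_self]
    simp [signedWave]

theorem memLp_signedWave {F : Space5 → ℂ} (hF : NiceAmplitude F) {s : ℝ}
    (hs : s = 1 ∨ s = -1) : MemLp (signedWave F s) 4 := by
  refine ⟨(continuous_signedWave hF s).aestronglyMeasurable, ?_⟩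
  have h := eLpNorm_nnreal_pow_eq_lintegral (f := signedWave F s) (p := 4)
    (μ := (volume : Measure (ℝ × Space5))) (by norm_num)
  have h2 : ∫⁻ p, ‖signedWave F s p‖ₑ ^ (4 : ℝ) < ∞ := by
    have : ∀ p, ‖signedWave F s p‖ₑ ^ (4 : ℝ) = ‖signedWave F s p‖ₑ ^ 4 := fun p => by
      rw [← ENNReal.rpow_natCast]; norm_num
    simp_rw [this]
    rw [lintegral_signedWave_pow_four hF hs]
    exact (lintegral_halfWave_pow_four_le_energy hF).trans_lt ENNReal.ofReal_lt_top
  refine lt_top_iff_ne_top.2 fun htop => ?_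
  have h' : eLpNorm (signedWave F s) 4 volume ^ (4 : ℝ) =
    ∫⁻ p, ‖signedWave F s p‖ₑ ^ (4 : ℝ) := by simpa using h
  rw [htop] at h'
  rw [← h'] at h2
  simp at h2

theorem integrable_quartic_product {f₁ f₂ f₃ f₄ : ℝ × Space5 → ℂ} (h₁ : MemLp f₁ 4)
    (h₂ : MemLp f₂ 4) (h₃ : MemLp f₃ 4) (h₄ : MemLp f₄ 4) :
    Integrable fun p => f₁ p * f₂ p * (f₃ p * f₄ p) := by
  have : ENNReal.HolderTriple 4 4 2 := ⟨by
    rw [← two_mul, show (4 : ℝ≥0∞) = 2 * 2 by norm_num,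
      ENNReal.mul_inv (by norm_num) (by norm_num), ← mul_assoc,
      ENNReal.mul_inv_cancel (by norm_num) (by norm_num), one_mul]⟩
  have h12 : MemLp (fun p => f₁ p * f₂ p) 2 := h₂.mul' h₁
  have h34 : MemLp (fun p => f₃ p * f₄ p) 2 := h₄.mul' h₃
  exact memLp_one_iff_integrable.1 (h34.mul' h12)

/-- The quartic interactions with nonnegative total frequency vanish. -/
theorem integral_quartic_eq_zero (h₁ : NiceAmplitude F₁) (h₂ : NiceAmplitude F₂)
    (h₃ : NiceAmplitude F₃) (h₄ : NiceAmplitude F₄) {s : ℝ} (hs : s = 1 ∨ s = -1) :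
    ∫ p, signedWave F₁ 1 p * signedWave F₂ 1 p * (signedWave F₃ 1 p *
      (starRingEnd ℂ) (signedWave F₄ s p)) = 0 := by
  have hint := integrable_quartic_product (memLp_signedWave h₁ (Or.inl rfl))
    (memLp_signedWave h₂ (Or.inl rfl)) (memLp_signedWave h₃ (Or.inl rfl))
    (memLp_signedWave h₄ hs).star
  rw [Measure.volume_eq_prod] at hint ⊢
  refine (integral_prod _ hint).trans ?_
  refine integral_eq_zero_of_nonneg_frequencies
    (Ω := fun p : (Space5 × Space5) × Space5 => jap p.1.2 + jap (p.1.1 - p.1.2) +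
      jap (p.2 - p.1.1) - s * jap p.2) (by fun_prop) (fun p => ?_)
    (integrable_quarticAmplitude h₁ h₂ h₃ h₄) hint.integral_prod_left fun t => ?_
  -- The fourth momentum is the sum of the other three, so two triangle inequalities give the sign.
  · have e1 := jap_add_le p.1.2 (p.1.1 - p.1.2)
    have e2 := jap_add_le p.1.1 (p.2 - p.1.1)
    rw [add_sub_cancel] at e1 e2
    have := jap_pos p.2
    rcases hs with rfl | rfl <;> linarith
  · refine Eq.trans ?_ ((integral_quartic (h₁.evolve t) (h₂.evolve t) (h₃.evolve t)
      (h₄.evolve (s * t))).trans ?_)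
    · refine integral_congr_ae (Filter.Eventually.of_forall fun x => ?_)
      simp only [signedWave, halfWave, one_mul, Pi.star_apply, RCLike.star_def]
      ring
    · refine integral_congr_ae (Filter.Eventually.of_forall fun p => ?_)
      simp only [quarticAmplitude, evolve, map_mul, ← Complex.exp_conj, Complex.conj_ofReal,
        Complex.conj_I]
      have : Complex.exp ((t * (jap p.1.2 + jap (p.1.1 - p.1.2) +
          jap (p.2 - p.1.1) - s * jap p.2) : ℝ) * Complex.I) =
          Complex.exp ((t * jap p.1.2 : ℝ) * Complex.I) *
          Complex.exp ((t * jap (p.1.1 - p.1.2) : ℝ) * Complex.I) *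
          Complex.exp ((t * jap (p.2 - p.1.1) : ℝ) * Complex.I) *
          Complex.exp ((s * t * jap p.2 : ℝ) * -Complex.I) := by
        rw [← Complex.exp_add, ← Complex.exp_add, ← Complex.exp_add]
        congr 1
        push_cast
        ring
      rw [this]; ring

end Quartic

end FrequencyOrthogonality

/-! ### Superposition of a forward and a backward half wave. -/

noncomputable section TwoWaves

open Set

/-- The amplitude of the complex conjugate of a function. -/
def conjAmplitude (G : Space5 → ℂ) (ξ : Space5) : ℂ := (starRingEnd ℂ) (G (-ξ))

theorem NiceAmplitude.conjAmplitude {G : Space5 → ℂ} (hG : NiceAmplitude G) :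
    NiceAmplitude (conjAmplitude G) where
  measurable := Complex.continuous_conj.measurable.comp (hG.measurable.comp measurable_neg)
  bounded := by
    obtain ⟨C, hC⟩ := hG.bounded
    exact ⟨C, fun ξ => by rw [_root_.conjAmplitude, RCLike.norm_conj]; exact hC _⟩
  integrable_weighted := by
    refine hG.integrable_weighted.comp_neg.congr (Filter.Eventually.of_forall fun ξ => ?_)
    simp only [_root_.conjAmplitude, RCLike.norm_conj, jap_neg]

/-- Conjugation makes the backward wave a forward one, so every unwanted cross term contains three
forward factors. -/
theorem conj_signedWave (G : Space5 → ℂ) (p : ℝ × Space5) :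
    (starRingEnd ℂ) (signedWave G (-1) p) = signedWave (conjAmplitude G) 1 p := by
  simp only [signedWave, halfWave, Real.fourierInv_eq']
  rw [← integral_conj, ← integral_neg_eq_self]
  refine integral_congr_ae (Filter.Eventually.of_forall fun ξ => ?_)
  simp only [evolve, conjAmplitude, smul_eq_mul, map_mul, ← Complex.exp_conj, Complex.conj_ofReal,
    Complex.conj_I, inner_neg_left, jap_neg]
  congr 2
  · push_cast; ring_nf
  · congr 1; push_cast; ring

/-- The terms inside `re` are grouped, conjugating where necessary, so that with `a` and the
conjugate of `b` forward each has three forward factors and one more conjugated wave. -/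
theorem norm_add_pow_four (a b : ℂ) :
    ‖a + b‖ ^ 4 = ‖a‖ ^ 4 + 4 * (‖a‖ ^ 2 * ‖b‖ ^ 2) + ‖b‖ ^ 4 +
      (4 * (a * a * ((starRingEnd ℂ) b * (starRingEnd ℂ) a)) +
       2 * (a * a * ((starRingEnd ℂ) b * (starRingEnd ℂ) b)) +
       4 * (a * (starRingEnd ℂ) b * ((starRingEnd ℂ) b * b))).re := by
  have h : ∀ z : ℂ, ‖z‖ ^ 4 = (z.re * z.re + z.im * z.im) ^ 2 := fun z => by
    rw [show ‖z‖ ^ 4 = (‖z‖ ^ 2) ^ 2 by ring, ← Complex.normSq_eq_norm_sq, Complex.normSq_apply]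
  have h2 : ∀ z : ℂ, ‖z‖ ^ 2 = z.re * z.re + z.im * z.im := fun z => by
    rw [← Complex.normSq_eq_norm_sq, Complex.normSq_apply]
  rw [h, h, h, h2, h2]
  simp only [Complex.add_re, Complex.add_im, Complex.mul_re, Complex.mul_im, Complex.conj_re,
    Complex.conj_im, Complex.re_ofNat, Complex.im_ofNat]
  ring

variable {F G : Space5 → ℂ}

theorem integrable_norm_pow_four {f : ℝ × Space5 → ℂ} (hf : MemLp f 4) :
    Integrable fun p => ‖f p‖ ^ 4 := by
  have := hf.integrable_norm_pow (p := 4) (by norm_num)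
  simpa using this

theorem integrable_norm_sq_mul_norm_sq {f g : ℝ × Space5 → ℂ} (hf : MemLp f 4) (hg : MemLp g 4) :
    Integrable fun p => ‖f p‖ ^ 2 * ‖g p‖ ^ 2 := by
  refine (integrable_quartic_product hf hf hg hg).norm.congr
    (Filter.Eventually.of_forall fun p => ?_)
  simp only [norm_mul]; ring

/-- Orthogonality of the three frequency components of the square of a solution. -/
theorem integral_norm_add_pow_four (hF : NiceAmplitude F) (hG : NiceAmplitude G) :
    ∫ p, ‖signedWave F 1 p + signedWave G (-1) p‖ ^ 4 =
      (∫ p, ‖signedWave F 1 p‖ ^ 4) +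
      4 * (∫ p, ‖signedWave F 1 p‖ ^ 2 * ‖signedWave G (-1) p‖ ^ 2) +
      ∫ p, ‖signedWave G (-1) p‖ ^ 4 := by
  have ha := memLp_signedWave hF (s := 1) (Or.inl rfl)
  have hb := memLp_signedWave hG (s := -1) (Or.inr rfl)
  have hG' := hG.conjAmplitude
  have hd := memLp_signedWave hG' (s := 1) (Or.inl rfl)
  have x1 := integrable_quartic_product ha ha hd ha.star
  have x2 := integrable_quartic_product ha ha hd hb.star
  have x3 := integrable_quartic_product ha hd hd hd.star
  have z1 := integral_quartic_eq_zero hF hF hG' hF (s := 1) (Or.inl rfl)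
  have z2 := integral_quartic_eq_zero hF hF hG' hG (s := -1) (Or.inr rfl)
  have z3 := integral_quartic_eq_zero hF hG' hG' hG' (s := 1) (Or.inl rfl)
  simp only [Pi.star_apply, RCLike.star_def] at x1 x2 x3
  have X := ((x1.const_mul 4).add (x2.const_mul 2)).add (x3.const_mul 4)
  have hX : ∫ p, (4 * (signedWave F 1 p * signedWave F 1 p * (signedWave (conjAmplitude G) 1 p *
        (starRingEnd ℂ) (signedWave F 1 p))) +
      2 * (signedWave F 1 p * signedWave F 1 p * (signedWave (conjAmplitude G) 1 p *
        (starRingEnd ℂ) (signedWave G (-1) p))) +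
      4 * (signedWave F 1 p * signedWave (conjAmplitude G) 1 p * (signedWave (conjAmplitude G) 1 p *
        (starRingEnd ℂ) (signedWave (conjAmplitude G) 1 p)))).re = 0 := by
    have h1 := integral_add ((x1.const_mul 4).add (x2.const_mul 2)) (x3.const_mul 4)
    have h2 := integral_add (x1.const_mul 4) (x2.const_mul 2)
    have h3 := integral_re X
    simp only [Pi.add_apply, RCLike.re_eq_complex_re] at h1 h2 h3
    rw [h3, h1, h2, integral_const_mul, integral_const_mul, integral_const_mul, z1, z2, z3]
    simp
  have i4 := integrable_norm_pow_four ha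
  have j4 := integrable_norm_pow_four hb
  have ij := (integrable_norm_sq_mul_norm_sq ha hb).const_mul 4
  calc ∫ p, ‖signedWave F 1 p + signedWave G (-1) p‖ ^ 4 =
      ∫ p, (‖signedWave F 1 p‖ ^ 4 + 4 * (‖signedWave F 1 p‖ ^ 2 * ‖signedWave G (-1) p‖ ^ 2) +
        ‖signedWave G (-1) p‖ ^ 4 + (4 * (signedWave F 1 p * signedWave F 1 p *
        (signedWave (conjAmplitude G) 1 p * (starRingEnd ℂ) (signedWave F 1 p))) +
      2 * (signedWave F 1 p * signedWave F 1 p * (signedWave (conjAmplitude G) 1 p *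
        (starRingEnd ℂ) (signedWave G (-1) p))) +
      4 * (signedWave F 1 p * signedWave (conjAmplitude G) 1 p * (signedWave (conjAmplitude G) 1 p *
        (starRingEnd ℂ) (signedWave (conjAmplitude G) 1 p)))).re) := by
        refine integral_congr_ae (Filter.Eventually.of_forall fun p => ?_)
        simp only
        rw [norm_add_pow_four, ← conj_signedWave, Complex.conj_conj]
    _ = _ := by
        have h1 := integral_add ((i4.add ij).add j4) X.re
        have h2 := integral_add (i4.add ij) j4
        have h3 := integral_add i4 ij
        simp only [Pi.add_apply, RCLike.re_eq_complex_re] at h1 h2 h3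
        rw [h1, h2, h3, hX, integral_const_mul, add_zero]

theorem integral_norm_sq_mul_norm_sq_le {f g : ℝ × Space5 → ℂ} (hf : MemLp f 4)
    (hg : MemLp g 4) {K L : ℝ} (hK : 0 ≤ K) (hL : 0 ≤ L) (h1 : ∫ p, ‖f p‖ ^ 4 ≤ K ^ 2)
    (h2 : ∫ p, ‖g p‖ ^ 4 ≤ L ^ 2) : ∫ p, ‖f p‖ ^ 2 * ‖g p‖ ^ 2 ≤ K * L := by
  have hsq : ∀ {h : ℝ × Space5 → ℂ}, MemLp h 4 → MemLp (fun p => ‖h p‖ ^ 2)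
      (ENNReal.ofReal 2) := fun {h} hh => by
    rw [show ENNReal.ofReal 2 = 2 by simp, memLp_two_iff_integrable_sq
      (show AEStronglyMeasurable (fun p => ‖h p‖ ^ 2) volume from hh.1.norm.pow 2)]
    exact (integrable_norm_pow_four hh).congr (Filter.Eventually.of_forall fun p => by ring)
  have h := integral_mul_le_Lp_mul_Lq_of_nonneg (μ := (volume : Measure (ℝ × Space5)))
    (p := 2) (q := 2) ⟨by norm_num, by norm_num, by norm_num⟩
    (f := fun p => ‖f p‖ ^ 2) (g := fun p => ‖g p‖ ^ 2)
    (Filter.Eventually.of_forall fun p => by positivity)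
    (Filter.Eventually.of_forall fun p => by positivity) (hsq hf) (hsq hg)
  have e : ∀ h : ℝ × Space5 → ℂ, (∫ p, (‖h p‖ ^ 2) ^ (2 : ℝ)) ^ (1 / 2 : ℝ) =
      √(∫ p, ‖h p‖ ^ 4) := fun h => by
    rw [Real.sqrt_eq_rpow]
    congr 1
    refine integral_congr_ae (Filter.Eventually.of_forall fun p => ?_)
    simp only [Real.rpow_two]; ring
  rw [e, e] at h
  refine h.trans (mul_le_mul ?_ ?_ (Real.sqrt_nonneg _) hK)
  · rw [Real.sqrt_le_left hK]; exact h1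
  · rw [Real.sqrt_le_left hL]; exact h2

theorem lintegral_enorm_pow_four {f : ℝ × Space5 → ℂ} (hf : MemLp f 4) :
    ∫⁻ p, ‖f p‖ₑ ^ 4 = ENNReal.ofReal (∫ p, ‖f p‖ ^ 4) := by
  rw [ofReal_integral_eq_lintegral_ofReal (integrable_norm_pow_four hf)
    (Filter.Eventually.of_forall fun p => by positivity)]
  refine lintegral_congr fun p => ?_
  rw [ENNReal.ofReal_pow (norm_nonneg _), ofReal_norm]

/-- Keeps the right-hand side nonnegative, so that the bound under `ENNReal.ofReal` can be read off
in the reals. -/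
theorem halfOrderEnergy_sq_le_energy_sq (hF : NiceAmplitude F) :
    halfOrderEnergy F ^ 2 ≤ energy F ^ 2 :=
  pow_le_pow_left₀ (halfOrderEnergy_nonneg F)
    (halfOrderEnergy_le_energy hF.measurable hF.integrable_energy) 2

theorem integral_signedWave_pow_four_le (hF : NiceAmplitude F) {s : ℝ} (hs : s = 1 ∨ s = -1) :
    ∫ p, ‖signedWave F s p‖ ^ 4 ≤
      1 / (24 * π ^ 2) * (energy F ^ 2 - halfOrderEnergy F ^ 2) := by
  have h := lintegral_halfWave_pow_four_le_energy hF
  rw [← lintegral_signedWave_pow_four hF hs, lintegral_enorm_pow_four (memLp_signedWave hF hs)] at h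
  refine (ENNReal.ofReal_le_ofReal_iff ?_).1 h
  have := halfOrderEnergy_sq_le_energy_sq hF
  exact mul_nonneg (by positivity) (by linarith)

/-- The sharp Strichartz estimate, with its gain, for absolutely convergent solutions. -/
theorem lintegral_two_waves_pow_four_le (hF : NiceAmplitude F) (hG : NiceAmplitude G) :
    ∫⁻ p, ‖signedWave F 1 p + signedWave G (-1) p‖ₑ ^ 4 ≤
      ENNReal.ofReal (1 / (24 * π ^ 2) * (3 / 2 * (energy F + energy G) ^ 2 -
        halfOrderEnergy F ^ 2 - halfOrderEnergy G ^ 2)) := by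
  have ha := memLp_signedWave hF (s := 1) (Or.inl rfl)
  have hb := memLp_signedWave hG (s := -1) (Or.inr rfl)
  have h1 := integral_signedWave_pow_four_le hF (s := 1) (Or.inl rfl)
  have h2 := integral_signedWave_pow_four_le hG (s := -1) (Or.inr rfl)
  have hab : MemLp (fun p => signedWave F 1 p + signedWave G (-1) p) 4 := ha.add hb
  rw [lintegral_enorm_pow_four hab]
  refine ENNReal.ofReal_le_ofReal ?_
  rw [integral_norm_add_pow_four hF hG]
  have hc : 0 ≤ 1 / (24 * π ^ 2) := by positivity
  set c := 1 / (24 * π ^ 2)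
  have hcs : √c ^ 2 = c := Real.sq_sqrt hc
  have h3 := integral_norm_sq_mul_norm_sq_le ha hb
    (mul_nonneg (Real.sqrt_nonneg c) (energy_nonneg F))
    (mul_nonneg (Real.sqrt_nonneg c) (energy_nonneg G))
    (h1.trans (by rw [mul_pow, hcs]; nlinarith [sq_nonneg (halfOrderEnergy F)]))
    (h2.trans (by rw [mul_pow, hcs]; nlinarith [sq_nonneg (halfOrderEnergy G)]))
  have h4 : √c * energy F * (√c * energy G) = c * (energy F * energy G) := by
    linear_combination (energy F * energy G) * hcs
  rw [h4] at h3
  -- With `x`, `y` the energies, `(3/2)(x+y)² - (x² + 4xy + y²) = (1/2)(x-y)²`: balanced energies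
  -- are the extremal case.
  nlinarith [mul_nonneg hc (sq_nonneg (energy F - energy G))]

/-- The fourth moment of twice the real part of a half wave. -/
theorem lintegral_real_wave_pow_four (hF : NiceAmplitude F) (hconj : conjAmplitude F = F) :
    ∫⁻ p, ‖signedWave F 1 p + signedWave F (-1) p‖ₑ ^ 4 =
      6 * ∫⁻ t, ∫⁻ x, ‖halfWave F t x‖ₑ ^ 4 := by
  have ha := memLp_signedWave hF (s := 1) (Or.inl rfl)
  have hb := memLp_signedWave hF (s := -1) (Or.inr rfl)
  have hn : ∀ p, ‖signedWave F (-1) p‖ = ‖signedWave F 1 p‖ := fun p => by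
    rw [← RCLike.norm_conj, conj_signedWave, hconj]
  have hab : MemLp (fun p => signedWave F 1 p + signedWave F (-1) p) 4 := ha.add hb
  rw [← lintegral_signedWave_pow_four hF (s := 1) (Or.inl rfl), lintegral_enorm_pow_four ha,
    lintegral_enorm_pow_four hab]
  rw [integral_norm_add_pow_four hF hF]
  simp only [hn]
  have : ∀ p, ‖signedWave F 1 p‖ ^ 2 * ‖signedWave F 1 p‖ ^ 2 = ‖signedWave F 1 p‖ ^ 4 :=
    fun p => by ring
  simp_rw [this]
  rw [show (6 : ℝ≥0∞) = ENNReal.ofReal 6 by simp, ← ENNReal.ofReal_mul (by norm_num)]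
  congr 1; ring

end TwoWaves

/-! ### Weak solutions on the Fourier side. -/

noncomputable section SolutionRepresentation

open Set

/-- The mean value inequality for `cos y + y sin x`, whose derivative between `x` and `x + h` is at
most `|h|`. -/
theorem abs_cos_taylor_le (x h : ℝ) :
    |Real.cos (x + h) - Real.cos x + h * Real.sin x| ≤ h ^ 2 := by
  have key := Convex.norm_image_sub_le_of_norm_hasDerivWithin_le (𝕜 := ℝ)
    (f := fun y => Real.cos y + y * Real.sin x) (f' := fun y => -Real.sin y + 1 * Real.sin x)
    (s := uIcc x (x + h)) (C := |h|) (x := x) (y := x + h)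
    (fun y _ => ((Real.hasDerivAt_cos y).add
      ((hasDerivAt_id y).mul_const (Real.sin x))).hasDerivWithinAt) ?_ (convex_uIcc _ _)
    left_mem_uIcc right_mem_uIcc
  · have e : Real.cos (x + h) + (x + h) * Real.sin x - (Real.cos x + x * Real.sin x) =
      Real.cos (x + h) - Real.cos x + h * Real.sin x := by ring
    rw [e, add_sub_cancel_left, Real.norm_eq_abs, Real.norm_eq_abs, ← sq, sq_abs] at key
    exact key
  · intro y hy
    have h1 : |y - x| ≤ |h| := by
      have := abs_sub_left_of_mem_uIcc hy
      simpa using this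
    have h2 := Real.abs_sin_sub_sin_le y x
    rw [Real.norm_eq_abs, one_mul, neg_add_eq_sub, abs_sub_comm]
    exact h2.trans h1

theorem abs_sin_taylor_le (x h : ℝ) :
    |Real.sin (x + h) - Real.sin x - h * Real.cos x| ≤ h ^ 2 := by
  have := abs_cos_taylor_le (x - π / 2) h
  rw [show x - π / 2 + h = x + h - π / 2 by ring, Real.cos_sub_pi_div_two,
    Real.cos_sub_pi_div_two, Real.sin_sub_pi_div_two] at this
  convert this using 2
  ring

/-- A quadratic Taylor bound gives differentiability of a curve in `L²`. -/
theorem hasDerivAt_Lp_of_taylor {c : ℝ → L2Space5} {c' : L2Space5} {t : ℝ} {k : Space5 → ℝ}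
    (hk : MemLp k 2) (h : ∀ s, ∀ᵐ ξ, ‖c s ξ - c t ξ - ((s - t : ℝ) : ℂ) * c' ξ‖ ≤
      (s - t) ^ 2 * k ξ) : HasDerivAt c c' t := by
  have hb : ∀ s, ‖c s - c t - (s - t) • c'‖ ≤ (s - t) ^ 2 * ‖hk.toLp k‖ := by
    intro s
    have h1 : ‖c s - c t - (s - t) • c'‖ ≤ ‖((s - t) ^ 2) • hk.toLp k‖ := by
      refine Lp.norm_le_norm_of_ae_le ?_
      filter_upwards [h s, Lp.coeFn_sub (c s - c t) ((s - t) • c'), Lp.coeFn_sub (c s) (c t),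
        Lp.coeFn_smul (s - t) c', Lp.coeFn_smul ((s - t) ^ 2) (hk.toLp k), hk.coeFn_toLp]
        with ξ h1 h2 h3 h4 h5 h6
      rw [h2, Pi.sub_apply, h3, Pi.sub_apply, h4, Pi.smul_apply, h5, Pi.smul_apply, h6,
        Complex.real_smul]
      exact h1.trans (le_abs_self _)
    rwa [norm_smul, Real.norm_of_nonneg (sq_nonneg _)] at h1
  rw [hasDerivAt_iff_isLittleO]
  refine Asymptotics.IsBigO.trans_isLittleO (g := fun s => (s - t) ^ 2) ?_ ?_
  · refine Asymptotics.IsBigO.of_bound ‖hk.toLp k‖ (Filter.Eventually.of_forall fun s => ?_)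
    rw [Real.norm_of_nonneg (sq_nonneg _), mul_comm]
    exact hb s
  · exact (Asymptotics.isLittleO_pow_id (𝕜 := ℝ) one_lt_two).comp_tendsto
      (tendsto_sub_nhds_zero_iff.2 Filter.tendsto_id)

/-- A product rule for the inner product of a differentiable curve with a curve which is
continuous and weakly differentiable. -/
theorem hasDerivAt_inner_of_weak {H : Type*} [NormedAddCommGroup H] [InnerProductSpace ℂ H]
    {p W : ℝ → H} {p' : H} {d : ℂ} {t : ℝ} (hp : HasDerivAt p p' t) (hW : ContinuousAt W t)
    (hd : HasDerivAt (fun s => inner ℂ (p t) (W s)) d t) :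
    HasDerivAt (fun s => inner ℂ (p s) (W s)) (d + inner ℂ p' (W t)) t := by
  -- The difference quotients of `p` converge in norm, so continuity of `W` is enough; the remaining
  -- term is the weak derivative.
  have h2 : HasDerivAt (fun s => inner ℂ (p s - p t) (W s)) (inner ℂ p' (W t)) t := by
    rw [hasDerivAt_iff_tendsto_slope] at hp ⊢
    have h3 := hp.inner (𝕜 := ℂ) (hW.tendsto.mono_left nhdsWithin_le_nhds)
    refine h3.congr fun s => ?_
    simp only [slope, vsub_eq_sub, sub_self, inner_zero_left, sub_zero]
    rw [← Complex.coe_smul, inner_smul_left, Complex.conj_ofReal, Complex.real_smul]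
  refine (hd.add h2).congr_of_eventuallyEq (Filter.Eventually.of_forall fun s => ?_)
  simp only [Pi.add_apply, inner_sub_left]
  ring

theorem contDiff_jap : ContDiff ℝ (⊤ : ℕ∞) jap := by
  unfold jap
  have h : ContDiff ℝ (⊤ : ℕ∞) fun ξ : Space5 => 1 + (2 * π * ‖ξ‖) ^ 2 := by
    simp_rw [mul_pow]
    exact contDiff_const.add (contDiff_const.mul (contDiff_norm_sq ℝ))
  exact h.sqrt fun ξ => by positivity

/-- The symbol of `Δ - 1` is `-(jap x)²`, which is even, so it is the same for `𝓕` and `𝓕⁻`. -/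
theorem fourierInv_laplacian_sub (φ : 𝓢(Space5, ℂ)) (x : Space5) :
    (𝓕⁻ (Δ φ - φ)) x = -((jap x : ℂ) ^ 2 * (𝓕⁻ φ) x) := by
  have hgr : (fun x : Space5 => ‖x‖ ^ 2).HasTemperateGrowth := by fun_prop
  have h1 : 𝓕 (Δ φ) = (-(2 * π) ^ 2 : ℝ) •
      SchwartzMap.smulLeftCLM ℂ (fun x : Space5 => ‖x‖ ^ 2) (𝓕 φ) := by
    rw [SchwartzMap.laplacian_eq_fourierMultiplierCLM, SchwartzMap.fourierMultiplierCLM_apply,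
      FourierTransform.fourier_smul, FourierTransform.fourier_fourierInv_eq]
  have h2 : ∀ g : 𝓢(Space5, ℂ), (𝓕⁻ g) x = (𝓕 g) (-x) := fun g => by
    rw [SchwartzMap.fourierInv_coe, SchwartzMap.fourier_coe, Real.fourierInv_eq_fourier_neg]
  have h3 : 𝓕 (Δ φ - φ) = 𝓕 (Δ φ) - 𝓕 φ := by
    rw [sub_eq_add_neg, FourierTransform.fourier_add, sub_eq_add_neg]
    congr 1
    simp
  rw [h2, h2, h3, h1]
  rw [sub_apply, smul_apply, SchwartzMap.smulLeftCLM_apply_apply hgr]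
  have h4 : ((jap x : ℝ) : ℂ) ^ 2 = 1 + 4 * (π : ℂ) ^ 2 * (‖x‖ : ℂ) ^ 2 := by
    rw [← Complex.ofReal_pow, jap_sq]; push_cast; ring
  rw [h4, norm_neg, Complex.real_smul, Complex.real_smul]
  push_cast
  ring

theorem laplacian_fourier_sub {ψ χ : 𝓢(Space5, ℂ)} (h : ∀ x, χ x = (jap x : ℂ) ^ 2 * ψ x) :
    Δ (𝓕 ψ) - 𝓕 ψ = 𝓕 (-χ) := by
  have : 𝓕⁻ (Δ (𝓕 ψ) - 𝓕 ψ) = -χ := by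
    ext x
    rw [fourierInv_laplacian_sub, FourierTransform.fourierInv_fourier_eq, neg_apply, h]
  rw [← this, FourierTransform.fourier_fourierInv_eq]

/-- Multiplication of a real test function by a smooth real function. -/
theorem memLp_test {m χ : Space5 → ℝ} (hm : Continuous m) (hχ : Continuous χ)
    (hs : HasCompactSupport χ) : MemLp (fun ξ => ((m ξ * χ ξ : ℝ) : ℂ)) 2 := by
  refine Continuous.memLp_of_hasCompactSupport (by fun_prop) ?_
  exact (hs.mul_left (f := m)).comp_left (g := fun r : ℝ => (r : ℂ)) Complex.ofReal_zero

theorem inner_toLp_ofReal {m : Space5 → ℝ} (hm : MemLp (fun ξ => (m ξ : ℂ)) 2) (f : L2Space5) :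
    inner ℂ (hm.toLp _) f = ∫ ξ, f ξ * (m ξ : ℂ) := by
  rw [L2.inner_def]
  refine integral_congr_ae ?_
  filter_upwards [hm.coeFn_toLp] with ξ h
  rw [h, RCLike.inner_apply, Complex.conj_ofReal]

section Representation

variable {u : ℝ → Space5 → ℂ} (hu : IsKleinGordonSolution u)
include hu

theorem IsKleinGordonSolution.hasDerivAt_sliceCurve (t : ℝ) :
    HasDerivAt (sliceCurve u hu.memLp) (deriv (sliceCurve u hu.memLp) t) t :=
  (hu.contDiff.differentiable one_ne_zero t).hasDerivAt

theorem IsKleinGordonSolution.hasDerivAt_fourier (t : ℝ) :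
    HasDerivAt (fun s => (𝓕 (sliceCurve u hu.memLp s) : L2Space5))
      (𝓕 (deriv (sliceCurve u hu.memLp) t) : L2Space5) t :=
  ((Lp.fourierTransformₗᵢ Space5 ℂ).toContinuousLinearEquiv.toContinuousLinearMap.restrictScalars
    ℝ).hasFDerivAt.comp_hasDerivAt t (hu.hasDerivAt_sliceCurve t)

theorem IsKleinGordonSolution.continuous_fourier_deriv :
    Continuous fun s => (𝓕 (deriv (sliceCurve u hu.memLp) s) : L2Space5) :=
  (Lp.fourierTransformₗᵢ Space5 ℂ).continuous.comp (hu.contDiff.continuous_deriv le_rfl)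

/-- The Klein-Gordon equation on the Fourier side, tested against compactly supported smooth
functions. -/
theorem IsKleinGordonSolution.weak_eq_fourier {g : Space5 → ℝ} (hg : ContDiff ℝ (⊤ : ℕ∞) g)
    (hgs : HasCompactSupport g) (t : ℝ) :
    HasDerivAt (fun s => ∫ ξ, (𝓕 (deriv (sliceCurve u hu.memLp) s) : L2Space5) ξ * (g ξ : ℂ))
      (-∫ ξ, (𝓕 (sliceCurve u hu.memLp t) : L2Space5) ξ * ((jap ξ ^ 2 * g ξ : ℝ) : ℂ)) t := by
  have h1 : ContDiff ℝ (⊤ : ℕ∞) fun ξ => (g ξ : ℂ) := Complex.ofRealCLM.contDiff.comp hg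
  have h2 : HasCompactSupport fun ξ => (g ξ : ℂ) :=
    hgs.comp_left (g := fun r : ℝ => (r : ℂ)) Complex.ofReal_zero
  have h3 : ContDiff ℝ (⊤ : ℕ∞) fun ξ => ((jap ξ ^ 2 * g ξ : ℝ) : ℂ) :=
    Complex.ofRealCLM.contDiff.comp ((contDiff_jap.pow 2).mul hg)
  have h4 : HasCompactSupport fun ξ => ((jap ξ ^ 2 * g ξ : ℝ) : ℂ) :=
    (hgs.mul_left (f := fun ξ => jap ξ ^ 2)).comp_left (g := fun r : ℝ => (r : ℂ))
      Complex.ofReal_zero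
  set ψ : 𝓢(Space5, ℂ) := h2.toSchwartzMap h1
  set χ : 𝓢(Space5, ℂ) := h4.toSchwartzMap h3
  have hψ : ∀ ξ, ψ ξ = (g ξ : ℂ) := fun ξ => rfl
  have hχ : ∀ ξ, χ ξ = ((jap ξ ^ 2 * g ξ : ℝ) : ℂ) := fun ξ => rfl
  have hlap := laplacian_fourier_sub (ψ := ψ) (χ := χ) fun x => by
    rw [hψ, hχ]; push_cast; ring
  -- Testing against `𝓕 ψ` and moving the transform onto the solution gives the equation tested
  -- against `ψ`.
  have h := hu.weak_eq (𝓕 ψ) t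
  simp_rw [← integral_fourier_Lp_mul, hψ] at h
  convert h using 1
  have e : ∀ x, (Δ (𝓕 ψ) : 𝓢(Space5, ℂ)) x - (𝓕 ψ) x = (𝓕 (-χ)) x := fun x => by
    rw [← hlap, sub_apply]
  simp_rw [e]
  have e2 : ∫ x, u t x * (𝓕 (-χ)) x = ∫ x, (sliceCurve u hu.memLp t) x * (𝓕 (-χ)) x := by
    refine integral_congr_ae ?_
    filter_upwards [(hu.memLp t).coeFn_toLp] with x hx
    rw [sliceCurve, hx]
  rw [e2, ← integral_fourier_Lp_mul, ← integral_neg]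
  refine integral_congr_ae (Filter.Eventually.of_forall fun ξ => ?_)
  simp only [neg_apply, hχ, mul_neg]

/-- The Fourier transform of a solution. -/
theorem IsKleinGordonSolution.fourier_eq (T : ℝ) :
    (𝓕 (sliceCurve u hu.memLp T) : L2Space5) =ᵐ[volume] fun ξ =>
      (Real.cos (T * jap ξ) : ℂ) * (𝓕 hu.initialPosition : L2Space5) ξ +
      (Real.sin (T * jap ξ) / jap ξ : ℝ) * (𝓕 hu.initialVelocity : L2Space5) ξ := by
  have hj := continuous_jap
  have hj0 : ∀ ξ, jap ξ ≠ 0 := fun ξ => (jap_pos ξ).ne'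
  set X : ℝ → L2Space5 := fun s => 𝓕 (sliceCurve u hu.memLp s) with hX
  set W : ℝ → L2Space5 := fun s => 𝓕 (deriv (sliceCurve u hu.memLp) s) with hW
  have hXd : ∀ t, HasDerivAt X (W t) t := hu.hasDerivAt_fourier
  have hWc : Continuous W := hu.continuous_fourier_deriv
  have hX0 : (𝓕 hu.initialPosition : L2Space5) = X 0 := rfl
  have hW0 : (𝓕 hu.initialVelocity : L2Space5) = W 0 := rfl
  rw [hX0, hW0]
  have hmX : LocallyIntegrable (X T : Space5 → ℂ) := (Lp.memLp _).locallyIntegrable (by norm_num)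
  have hcosb : ∀ ξ, ‖(Real.cos (T * jap ξ) : ℂ)‖ ≤ 1 := fun ξ => by
    rw [Complex.norm_real]; exact Real.abs_cos_le_one _
  have hsinb : ∀ ξ, ‖((Real.sin (T * jap ξ) / jap ξ : ℝ) : ℂ)‖ ≤ 1 := fun ξ => by
    rw [Complex.norm_real, norm_div, Real.norm_of_nonneg (jap_pos ξ).le]
    exact div_le_one_of_le₀ ((Real.abs_sin_le_one _).trans (one_le_jap ξ)) (jap_pos ξ).le
  have hbdd : ∀ {m : Space5 → ℝ}, Measurable m → (∀ ξ, ‖(m ξ : ℂ)‖ ≤ 1) → ∀ f : L2Space5,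
      MemLp (fun ξ => (m ξ : ℂ) * f ξ) 2 := by
    intro m hm hb f
    refine (Lp.memLp f).mono ((Measurable.aestronglyMeasurable (by fun_prop)).mul
      (Lp.aestronglyMeasurable f)) (Filter.Eventually.of_forall fun ξ => ?_)
    rw [norm_mul]
    exact mul_le_of_le_one_left (norm_nonneg _) (hb ξ)
  have hm1 := hbdd (m := fun ξ => Real.cos (T * jap ξ)) (by fun_prop) hcosb (X 0)
  have hm2 := hbdd (m := fun ξ => Real.sin (T * jap ξ) / jap ξ) (by fun_prop) hsinb (W 0)
  refine ae_eq_of_integral_contDiff_smul_eq hmX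
    ((hm1.add hm2).locallyIntegrable (by norm_num)) fun χ hχ hχs => ?_
  have hχc := hχ.continuous
  have hsc : ∀ t, Continuous fun ξ => Real.sin ((T - t) * jap ξ) / jap ξ := fun t =>
    (by fun_prop : Continuous fun ξ => Real.sin ((T - t) * jap ξ)).div hj hj0
  -- Duality: the solution is paired with the backward solution having data prescribed at time `T`.
  -- The cutoff `χ` makes every multiplier square integrable.
  have hpm : ∀ t, MemLp (fun ξ => ((Real.sin ((T - t) * jap ξ) / jap ξ * χ ξ : ℝ) : ℂ)) 2 :=
    fun t => memLp_test (hsc t) hχc hχs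
  have hqm : ∀ t, MemLp (fun ξ => ((Real.cos ((T - t) * jap ξ) * χ ξ : ℝ) : ℂ)) 2 := fun t =>
    memLp_test (by fun_prop) hχc hχs
  have hqm' : ∀ t, MemLp (fun ξ => ((jap ξ * Real.sin ((T - t) * jap ξ) * χ ξ : ℝ) : ℂ)) 2 :=
    fun t => memLp_test (by fun_prop) hχc hχs
  have hpm' : ∀ t, MemLp (fun ξ => ((-Real.cos ((T - t) * jap ξ) * χ ξ : ℝ) : ℂ)) 2 := fun t =>
    memLp_test (by fun_prop) hχc hχs
  have hk : MemLp (fun ξ => jap ξ ^ 2 * |χ ξ|) 2 :=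
    Continuous.memLp_of_hasCompactSupport (by fun_prop)
      ((hχs.comp_left (g := fun r : ℝ => |r|) abs_zero).mul_left (f := fun ξ => jap ξ ^ 2))
  have hpd : ∀ t, HasDerivAt (fun s => (hpm s).toLp _) ((hpm' t).toLp _) t := by
    intro t
    refine hasDerivAt_Lp_of_taylor hk fun s => ?_
    filter_upwards [(hpm s).coeFn_toLp, (hpm t).coeFn_toLp, (hpm' t).coeFn_toLp] with ξ h1 h2 h3
    rw [h1, h2, h3, ← Complex.ofReal_mul, ← Complex.ofReal_sub, ← Complex.ofReal_sub,
      Complex.norm_real, Real.norm_eq_abs]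
    have hp := jap_pos ξ
    have ht := abs_sin_taylor_le ((T - t) * jap ξ) ((t - s) * jap ξ)
    rw [← add_mul, show T - t + (t - s) = T - s by ring] at ht
    have e : Real.sin ((T - s) * jap ξ) / jap ξ * χ ξ - Real.sin ((T - t) * jap ξ) / jap ξ * χ ξ -
        (s - t) * (-Real.cos ((T - t) * jap ξ) * χ ξ) =
        (Real.sin ((T - s) * jap ξ) - Real.sin ((T - t) * jap ξ) -
          (t - s) * jap ξ * Real.cos ((T - t) * jap ξ)) * (χ ξ / jap ξ) := by
      field_simp; ring
    rw [e, abs_mul, abs_div, abs_of_pos hp]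
    calc _ ≤ ((t - s) * jap ξ) ^ 2 * (|χ ξ| / 1) := by
          gcongr
          exact one_le_jap ξ
      _ = _ := by ring
  have hqd : ∀ t, HasDerivAt (fun s => (hqm s).toLp _) ((hqm' t).toLp _) t := by
    intro t
    refine hasDerivAt_Lp_of_taylor hk fun s => ?_
    filter_upwards [(hqm s).coeFn_toLp, (hqm t).coeFn_toLp, (hqm' t).coeFn_toLp] with ξ h1 h2 h3
    rw [h1, h2, h3, ← Complex.ofReal_mul, ← Complex.ofReal_sub, ← Complex.ofReal_sub,
      Complex.norm_real, Real.norm_eq_abs]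
    have ht := abs_cos_taylor_le ((T - t) * jap ξ) ((t - s) * jap ξ)
    rw [← add_mul, show T - t + (t - s) = T - s by ring] at ht
    have e : Real.cos ((T - s) * jap ξ) * χ ξ - Real.cos ((T - t) * jap ξ) * χ ξ -
        (s - t) * (jap ξ * Real.sin ((T - t) * jap ξ) * χ ξ) =
        (Real.cos ((T - s) * jap ξ) - Real.cos ((T - t) * jap ξ) +
          (t - s) * jap ξ * Real.sin ((T - t) * jap ξ)) * χ ξ := by ring
    rw [e, abs_mul]
    calc _ ≤ ((t - s) * jap ξ) ^ 2 * |χ ξ| := by gcongr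
      _ = _ := by ring
  have hweak : ∀ t, HasDerivAt (fun s => inner ℂ ((hpm t).toLp _) (W s))
      (-inner ℂ ((hqm' t).toLp _) (X t)) t := by
    intro t
    have hcd : ContDiff ℝ (⊤ : ℕ∞) fun ξ => Real.sin ((T - t) * jap ξ) / jap ξ * χ ξ :=
      (((Real.contDiff_sin.comp (contDiff_const.mul contDiff_jap)).div contDiff_jap hj0).mul hχ)
    have h := hu.weak_eq_fourier hcd hχs.mul_left t
    simp_rw [inner_toLp_ofReal]
    convert h using 4 with ξ
    congr 1
    have := hj0 ξ
    field_simp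
  -- The pairing is conserved: `p' = -q` cancels `X' = W`, and `q' = jap² p` cancels the weak
  -- equation `W' = -jap² X`. Its values at `T` and at `0` are the two sides of the formula tested
  -- against `χ`.
  have hder : ∀ t, HasDerivAt (fun s => inner ℂ ((hpm s).toLp _) (W s) +
      inner ℂ ((hqm s).toLp _) (X s)) 0 t := by
    intro t
    have h1 := hasDerivAt_inner_of_weak (hpd t) hWc.continuousAt (hweak t)
    have h2 := (hqd t).inner ℂ (hXd t)
    refine (h1.add h2).congr_deriv ?_
    have h3 : (hpm' t).toLp _ = -(hqm t).toLp _ := by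
      rw [← MemLp.toLp_neg]
      refine (MemLp.toLp_eq_toLp_iff _ _).2 (Filter.Eventually.of_forall fun ξ => ?_)
      simp
    rw [h3, inner_neg_left]
    ring
  have hconst := is_const_of_deriv_eq_zero (fun t => (hder t).differentiableAt)
    (fun t => (hder t).deriv) T 0
  simp only [inner_toLp_ofReal] at hconst
  simp only [sub_self, zero_mul, Real.sin_zero, zero_div, Complex.ofReal_zero, mul_zero, integral_zero, zero_add, Real.cos_zero, one_mul, sub_zero] at hconst
  have i1 : Integrable fun ξ => (W 0) ξ * ((Real.sin (T * jap ξ) / jap ξ * χ ξ : ℝ) : ℂ) := by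
    have := hpm 0
    rw [sub_zero] at this
    exact (Lp.memLp (W 0)).integrable_mul this
  have i2 : Integrable fun ξ => (X 0) ξ * ((Real.cos (T * jap ξ) * χ ξ : ℝ) : ℂ) := by
    have := hqm 0
    rw [sub_zero] at this
    exact (Lp.memLp (X 0)).integrable_mul this
  calc ∫ ξ, χ ξ • (X T) ξ = ∫ ξ, (X T) ξ * (χ ξ : ℂ) := by
        refine integral_congr_ae (Filter.Eventually.of_forall fun ξ => ?_)
        simp only [Complex.real_smul]; ring
    _ = _ := hconst
    _ = _ := by
        rw [← integral_add i1 i2]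
        refine integral_congr_ae (Filter.Eventually.of_forall fun ξ => ?_)
        simp only [Complex.real_smul]; push_cast; ring

end Representation

end SolutionRepresentation

/-! ### Truncation and the inequality for all finite-energy solutions. -/

noncomputable section Approximation

open Set Filter Topology

theorem fourierInv_add_of_integrable {f g : Space5 → ℂ} (hf : Integrable f) (hg : Integrable g)
    (x : Space5) : 𝓕⁻ (fun ξ => f ξ + g ξ) x = 𝓕⁻ f x + 𝓕⁻ g x := by
  have h : ∀ {f : Space5 → ℂ}, Integrable f →
      Integrable fun ξ => Complex.exp ((2 * π * inner ℝ ξ x : ℝ) * Complex.I) • f ξ := fun hf => by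
    refine hf.bdd_mul (c := 1) (Measurable.aestronglyMeasurable (by fun_prop))
      (Eventually.of_forall fun ξ => ?_)
    rw [Complex.norm_exp_ofReal_mul_I]
  simp only [Real.fourierInv_eq', smul_add]
  exact integral_add (h hf) (h hg)

theorem toReal_eLpNorm_two_sq {f : Space5 → ℂ} (hf : MemLp f 2) :
    (eLpNorm f 2 volume).toReal ^ 2 = ∫ ξ, ‖f ξ‖ ^ 2 := by
  have hm : AEStronglyMeasurable (fun ξ => ‖f ξ‖ ^ 2) := hf.1.norm.pow 2
  rw [← ENNReal.toReal_pow, eLpNorm_two_sq, integral_eq_lintegral_of_nonneg_ae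
    (Eventually.of_forall fun _ => sq_nonneg _) hm]
  congr 1
  refine lintegral_congr fun ξ => ?_
  rw [ENNReal.ofReal_pow (norm_nonneg _), ofReal_norm]

/-- Plancherel, phrased for the pointwise representatives on both sides. -/
theorem eLpNorm_fourierInv_sub {f g : Space5 → ℂ} (hf : MemLp f 2) {h : Space5 → ℂ}
    (hh : Integrable h) (hh2 : MemLp h 2) (hg : (𝓕 (hf.toLp f) : L2Space5) =ᵐ[volume] g) :
    eLpNorm (fun x => 𝓕⁻ h x - f x) 2 volume = eLpNorm (fun ξ => h ξ - g ξ) 2 volume := by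
  have h1 : (fun x => 𝓕⁻ h x - f x) =ᵐ[volume]
      ((𝓕⁻ (hh2.toLp h) - hf.toLp f : L2Space5) : Space5 → ℂ) := by
    filter_upwards [fourierInv_toLp_ae hh hh2, hf.coeFn_toLp,
      Lp.coeFn_sub (𝓕⁻ (hh2.toLp h) : L2Space5) (hf.toLp f)] with x a b c
    rw [c, Pi.sub_apply, a, b]
  have h2 : (fun ξ => h ξ - g ξ) =ᵐ[volume]
      ((hh2.toLp h - 𝓕 (hf.toLp f) : L2Space5) : Space5 → ℂ) := by
    filter_upwards [hh2.coeFn_toLp, hg,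
      Lp.coeFn_sub (hh2.toLp h) (𝓕 (hf.toLp f) : L2Space5)] with x a b c
    rw [c, Pi.sub_apply, a, b]
  rw [eLpNorm_congr_ae h1, eLpNorm_congr_ae h2, ← Lp.enorm_def, ← Lp.enorm_def]
  have h3 : (hh2.toLp h - 𝓕 (hf.toLp f) : L2Space5) =
      𝓕 (𝓕⁻ (hh2.toLp h) - hf.toLp f : L2Space5) := by
    rw [sub_eq_add_neg, sub_eq_add_neg, FourierTransform.fourier_add,
      FourierTransform.fourier_fourierInv_eq, FourierTransform.fourier_neg]
  rw [h3, ← ofReal_norm, ← ofReal_norm, Lp.norm_fourier_eq]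

section Truncation

variable {F : Space5 → ℂ}

/-- Truncation of an amplitude in frequency and in size. -/
def truncate (n : ℕ) (F : Space5 → ℂ) : Space5 → ℂ :=
  (Metric.closedBall 0 n ∩ {ξ | ‖F ξ‖ ≤ n}).indicator F

theorem norm_truncate_le (n : ℕ) (F : Space5 → ℂ) (ξ : Space5) : ‖truncate n F ξ‖ ≤ ‖F ξ‖ :=
  norm_indicator_le_norm_self _ _

theorem norm_truncate_sub_le (n : ℕ) (F : Space5 → ℂ) (ξ : Space5) :
    ‖truncate n F ξ - F ξ‖ ≤ ‖F ξ‖ := by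
  unfold truncate indicator
  split_ifs <;> simp

theorem eventually_truncate_eq (F : Space5 → ℂ) (ξ : Space5) :
    ∀ᶠ n : ℕ in atTop, truncate n F ξ = F ξ := by
  obtain ⟨m, hm⟩ := exists_nat_ge (max ‖ξ‖ ‖F ξ‖)
  filter_upwards [eventually_ge_atTop m] with n hn
  have hn' : max ‖ξ‖ ‖F ξ‖ ≤ n := hm.trans (by exact_mod_cast hn)
  refine indicator_of_mem (s := Metric.closedBall 0 n ∩ {ξ | ‖F ξ‖ ≤ n}) ⟨?_, ?_⟩ F
  · simpa using (le_max_left _ _).trans hn'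
  · exact (le_max_right _ _).trans hn'

theorem measurable_truncate (hF : Measurable F) (n : ℕ) : Measurable (truncate n F) :=
  hF.indicator (Metric.isClosed_closedBall.measurableSet.inter
    (measurableSet_le hF.norm measurable_const))

theorem niceAmplitude_truncate (hF : Measurable F) (n : ℕ) : NiceAmplitude (truncate n F) where
  measurable := measurable_truncate hF n
  bounded := by
    refine ⟨n, fun ξ => ?_⟩
    unfold truncate indicator
    split_ifs with h
    · exact h.2
    · simp
  integrable_weighted := by
    have hm := measurable_truncate hF n
    have hc : IntegrableOn (fun ξ => jap ξ ^ 2 * (n : ℝ)) (Metric.closedBall (0 : Space5) n) :=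
      ((continuous_jap.pow 2).mul continuous_const).continuousOn.integrableOn_compact
        (isCompact_closedBall _ _)
    refine (hc.integrable_indicator Metric.isClosed_closedBall.measurableSet).mono'
      (Measurable.aestronglyMeasurable (by fun_prop)) (Eventually.of_forall fun ξ => ?_)
    rw [Real.norm_of_nonneg (by positivity)]
    unfold truncate
    by_cases h : ξ ∈ Metric.closedBall (0 : Space5) n ∩ {ξ | ‖F ξ‖ ≤ n}
    · rw [indicator_of_mem h, indicator_of_mem h.1]
      have := h.2
      simp only [mem_ofPred_eq] at this
      gcongr
    · rw [indicator_of_notMem h, norm_zero, mul_zero]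
      exact indicator_nonneg (fun _ _ => by positivity) _

theorem tendsto_energy_truncate (hF : Measurable F)
    (h : Integrable fun ξ => jap ξ ^ 2 * ‖F ξ‖ ^ 2) :
    Tendsto (fun n => energy (truncate n F)) atTop (𝓝 (energy F)) := by
  have hm := measurable_truncate hF
  refine tendsto_integral_of_dominated_convergence _
    (fun n => Measurable.aestronglyMeasurable (by have := hm n; fun_prop)) h
    (fun n => Eventually.of_forall fun ξ => ?_) (Eventually.of_forall fun ξ => ?_)
  · rw [Real.norm_of_nonneg (by positivity)]
    gcongr
    exact norm_truncate_le _ _ _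
  · refine tendsto_const_nhds.congr' ?_
    filter_upwards [eventually_truncate_eq F ξ] with n hn
    rw [hn]

theorem tendsto_halfOrderEnergy_truncate (hF : Measurable F)
    (h : Integrable fun ξ => jap ξ ^ 2 * ‖F ξ‖ ^ 2) :
    Tendsto (fun n => halfOrderEnergy (truncate n F)) atTop (𝓝 (halfOrderEnergy F)) := by
  have hm := measurable_truncate hF
  refine tendsto_integral_of_dominated_convergence _
    (fun n => Measurable.aestronglyMeasurable (by have := hm n; fun_prop))
    (integrable_halfOrderEnergy hF h)
    (fun n => Eventually.of_forall fun ξ => ?_) (Eventually.of_forall fun ξ => ?_)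
  · have := jap_pos ξ
    rw [Real.norm_of_nonneg (by positivity)]
    gcongr
    exact norm_truncate_le _ _ _
  · refine tendsto_const_nhds.congr' ?_
    filter_upwards [eventually_truncate_eq F ξ] with n hn
    rw [hn]

theorem memLp_two_of_energy (hF : Measurable F)
    (h : Integrable fun ξ => jap ξ ^ 2 * ‖F ξ‖ ^ 2) : MemLp F 2 := by
  refine (memLp_two_iff_integrable_sq_norm hF.aestronglyMeasurable).2
    (h.mono' (Measurable.aestronglyMeasurable (by fun_prop)) (Eventually.of_forall fun ξ => ?_))
  rw [Real.norm_of_nonneg (by positivity)]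
  exact le_mul_of_one_le_left (by positivity) (one_le_pow₀ (one_le_jap ξ))

theorem tendsto_eLpNorm_truncate_sub (hF : Measurable F)
    (h : Integrable fun ξ => jap ξ ^ 2 * ‖F ξ‖ ^ 2) :
    Tendsto (fun n => eLpNorm (fun ξ => truncate n F ξ - F ξ) 2 volume) atTop (𝓝 0) := by
  have hm := measurable_truncate hF
  have key : Tendsto (fun n => ∫⁻ ξ, ‖truncate n F ξ - F ξ‖ₑ ^ 2) atTop (𝓝 (∫⁻ _ : Space5, 0)) := by
    refine tendsto_lintegral_of_dominated_convergence (fun ξ => ‖F ξ‖ₑ ^ 2)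
      (fun n => by have := hm n; fun_prop) (fun n => Eventually.of_forall fun ξ => ?_) ?_
      (Eventually.of_forall fun ξ => ?_)
    · exact pow_le_pow_left' (enorm_le_iff_norm_le.2 (norm_truncate_sub_le _ _ _)) 2
    · rw [← eLpNorm_two_sq]
      exact ENNReal.pow_ne_top (memLp_two_of_energy hF h).eLpNorm_ne_top
    · refine tendsto_const_nhds.congr' ?_
      filter_upwards [eventually_truncate_eq F ξ] with n hn
      simp [hn]
  simp_rw [← eLpNorm_two_sq, lintegral_zero] at key
  have := (ENNReal.continuous_rpow_const (y := 1 / 2)).tendsto 0 |>.comp key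
  have e : ∀ x : ℝ≥0∞, (x ^ 2) ^ (1 / 2 : ℝ) = x := fun x => by
    rw [← ENNReal.rpow_natCast, ← ENNReal.rpow_mul]; norm_num
  simpa only [Function.comp_def, e, ENNReal.zero_rpow_of_pos (show (0 : ℝ) < 1 / 2 by norm_num)]
    using this

end Truncation

/-- The `L⁴` estimate for a superposition of two half waves of finite energy. -/
theorem lintegral_pow_four_le_of_fourier_eq {u : ℝ → Space5 → ℂ} {F G : Space5 → ℂ}
    (hum : AEStronglyMeasurable (fun p : ℝ × Space5 => u p.1 p.2) volume)
    (hu2 : ∀ t, MemLp (u t) 2 (volume : Measure Space5))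
    (hF : Measurable F) (hG : Measurable G)
    (hFe : Integrable fun ξ => jap ξ ^ 2 * ‖F ξ‖ ^ 2)
    (hGe : Integrable fun ξ => jap ξ ^ 2 * ‖G ξ‖ ^ 2)
    (hfu : ∀ t, (𝓕 ((hu2 t).toLp (u t)) : L2Space5) =ᵐ[volume]
      fun ξ => evolve t F ξ + evolve (-t) G ξ) :
    ∫⁻ p : ℝ × Space5, ‖u p.1 p.2‖ₑ ^ 4 ≤
      ENNReal.ofReal (1 / (24 * π ^ 2) * (3 / 2 * (energy F + energy G) ^ 2 -
        halfOrderEnergy F ^ 2 - halfOrderEnergy G ^ 2)) := by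
  have hFn := niceAmplitude_truncate hF
  have hGn := niceAmplitude_truncate hG
  set w : ℕ → ℝ × Space5 → ℂ := fun n p =>
    signedWave (truncate n F) 1 p + signedWave (truncate n G) (-1) p with hw
  have hwc : ∀ n, Continuous (w n) := fun n =>
    (continuous_signedWave (hFn n) _).add (continuous_signedWave (hGn n) _)
  have hslice : ∀ n t, eLpNorm (fun x => w n (t, x) - u t x) 2 volume ≤
      eLpNorm (fun ξ => truncate n F ξ - F ξ) 2 volume +
      eLpNorm (fun ξ => truncate n G ξ - G ξ) 2 volume := by
    intro n t
    have hF' := (hFn n).evolve t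
    have hG' := (hGn n).evolve (-t)
    have e : (fun x => w n (t, x) - u t x) = fun x =>
        𝓕⁻ (fun ξ => evolve t (truncate n F) ξ + evolve (-t) (truncate n G) ξ) x - u t x := by
      funext x
      rw [fourierInv_add_of_integrable hF'.integrable hG'.integrable]
      simp [hw, signedWave, halfWave]
    rw [e, eLpNorm_fourierInv_sub (h := fun ξ => evolve t (truncate n F) ξ +
      evolve (-t) (truncate n G) ξ) (hu2 t) (hF'.integrable.add hG'.integrable)
      (hF'.memLp_two.add hG'.memLp_two) (hfu t)]
    have e2 : (fun ξ => evolve t (truncate n F) ξ + evolve (-t) (truncate n G) ξ -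
        (evolve t F ξ + evolve (-t) G ξ)) =
        evolve t (fun ξ => truncate n F ξ - F ξ) + evolve (-t) (fun ξ => truncate n G ξ - G ξ) := by
      funext ξ
      simp only [evolve, Pi.add_apply]
      ring
    rw [e2]
    have m1 : Measurable fun ξ => truncate n F ξ - F ξ := (measurable_truncate hF n).sub hF
    have m2 : Measurable fun ξ => truncate n G ξ - G ξ := (measurable_truncate hG n).sub hG
    refine (eLpNorm_add_le (measurable_evolve m1 t).aestronglyMeasurable
      (measurable_evolve m2 _).aestronglyMeasurable (by norm_num)).trans_eq ?_
    congr 1 <;> exact eLpNorm_congr_norm_ae (Eventually.of_forall fun ξ => norm_evolve _ _ _)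
  -- The slices converge in `L²` uniformly in time, but time has infinite length. A probability
  -- measure with the same null sets turns this into `L²` convergence on space-time.
  set ν : Measure ℝ := ProbabilityTheory.gaussianReal 0 1
  have hν1 : ν ≪ volume := ProbabilityTheory.gaussianReal_absolutelyContinuous 0 one_ne_zero
  have hν2 : volume ≪ ν := ProbabilityTheory.gaussianReal_absolutelyContinuous' 0 one_ne_zero
  have hp1 : ν.prod (volume : Measure Space5) ≪ volume := hν1.prod Measure.AbsolutelyContinuous.rfl
  have hp2 : (volume : Measure (ℝ × Space5)) ≪ ν.prod volume :=
    hν2.prod Measure.AbsolutelyContinuous.rfl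
  have hum' := hum.mono_ac hp1
  have hL2 : Tendsto (fun n => eLpNorm (w n - fun p : ℝ × Space5 => u p.1 p.2) 2
      (ν.prod volume)) atTop (𝓝 0) := by
    have hd := (tendsto_eLpNorm_truncate_sub hF hFe).add (tendsto_eLpNorm_truncate_sub hG hGe)
    rw [add_zero] at hd
    refine tendsto_of_tendsto_of_tendsto_of_le_of_le tendsto_const_nhds hd (fun _ => bot_le)
      fun n => ?_
    refine (ENNReal.pow_le_pow_left_iff two_ne_zero).1 ?_
    rw [eLpNorm_two_sq]
    have hmeas : AEMeasurable (fun p : ℝ × Space5 =>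
        ‖(w n - fun p : ℝ × Space5 => u p.1 p.2) p‖ₑ ^ 2) (ν.prod volume) :=
      (((hwc n).aestronglyMeasurable.sub hum').enorm).pow_const _
    rw [lintegral_prod _ hmeas]
    calc _ ≤ ∫⁻ _, (eLpNorm (fun ξ => truncate n F ξ - F ξ) 2 volume +
          eLpNorm (fun ξ => truncate n G ξ - G ξ) 2 volume) ^ 2 ∂ν := by
          refine lintegral_mono fun t => ?_
          refine le_trans (le_of_eq ?_) (pow_le_pow_left' (hslice n t) 2)
          rw [eLpNorm_two_sq]
          rfl
      _ = _ := by simp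
  -- A subsequence converges almost everywhere, and Fatou's lemma carries the `L⁴` bound to the
  -- limit.
  obtain ⟨ns, hns, hae⟩ := (tendstoInMeasure_of_tendsto_eLpNorm two_ne_zero
    (fun n => (hwc n).aestronglyMeasurable) hum' hL2).exists_seq_tendsto_ae
  replace hae := hp2.ae_le hae
  have hlim : Tendsto (fun k => ENNReal.ofReal (1 / (24 * π ^ 2) *
      (3 / 2 * (energy (truncate (ns k) F) + energy (truncate (ns k) G)) ^ 2 -
        halfOrderEnergy (truncate (ns k) F) ^ 2 - halfOrderEnergy (truncate (ns k) G) ^ 2))) atTop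
      (𝓝 (ENNReal.ofReal (1 / (24 * π ^ 2) * (3 / 2 * (energy F + energy G) ^ 2 -
        halfOrderEnergy F ^ 2 - halfOrderEnergy G ^ 2)))) := by
    refine (ENNReal.continuous_ofReal.tendsto _).comp (Tendsto.const_mul _ (Tendsto.comp (g := fun n =>
      3 / 2 * (energy (truncate n F) + energy (truncate n G)) ^ 2 -
        halfOrderEnergy (truncate n F) ^ 2 - halfOrderEnergy (truncate n G) ^ 2) ?_
      hns.tendsto_atTop))
    exact (((((tendsto_energy_truncate hF hFe).add (tendsto_energy_truncate hG hGe)).pow 2).const_mul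
      _).sub ((tendsto_halfOrderEnergy_truncate hF hFe).pow 2)).sub
      ((tendsto_halfOrderEnergy_truncate hG hGe).pow 2)
  rw [← hlim.liminf_eq]
  calc ∫⁻ p : ℝ × Space5, ‖u p.1 p.2‖ₑ ^ 4
      = ∫⁻ p : ℝ × Space5, liminf (fun k => ‖w (ns k) p‖ₑ ^ 4) atTop := by
        refine lintegral_congr_ae ?_
        filter_upwards [hae] with p hp
        exact (((ENNReal.continuous_pow 4).tendsto _).comp hp.enorm).liminf_eq.symm
    _ ≤ liminf (fun k => ∫⁻ p : ℝ × Space5, ‖w (ns k) p‖ₑ ^ 4) atTop :=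
        lintegral_liminf_le fun k => by have := (hwc (ns k)).measurable; fun_prop
    _ ≤ _ := liminf_le_liminf (Eventually.of_forall fun k =>
        lintegral_two_waves_pow_four_le (hFn _) (hGn _))

section Amplitudes

variable {u : ℝ → Space5 → ℂ} (hu : IsKleinGordonSolution u)

include hu

/-- Every solution is a superposition of a forward and a backward half wave. -/
theorem IsKleinGordonSolution.exists_amplitudes : ∃ F G : Space5 → ℂ, Measurable F ∧ Measurable G ∧
    (Integrable fun ξ => jap ξ ^ 2 * ‖F ξ‖ ^ 2) ∧ (Integrable fun ξ => jap ξ ^ 2 * ‖G ξ‖ ^ 2) ∧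
    energy F + energy G = hu.dataNorm ^ 2 / 2 ∧
    ∀ t, (𝓕 ((hu.memLp t).toLp (u t)) : L2Space5) =ᵐ[volume]
      fun ξ => evolve t F ξ + evolve (-t) G ξ := by
  set X : L2Space5 := 𝓕 hu.initialPosition with hX
  set W : L2Space5 := 𝓕 hu.initialVelocity with hW
  have hXm : Measurable X := (Lp.stronglyMeasurable X).measurable
  have hWm : Measurable W := (Lp.stronglyMeasurable W).measurable
  have hb : ∀ ξ, besselFourier hu.initialPosition ξ = (jap ξ : ℂ) * X ξ := fun ξ => by
    simp only [besselFourier, jap, hX]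
  have hXL : MemLp (fun ξ => (jap ξ : ℂ) * X ξ) 2 := by
    have := hu.memH1_zero
    unfold MemH1 at this
    exact (memLp_congr_ae (Eventually.of_forall hb)).1 this
  have i1 : Integrable fun ξ => jap ξ ^ 2 * ‖X ξ‖ ^ 2 := by
    refine hXL.integrable_norm_pow (p := 2) two_ne_zero |>.congr (Eventually.of_forall fun ξ => ?_)
    simp only [norm_mul, Complex.norm_real, mul_pow, Real.norm_of_nonneg (jap_pos ξ).le]
  have i2 : Integrable fun ξ => ‖W ξ‖ ^ 2 := (Lp.memLp W).integrable_norm_pow (p := 2) two_ne_zero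
  have hD : hu.dataNorm ^ 2 = (∫ ξ, jap ξ ^ 2 * ‖X ξ‖ ^ 2) + ∫ ξ, ‖W ξ‖ ^ 2 := by
    rw [IsKleinGordonSolution.dataNorm, Real.sq_sqrt (by positivity)]
    congr 1
    · rw [h1Norm, eLpNorm_congr_ae (Eventually.of_forall hb), toReal_eLpNorm_two_sq hXL]
      refine integral_congr_ae (Eventually.of_forall fun ξ => ?_)
      simp only [norm_mul, Complex.norm_real, mul_pow, Real.norm_of_nonneg (jap_pos ξ).le]
    · rw [← Lp.norm_fourier_eq hu.initialVelocity, Lp.norm_def, toReal_eLpNorm_two_sq (Lp.memLp _)]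
  -- Solves `F + G = X` and `i jap (F - G) = W`. The parallelogram law then makes the two energies
  -- add up to half the squared data norm.
  set F : Space5 → ℂ := fun ξ => (X ξ - Complex.I * W ξ / jap ξ) / 2 with hF
  set G : Space5 → ℂ := fun ξ => (X ξ + Complex.I * W ξ / jap ξ) / 2 with hG
  have hFm : Measurable F := by fun_prop
  have hGm : Measurable G := by fun_prop
  have hpar : ∀ ξ, jap ξ ^ 2 * ‖F ξ‖ ^ 2 + jap ξ ^ 2 * ‖G ξ‖ ^ 2 =
      (jap ξ ^ 2 * ‖X ξ‖ ^ 2 + ‖W ξ‖ ^ 2) / 2 := by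
    intro ξ
    have hp := jap_pos ξ
    have h := parallelogram_law_with_norm ℂ (X ξ) (Complex.I * W ξ / jap ξ)
    have e : ‖Complex.I * W ξ / jap ξ‖ = ‖W ξ‖ / jap ξ := by
      rw [norm_div, norm_mul, Complex.norm_I, one_mul, Complex.norm_real,
        Real.norm_of_nonneg hp.le]
    rw [e] at h
    simp only [hF, hG, norm_div, Complex.norm_ofNat]
    have : jap ξ ^ 2 * (‖W ξ‖ / jap ξ) ^ 2 = ‖W ξ‖ ^ 2 := by field_simp
    rw [← this]
    linear_combination (jap ξ ^ 2 / 4) * h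
  have isum : Integrable fun ξ => (jap ξ ^ 2 * ‖X ξ‖ ^ 2 + ‖W ξ‖ ^ 2) / 2 := (i1.add i2).div_const 2
  have iF : Integrable fun ξ => jap ξ ^ 2 * ‖F ξ‖ ^ 2 := by
    refine isum.mono' (Measurable.aestronglyMeasurable (by fun_prop))
      (Eventually.of_forall fun ξ => ?_)
    rw [Real.norm_of_nonneg (by positivity), ← hpar]
    exact le_add_of_nonneg_right (by positivity)
  have iG : Integrable fun ξ => jap ξ ^ 2 * ‖G ξ‖ ^ 2 := by
    refine isum.mono' (Measurable.aestronglyMeasurable (by fun_prop))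
      (Eventually.of_forall fun ξ => ?_)
    rw [Real.norm_of_nonneg (by positivity), ← hpar]
    exact le_add_of_nonneg_left (by positivity)
  refine ⟨F, G, hFm, hGm, iF, iG, ?_, fun t => ?_⟩
  · rw [energy, energy, ← integral_add iF iG, integral_congr_ae (Eventually.of_forall hpar),
      integral_div, integral_add i1 i2, hD]
  · filter_upwards [hu.fourier_eq t] with ξ h
    have hp : (jap ξ : ℂ) ≠ 0 := by exact_mod_cast (jap_pos ξ).ne'
    refine h.trans ?_
    simp only [evolve, hF, hG, neg_mul, Complex.ofReal_neg]
    rw [← neg_mul, Complex.exp_mul_I, Complex.exp_mul_I, Complex.cos_neg, Complex.sin_neg]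
    push_cast
    field_simp
    linear_combination (2 * W ξ * Complex.sin (t * jap ξ)) * Complex.I_sq

/-- The Strichartz estimate, with a remainder that detects vanishing. -/
theorem IsKleinGordonSolution.exists_lintegral_pow_four_le : ∃ N : ℝ, 0 ≤ N ∧
    N ≤ 1 / (64 * π ^ 2) * hu.dataNorm ^ 4 ∧
    ∫⁻ p : ℝ × Space5, ‖u p.1 p.2‖ₑ ^ 4 ≤
      ENNReal.ofReal (1 / (64 * π ^ 2) * hu.dataNorm ^ 4 - N) ∧
    (N = 0 → ∀ t, u t =ᵐ[volume] 0) := by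
  obtain ⟨F, G, hF, hG, iF, iG, hE, hfu⟩ := hu.exists_amplitudes
  -- The remainder is the gain from the mass term. The upper bound on it keeps the subtraction
  -- nonnegative, so that `ENNReal.ofReal` does not truncate.
  refine ⟨1 / (24 * π ^ 2) * (halfOrderEnergy F ^ 2 + halfOrderEnergy G ^ 2), by positivity,
    ?_, (lintegral_pow_four_le_of_fourier_eq hu.aestronglyMeasurable hu.memLp hF hG iF iG hfu).trans_eq
      ?_, fun hN t => ?_⟩
  · have h1 : halfOrderEnergy F ^ 2 + halfOrderEnergy G ^ 2 ≤ (hu.dataNorm ^ 2 / 2) ^ 2 := by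
      have hF0 := halfOrderEnergy_nonneg F
      have hG0 := halfOrderEnergy_nonneg G
      have hF1 := halfOrderEnergy_le_energy hF iF
      have hG1 := halfOrderEnergy_le_energy hG iG
      rw [← hE]
      nlinarith
    calc _ ≤ 1 / (24 * π ^ 2) * (hu.dataNorm ^ 2 / 2) ^ 2 := by gcongr
      _ = 1 / (96 * π ^ 2) * hu.dataNorm ^ 4 := by ring
      _ ≤ _ := by gcongr; norm_num
  · rw [hE]
    congr 1
    ring
  · have vanish : ∀ {F : Space5 → ℂ}, Measurable F →
        (Integrable fun ξ => jap ξ ^ 2 * ‖F ξ‖ ^ 2) → halfOrderEnergy F = 0 → F =ᵐ[volume] 0 := by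
      intro F hF iF h0
      have := (integral_eq_zero_iff_of_nonneg (fun ξ => mul_nonneg (jap_pos ξ).le (by positivity))
        (integrable_halfOrderEnergy hF iF)).1 h0
      filter_upwards [this] with ξ hξ
      simpa [(jap_pos ξ).ne'] using hξ
    have hpos : 0 < 1 / (24 * π ^ 2) := by positivity
    have h2 : halfOrderEnergy F ^ 2 + halfOrderEnergy G ^ 2 = 0 :=
      (mul_eq_zero.1 hN).resolve_left hpos.ne'
    have hF0 := vanish hF iF (pow_eq_zero_iff two_ne_zero |>.1 (le_antisymm (by linarith [sq_nonneg (halfOrderEnergy G)]) (sq_nonneg _)))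
    have hG0 := vanish hG iG (pow_eq_zero_iff two_ne_zero |>.1 (le_antisymm (by linarith [sq_nonneg (halfOrderEnergy F)]) (sq_nonneg _)))
    have h3 : (𝓕 ((hu.memLp t).toLp (u t)) : L2Space5) = 0 := by
      refine Lp.ext ?_
      filter_upwards [hfu t, hF0, hG0, Lp.coeFn_zero ℂ 2 (volume : Measure Space5)] with ξ a b c d
      rw [a, d]
      simp [evolve, b, c]
    have h4 : (hu.memLp t).toLp (u t) = 0 := by
      rw [← norm_eq_zero, ← Lp.norm_fourier_eq, h3, norm_zero]
    exact (hu.memLp t).coeFn_toLp.symm.trans ((Lp.eq_zero_iff_ae_eq_zero).1 h4)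

end Amplitudes

end Approximation

/-! ### The near-extremal amplitudes as `a` tends to zero. -/

noncomputable section ExponentialAmplitude

open Set Filter Topology

/-- The exponential beats the power `m + 6`, which leaves decay of order `6`, more than the
dimension `5`. -/
theorem integrable_jap_pow_mul_exp {a : ℝ} (ha : 0 < a) (m : ℕ) :
    Integrable fun ξ : Space5 => jap ξ ^ m * Real.exp (-(a * jap ξ)) := by
  have h1 : Integrable fun ξ : Space5 => (1 + ‖ξ‖) ^ (-(6 : ℝ)) :=
    integrable_one_add_norm (by simp; norm_num)
  refine (h1.const_mul ((m + 6).factorial / a ^ (m + 6) * 2 ^ 6)).mono'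
    (Measurable.aestronglyMeasurable (by fun_prop)) (Eventually.of_forall fun ξ => ?_)
  have hj := jap_pos ξ
  rw [Real.norm_of_nonneg (by positivity)]
  have h2 := Real.pow_div_factorial_le_exp (a * jap ξ) (by positivity) (m + 6)
  have h3 : 1 + ‖ξ‖ ≤ 2 * jap ξ := by
    have := two_pi_norm_lt_jap ξ
    have := one_le_jap ξ
    nlinarith [Real.pi_gt_three, norm_nonneg ξ]
  have h4 : (1 + ‖ξ‖) ^ (-(6 : ℝ)) = ((1 + ‖ξ‖) ^ 6)⁻¹ := by
    rw [Real.rpow_neg (by positivity)]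
    norm_cast
  rw [h4, Real.exp_neg, ← div_eq_mul_inv, ← div_eq_mul_inv, div_le_div_iff₀ (by positivity)
    (by positivity)]
  have h5 : (1 + ‖ξ‖) ^ 6 ≤ 2 ^ 6 * jap ξ ^ 6 := by
    rw [← mul_pow]; gcongr
  rw [div_le_iff₀ (by positivity), mul_pow] at h2
  calc jap ξ ^ m * (1 + ‖ξ‖) ^ 6 ≤ jap ξ ^ m * (2 ^ 6 * jap ξ ^ 6) := by gcongr
    _ = 2 ^ 6 / a ^ (m + 6) * (a ^ (m + 6) * jap ξ ^ (m + 6)) := by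
        field_simp; ring
    _ ≤ 2 ^ 6 / a ^ (m + 6) * (Real.exp (a * jap ξ) * (m + 6).factorial) := by gcongr
    _ = _ := by ring

/-- The amplitude `e^{-a⟨ξ⟩}/⟨ξ⟩`, for which the sharp bilinear estimate is an identity. -/
def expAmplitude (a : ℝ) (ξ : Space5) : ℂ := ((Real.exp (-(a * jap ξ)) / jap ξ : ℝ) : ℂ)

theorem norm_expAmplitude (a : ℝ) (ξ : Space5) :
    ‖expAmplitude a ξ‖ = Real.exp (-(a * jap ξ)) / jap ξ := by
  have := jap_pos ξ
  rw [expAmplitude, Complex.norm_real, Real.norm_of_nonneg (by positivity)]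

@[fun_prop]
theorem measurable_expAmplitude (a : ℝ) : Measurable (expAmplitude a) := by
  unfold expAmplitude; fun_prop

theorem conjAmplitude_expAmplitude (a : ℝ) : conjAmplitude (expAmplitude a) = expAmplitude a := by
  funext ξ
  simp only [conjAmplitude, expAmplitude, jap_neg, Complex.conj_ofReal]

/-- The density is odd. Hence the momentum term dropped in the upper bound is zero here. -/
theorem momentum_expAmplitude (a : ℝ) : momentum (expAmplitude a) = 0 := by
  have h : momentum (expAmplitude a) = -momentum (expAmplitude a) := by
    conv_lhs => rw [momentum, ← integral_neg_eq_self]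
    rw [momentum, ← integral_neg]
    refine integral_congr_ae (Eventually.of_forall fun ξ => ?_)
    simp only [norm_expAmplitude, jap_neg, smul_neg]
  have h2 : (2 : ℝ) • momentum (expAmplitude a) = 0 := by
    rw [two_smul]
    nth_rewrite 1 [h]
    exact neg_add_cancel _
  exact (smul_eq_zero.1 h2).resolve_left two_ne_zero

/-- The factors `1/jap` cancel the energies in the Jacobian, and the exponents add up to the total
energy, so the result is radial in `ζ` for every `k`. -/
theorem pairAmplitude_expAmplitude (a : ℝ) (k ζ : Space5) : pairAmplitude (expAmplitude a) k ζ =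
    ((Real.exp (-(2 * a * halfEnergy k ζ)) / (jap ζ * halfEnergy k ζ) : ℝ) : ℂ) := by
  have h1 := jap_pos ζ
  have h2 := halfEnergy_pos k ζ
  have h3 := jap_pos ((1 / 2 : ℝ) • k + boost k ζ)
  have h4 := jap_pos ((1 / 2 : ℝ) • k - boost k ζ)
  have h5 : jap ((1 / 2 : ℝ) • k + boost k ζ) + jap ((1 / 2 : ℝ) • k - boost k ζ) =
      2 * halfEnergy k ζ := by
    rw [jap_half_add_boost, jap_half_sub_boost]; ring
  rw [pairAmplitude, expAmplitude, expAmplitude, ← Complex.ofReal_mul, ← Complex.ofReal_mul,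
    boostJac_eq, mul_comm 2 a, mul_assoc a, ← h5, mul_add, neg_add, Real.exp_add]
  congr 1
  field_simp

theorem energy_expAmplitude (a : ℝ) :
    energy (expAmplitude a) = ∫ ξ : Space5, Real.exp (-(2 * a * jap ξ)) := by
  refine integral_congr_ae (Eventually.of_forall fun ξ => ?_)
  have := jap_pos ξ
  simp only [norm_expAmplitude]
  rw [div_pow, mul_div_cancel₀ _ (by positivity), ← Real.exp_nat_mul]
  congr 1; push_cast; ring

section Positive

variable {a : ℝ} (ha : 0 < a)
include ha

theorem niceAmplitude_expAmplitude : NiceAmplitude (expAmplitude a) where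
  measurable := measurable_expAmplitude a
  bounded := by
    refine ⟨1, fun ξ => ?_⟩
    have := jap_pos ξ
    rw [norm_expAmplitude, div_le_one this]
    exact (Real.exp_le_one_iff.2 (by nlinarith)).trans (one_le_jap ξ)
  integrable_weighted := by
    refine (integrable_jap_pow_mul_exp ha 1).congr (Eventually.of_forall fun ξ => ?_)
    have := jap_pos ξ
    simp only [norm_expAmplitude]
    field_simp

theorem memLp_jap_pow_mul_expAmplitude (m : ℕ) :
    MemLp (fun ξ => (jap ξ : ℂ) ^ m * expAmplitude a ξ) 2 := by
  refine (memLp_two_iff_integrable_sq_norm (Measurable.aestronglyMeasurable (by fun_prop))).2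
    ((integrable_jap_pow_mul_exp (a := 2 * a) (by positivity) (2 * m)).mono'
      (Measurable.aestronglyMeasurable (by fun_prop)) (Eventually.of_forall fun ξ => ?_))
  have hj := jap_pos ξ
  rw [Real.norm_of_nonneg (by positivity), norm_mul, norm_pow, norm_expAmplitude, Complex.norm_real,
    Real.norm_of_nonneg hj.le, mul_pow, ← pow_mul, mul_comm m, div_pow, ← Real.exp_nat_mul]
  gcongr
  refine (div_le_self (Real.exp_pos _).le (one_le_pow₀ (one_le_jap ξ))).trans_eq ?_
  congr 1; push_cast; ring

theorem le_lintegral_halfWave_expAmplitude :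
    ENNReal.ofReal (1 / (24 * π ^ 2)) * ENNReal.ofReal (energy (expAmplitude a) ^ 2 -
      3 * halfOrderEnergy (expAmplitude a) ^ 2) ≤
    ∫⁻ t, ∫⁻ x, ‖halfWave (expAmplitude a) t x‖ₑ ^ 4 := by
  have hF := niceAmplitude_expAmplitude ha
  have hm := hF.measurable
  have he := hF.integrable_energy
  have h1 := le_lintegral_pairDensity hm he 3
  rw [momentum_expAmplitude] at h1
  simp only [norm_zero, ne_eq, OfNat.ofNat_ne_zero, not_false_eq_true, zero_pow, mul_zero,
    sub_zero] at h1
  refine (mul_le_mul_right h1 _).trans ?_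
  refine le_lintegral_halfWave_pow_four hF (g := fun k r =>
    ((Real.exp (-(2 * a * √(√(1 + (2 * π * r) ^ 2) ^ 2 + π ^ 2 * ‖k‖ ^ 2))) /
      (√(1 + (2 * π * r) ^ 2) * √(√(1 + (2 * π * r) ^ 2) ^ 2 + π ^ 2 * ‖k‖ ^ 2)) : ℝ) : ℂ))
    (fun k => by fun_prop) (fun k ζ => pairAmplitude_expAmplitude a k ζ) ?_
  rw [lintegral_pairDensity_one hm he]
  exact ENNReal.ofReal_ne_top

theorem energy_expAmplitude_pos : 0 < energy (expAmplitude a) := by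
  rw [energy_expAmplitude]
  have h := integrable_jap_pow_mul_exp (a := 2 * a) (by positivity) 0
  simp only [pow_zero, one_mul] at h
  exact integral_exp_pos h

/-- The half-order density is the energy density divided by `jap`: at most `1` inside the ball, and
smaller than the energy density by a factor `R` outside. -/
theorem halfOrderEnergy_expAmplitude_le {R : ℝ} (hR : 0 < R) :
    halfOrderEnergy (expAmplitude a) ≤
      volume.real (Metric.closedBall (0 : Space5) R) + energy (expAmplitude a) / R := by
  have h := integrable_jap_pow_mul_exp (a := 2 * a) (by positivity) 0
  simp only [pow_zero, one_mul] at h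
  have hb : Integrable ((Metric.closedBall (0 : Space5) R).indicator fun _ => (1 : ℝ)) :=
    (integrable_indicator_iff Metric.isClosed_closedBall.measurableSet).2
      (integrableOn_const (isCompact_closedBall _ _).measure_lt_top.ne)
  rw [energy_expAmplitude, ← integral_div, ← integral_indicator_one
    Metric.isClosed_closedBall.measurableSet]
  simp only [Pi.one_def]
  rw [← integral_add hb (h.div_const R)]
  refine integral_mono (integrable_halfOrderEnergy (measurable_expAmplitude a)
    (niceAmplitude_expAmplitude ha).integrable_energy) (hb.add (h.div_const R)) fun ξ => ?_
  have hj := jap_pos ξ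
  have hj1 := one_le_jap ξ
  have e : jap ξ * ‖expAmplitude a ξ‖ ^ 2 = Real.exp (-(2 * a * jap ξ)) / jap ξ := by
    have e1 : Real.exp (-(a * jap ξ)) ^ 2 = Real.exp (-(2 * a * jap ξ)) := by
      rw [← Real.exp_nat_mul]
      congr 1; push_cast; ring
    rw [norm_expAmplitude, div_pow, e1]
    field_simp
  simp only [e]
  by_cases hξ : ξ ∈ Metric.closedBall (0 : Space5) R
  · rw [indicator_of_mem hξ]
    have : Real.exp (-(2 * a * jap ξ)) / jap ξ ≤ 1 := by
      rw [div_le_one hj]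
      exact (Real.exp_le_one_iff.2 (by nlinarith)).trans hj1
    have : 0 ≤ Real.exp (-(2 * a * jap ξ)) / R := by positivity
    linarith
  · rw [indicator_of_notMem hξ, zero_add]
    rw [mem_closedBall_zero_iff, not_le] at hξ
    gcongr
    nlinarith [two_pi_norm_lt_jap ξ, Real.pi_gt_three]

end Positive

/-- The energy density tends to `1` everywhere as `a` tends to `0`, so the energy is unbounded and
dominates the fixed ball term in the half-order bound. -/
theorem exists_energy_expAmplitude_ge (K : ℝ) : ∃ a : ℝ, 0 < a ∧ K ≤ energy (expAmplitude a) := by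
  set v := volume.real (Metric.closedBall (0 : Space5) 1)
  have hv : 0 < v := ENNReal.toReal_pos (Metric.measure_closedBall_pos _ _ one_pos).ne'
    (isCompact_closedBall _ _).measure_lt_top.ne
  set r : ℝ := max 1 (K * Real.exp 2 / v)
  have hr : 1 ≤ r := le_max_left _ _
  -- The largest value of `jap` on the ball of radius `r`. With `a = 1/J` the density there is at
  -- least `exp(-2)`.
  set J : ℝ := √(1 + (2 * π * r) ^ 2)
  have hJ : 0 < J := by positivity
  refine ⟨J⁻¹, by positivity, ?_⟩
  have h := integrable_jap_pow_mul_exp (a := 2 * J⁻¹) (by positivity) 0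
  simp only [pow_zero, one_mul] at h
  rw [energy_expAmplitude]
  have hvol : volume.real (Metric.closedBall (0 : Space5) r) = r ^ 5 * v := by
    rw [Measure.addHaar_real_closedBall' _ _ (by positivity)]
    simp [v]
  calc K = K * Real.exp 2 / v * (v * Real.exp (-2)) := by
        rw [Real.exp_neg]; field_simp
    _ ≤ r ^ 5 * (v * Real.exp (-2)) := by
        gcongr
        exact (le_max_right _ _).trans (le_self_pow₀ hr (by norm_num))
    _ = ∫ ξ in Metric.closedBall (0 : Space5) r, Real.exp (-2) := by
        rw [setIntegral_const, hvol, smul_eq_mul, mul_assoc]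
    _ ≤ ∫ ξ in Metric.closedBall (0 : Space5) r, Real.exp (-(2 * J⁻¹ * jap ξ)) := by
        refine setIntegral_mono_on (integrableOn_const (isCompact_closedBall _ _).measure_lt_top.ne)
          h.integrableOn Metric.isClosed_closedBall.measurableSet fun ξ hξ => ?_
        rw [mem_closedBall_zero_iff] at hξ
        gcongr
        have : jap ξ ≤ J := by
          unfold jap J; gcongr
        rw [mul_assoc]
        have : J⁻¹ * jap ξ ≤ 1 := by
          rw [inv_mul_le_iff₀ hJ]; linarith
        linarith
    _ ≤ _ := setIntegral_le_integral h (Eventually.of_forall fun ξ => (Real.exp_pos _).le)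

/-- The low order energy of the amplitudes is negligible. -/
theorem exists_halfOrderEnergy_le {ε : ℝ} (hε : 0 < ε) : ∃ a : ℝ, 0 < a ∧
    halfOrderEnergy (expAmplitude a) ≤ ε * energy (expAmplitude a) := by
  obtain ⟨a, ha, hK⟩ := exists_energy_expAmplitude_ge
    (volume.real (Metric.closedBall (0 : Space5) (2 / ε)) * (2 / ε))
  refine ⟨a, ha, (halfOrderEnergy_expAmplitude_le ha (R := 2 / ε) (by positivity)).trans ?_⟩
  rw [← le_div_iff₀ (by positivity)] at hK
  refine (add_le_add_left hK _).trans_eq ?_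
  field_simp
  ring

end ExponentialAmplitude

/-! ### The near-extremal solutions. -/

noncomputable section ExponentialWave

open Set Filter Topology

theorem integral_fourierInv_Lp_mul (f : L2Space5) (ψ : 𝓢(Space5, ℂ)) :
    ∫ x, (𝓕⁻ f : L2Space5) x * ψ x = ∫ ξ, f ξ * (𝓕⁻ ψ) ξ := by
  have h := integral_fourier_Lp_mul (𝓕⁻ f : L2Space5) (𝓕⁻ ψ)
  rw [FourierTransform.fourier_fourierInv_eq, FourierTransform.fourier_fourierInv_eq] at h
  exact h.symm

theorem hasDerivAt_fourierInv {c : ℝ → L2Space5} {c' : L2Space5} {t : ℝ} (h : HasDerivAt c c' t) :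
    HasDerivAt (fun s => (𝓕⁻ (c s) : L2Space5)) (𝓕⁻ c' : L2Space5) t :=
  ((Lp.fourierTransformₗᵢ Space5 ℂ).symm.toContinuousLinearEquiv.toContinuousLinearMap.restrictScalars
    ℝ).hasFDerivAt.comp_hasDerivAt t h

theorem hasDerivAt_integral_mul_schwartz {c : ℝ → L2Space5} {c' : L2Space5} {t : ℝ}
    (h : HasDerivAt c c' t) (φ : 𝓢(Space5, ℂ)) :
    HasDerivAt (fun s => ∫ x, c s x * φ x) (∫ x, c' x * φ x) t := by
  have hm : MemLp (fun x => (starRingEnd ℂ) (φ x)) 2 := (φ.memLp 2 volume).star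
  have e : ∀ f : L2Space5, ∫ x, f x * φ x = inner ℂ (hm.toLp _) f := fun f => by
    rw [L2.inner_def]
    refine integral_congr_ae ?_
    filter_upwards [hm.coeFn_toLp] with x hx
    rw [hx, RCLike.inner_apply, Complex.conj_conj]
  simp_rw [e]
  simpa using (hasDerivAt_const t (hm.toLp _)).inner ℂ h

variable {a : ℝ} (ha : 0 < a)
include ha

theorem memLp_multiplier_mul_expAmplitude {θ : Space5 → ℝ} (hθ : Measurable θ) {m : ℕ}
    (h : ∀ ξ, |θ ξ| ≤ 2 * jap ξ ^ m) : MemLp (fun ξ => (θ ξ : ℂ) * expAmplitude a ξ) 2 := by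
  refine ((memLp_jap_pow_mul_expAmplitude ha m).const_mul 2).mono
    (Measurable.aestronglyMeasurable (by fun_prop)) (Eventually.of_forall fun ξ => ?_)
  have hj := jap_pos ξ
  simp only [norm_mul, norm_pow, Complex.norm_real, Complex.norm_ofNat, Real.norm_eq_abs,
    abs_of_pos hj]
  rw [← mul_assoc]
  exact mul_le_mul_of_nonneg_right (h ξ) (norm_nonneg _)

theorem hasDerivAt_multiplier_mul_expAmplitude {θ : ℝ → Space5 → ℝ} {θ' : Space5 → ℝ} {t : ℝ}
    (h : ∀ s, MemLp (fun ξ => (θ s ξ : ℂ) * expAmplitude a ξ) 2)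
    (h' : MemLp (fun ξ => (θ' ξ : ℂ) * expAmplitude a ξ) 2) (m : ℕ)
    (hd : ∀ s ξ, |θ s ξ - θ t ξ - (s - t) * θ' ξ| ≤ (s - t) ^ 2 * (2 * jap ξ ^ m)) :
    HasDerivAt (fun s => (h s).toLp _) (h'.toLp _) t := by
  have hk : MemLp (fun ξ => ‖(2 : ℂ) * ((jap ξ : ℂ) ^ m * expAmplitude a ξ)‖) 2 :=
    ((memLp_jap_pow_mul_expAmplitude ha m).const_mul 2).norm
  refine hasDerivAt_Lp_of_taylor hk fun s => ?_
  filter_upwards [(h s).coeFn_toLp, (h t).coeFn_toLp, h'.coeFn_toLp] with ξ h1 h2 h3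
  have hj := jap_pos ξ
  rw [h1, h2, h3, ← mul_assoc, ← sub_mul, ← sub_mul, ← Complex.ofReal_mul, ← Complex.ofReal_sub,
    ← Complex.ofReal_sub]
  simp only [norm_mul, norm_pow, Complex.norm_real, Complex.norm_ofNat, Real.norm_eq_abs,
    abs_of_pos hj]
  refine (mul_le_mul_of_nonneg_right (hd s ξ) (norm_nonneg _)).trans_eq ?_
  ring

omit ha in
/-- The solution with Fourier transform `2 cos(t⟨ξ⟩) e^{-a⟨ξ⟩}/⟨ξ⟩`. -/
def expWave (a : ℝ) (t : ℝ) (x : Space5) : ℂ :=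
  signedWave (expAmplitude a) 1 (t, x) + signedWave (expAmplitude a) (-1) (t, x)

theorem memLp_cos_mul_expAmplitude (t : ℝ) :
    MemLp (fun ξ => ((2 * Real.cos (t * jap ξ) : ℝ) : ℂ) * expAmplitude a ξ) 2 :=
  memLp_multiplier_mul_expAmplitude ha (m := 0) (by fun_prop) fun ξ => by
    rw [abs_mul, abs_two, pow_zero]
    gcongr
    exact Real.abs_cos_le_one _

theorem memLp_sin_mul_expAmplitude (t : ℝ) :
    MemLp (fun ξ => ((-(2 * jap ξ * Real.sin (t * jap ξ)) : ℝ) : ℂ) * expAmplitude a ξ) 2 :=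
  memLp_multiplier_mul_expAmplitude ha (m := 1) (by fun_prop) fun ξ => by
    have hj := jap_pos ξ
    rw [abs_neg, abs_mul, abs_of_pos (by positivity), pow_one]
    exact mul_le_of_le_one_right (by positivity) (Real.abs_sin_le_one _)

theorem memLp_sq_mul_cos_mul_expAmplitude (t : ℝ) :
    MemLp (fun ξ => ((-(2 * jap ξ ^ 2 * Real.cos (t * jap ξ)) : ℝ) : ℂ) * expAmplitude a ξ) 2 :=
  memLp_multiplier_mul_expAmplitude ha (m := 2) (by fun_prop) fun ξ => by
    have hj := jap_pos ξ
    rw [abs_neg, abs_mul, abs_of_pos (by positivity)]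
    exact mul_le_of_le_one_right (by positivity) (Real.abs_cos_le_one _)

theorem hasDerivAt_cos_mul_expAmplitude (t : ℝ) :
    HasDerivAt (fun s => (memLp_cos_mul_expAmplitude ha s).toLp _)
      ((memLp_sin_mul_expAmplitude ha t).toLp _) t :=
  hasDerivAt_multiplier_mul_expAmplitude ha (θ := fun s ξ => 2 * Real.cos (s * jap ξ)) _ _ 2
    fun s ξ => by
      have h := abs_cos_taylor_le (t * jap ξ) ((s - t) * jap ξ)
      rw [← add_mul, show t + (s - t) = s by ring] at h
      have e : 2 * Real.cos (s * jap ξ) - 2 * Real.cos (t * jap ξ) -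
          (s - t) * -(2 * jap ξ * Real.sin (t * jap ξ)) = 2 * (Real.cos (s * jap ξ) -
            Real.cos (t * jap ξ) + (s - t) * jap ξ * Real.sin (t * jap ξ)) := by ring
      rw [e, abs_mul, abs_two]
      linarith [mul_pow (s - t) (jap ξ) 2]

theorem hasDerivAt_sin_mul_expAmplitude (t : ℝ) :
    HasDerivAt (fun s => (memLp_sin_mul_expAmplitude ha s).toLp _)
      ((memLp_sq_mul_cos_mul_expAmplitude ha t).toLp _) t :=
  hasDerivAt_multiplier_mul_expAmplitude ha
    (θ := fun s ξ => -(2 * jap ξ * Real.sin (s * jap ξ))) _ _ 3 fun s ξ => by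
      have h := abs_sin_taylor_le (t * jap ξ) ((s - t) * jap ξ)
      rw [← add_mul, show t + (s - t) = s by ring] at h
      have hj := jap_pos ξ
      have e : -(2 * jap ξ * Real.sin (s * jap ξ)) - -(2 * jap ξ * Real.sin (t * jap ξ)) -
          (s - t) * -(2 * jap ξ ^ 2 * Real.cos (t * jap ξ)) = -(2 * jap ξ) * (Real.sin (s * jap ξ) -
            Real.sin (t * jap ξ) - (s - t) * jap ξ * Real.cos (t * jap ξ)) := by ring
      rw [e, abs_mul, abs_neg, abs_of_pos (by positivity : 0 < 2 * jap ξ)]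
      calc _ ≤ 2 * jap ξ * ((s - t) * jap ξ) ^ 2 := by gcongr
        _ = _ := by ring

theorem expWave_eq_fourierInv (t : ℝ) : expWave a t =
    𝓕⁻ (fun ξ => ((2 * Real.cos (t * jap ξ) : ℝ) : ℂ) * expAmplitude a ξ) := by
  have hF := niceAmplitude_expAmplitude ha
  funext x
  have h := fourierInv_add_of_integrable (hF.evolve t).integrable (hF.evolve (-t)).integrable x
  have e : (fun ξ => evolve t (expAmplitude a) ξ + evolve (-t) (expAmplitude a) ξ) =
      fun ξ => ((2 * Real.cos (t * jap ξ) : ℝ) : ℂ) * expAmplitude a ξ := by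
    funext ξ
    simp only [evolve, neg_mul, Complex.ofReal_neg]
    rw [← neg_mul, Complex.exp_mul_I, Complex.exp_mul_I, Complex.cos_neg, Complex.sin_neg]
    push_cast
    ring
  rw [e] at h
  rw [h]
  simp [expWave, signedWave, halfWave]

theorem integrable_cos_mul_expAmplitude (t : ℝ) :
    Integrable fun ξ => ((2 * Real.cos (t * jap ξ) : ℝ) : ℂ) * expAmplitude a ξ := by
  refine (niceAmplitude_expAmplitude ha).integrable.bdd_mul (c := 2)
    (Measurable.aestronglyMeasurable (by fun_prop)) (Eventually.of_forall fun ξ => ?_)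
  rw [Complex.norm_real, norm_mul, Real.norm_ofNat, Real.norm_eq_abs]
  linarith [Real.abs_cos_le_one (t * jap ξ)]

theorem fourierInv_toLp_ae_expWave (t : ℝ) :
    (𝓕⁻ ((memLp_cos_mul_expAmplitude ha t).toLp _) : L2Space5) =ᵐ[volume] expWave a t := by
  rw [expWave_eq_fourierInv ha]
  exact fourierInv_toLp_ae (integrable_cos_mul_expAmplitude ha t) _

theorem memLp_expWave (t : ℝ) : MemLp (expWave a t) 2 :=
  (memLp_congr_ae (fourierInv_toLp_ae_expWave ha t)).1 (Lp.memLp _)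

theorem sliceCurve_expWave (t : ℝ) : sliceCurve (expWave a) (memLp_expWave ha) t =
    𝓕⁻ ((memLp_cos_mul_expAmplitude ha t).toLp _) :=
  Lp.ext ((memLp_expWave ha t).coeFn_toLp.trans (fourierInv_toLp_ae_expWave ha t).symm)

theorem hasDerivAt_sliceCurve_expWave (t : ℝ) :
    HasDerivAt (sliceCurve (expWave a) (memLp_expWave ha))
      (𝓕⁻ ((memLp_sin_mul_expAmplitude ha t).toLp _) : L2Space5) t := by
  rw [funext (sliceCurve_expWave ha)]
  exact hasDerivAt_fourierInv (hasDerivAt_cos_mul_expAmplitude ha t)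

theorem besselFourier_expWave : besselFourier (sliceCurve (expWave a) (memLp_expWave ha) 0)
    =ᵐ[volume] fun ξ => 2 * ((jap ξ : ℂ) ^ 1 * expAmplitude a ξ) := by
  rw [sliceCurve_expWave ha]
  unfold besselFourier
  rw [FourierTransform.fourier_fourierInv_eq]
  filter_upwards [(memLp_cos_mul_expAmplitude ha 0).coeFn_toLp] with ξ h
  rw [h]
  simp only [zero_mul, Real.cos_zero, jap]
  push_cast
  ring

/-- The exponential absorbs all powers of `jap`, so the multipliers `2 cos`, `-2 jap sin` and `-2
jap² cos` are successive derivatives in `L²` and the equation even holds strongly. -/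
theorem isKleinGordonSolution_expWave : IsKleinGordonSolution (expWave a) where
  aestronglyMeasurable :=
    ((continuous_signedWave (niceAmplitude_expAmplitude ha) 1).add
      (continuous_signedWave (niceAmplitude_expAmplitude ha) (-1))).aestronglyMeasurable
  memLp := memLp_expWave ha
  contDiff := by
    refine contDiff_one_iff_deriv.2
      ⟨fun t => (hasDerivAt_sliceCurve_expWave ha t).differentiableAt, ?_⟩
    rw [funext fun t => (hasDerivAt_sliceCurve_expWave ha t).deriv]
    exact continuous_iff_continuousAt.2 fun t =>
      (hasDerivAt_fourierInv (hasDerivAt_sin_mul_expAmplitude ha t)).continuousAt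
  memH1_zero := (memLp_congr_ae (besselFourier_expWave ha)).2
    ((memLp_jap_pow_mul_expAmplitude ha 1).const_mul 2)
  weak_eq := by
    intro φ t
    rw [funext fun t => (hasDerivAt_sliceCurve_expWave ha t).deriv]
    refine (hasDerivAt_integral_mul_schwartz (hasDerivAt_fourierInv
      (hasDerivAt_sin_mul_expAmplitude ha t)) φ).congr_deriv ?_
    have h1 : ∫ x, expWave a t x * ((Δ φ : 𝓢(Space5, ℂ)) x - φ x) =
        ∫ x, (𝓕⁻ ((memLp_cos_mul_expAmplitude ha t).toLp _) : L2Space5) x * (Δ φ - φ) x := by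
      refine integral_congr_ae ?_
      filter_upwards [fourierInv_toLp_ae_expWave ha t] with x hx
      rw [hx, sub_apply]
    rw [h1, integral_fourierInv_Lp_mul, integral_fourierInv_Lp_mul]
    refine integral_congr_ae ?_
    filter_upwards [(memLp_cos_mul_expAmplitude ha t).coeFn_toLp,
      (memLp_sq_mul_cos_mul_expAmplitude ha t).coeFn_toLp] with ξ h2 h3
    rw [h2, h3, fourierInv_laplacian_sub]
    push_cast
    ring

theorem dataNorm_expWave :
    (isKleinGordonSolution_expWave ha).dataNorm ^ 2 = 4 * energy (expAmplitude a) := by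
  have hv : (isKleinGordonSolution_expWave ha).initialVelocity = 0 := by
    have h0 : (memLp_sin_mul_expAmplitude ha 0).toLp _ = 0 := by
      refine Lp.ext ?_
      filter_upwards [(memLp_sin_mul_expAmplitude ha 0).coeFn_toLp,
        Lp.coeFn_zero ℂ 2 (volume : Measure Space5)] with ξ h1 h2
      rw [h1, h2]
      simp
    rw [IsKleinGordonSolution.initialVelocity, (hasDerivAt_sliceCurve_expWave ha 0).deriv, h0,
      FourierTransform.fourierInv_zero]
  have hm := (memLp_jap_pow_mul_expAmplitude ha 1).const_mul 2
  rw [IsKleinGordonSolution.dataNorm, Real.sq_sqrt (by positivity), hv, norm_zero, h1Norm,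
    IsKleinGordonSolution.initialPosition, eLpNorm_congr_ae (besselFourier_expWave ha),
    toReal_eLpNorm_two_sq hm, energy, ← integral_const_mul, zero_pow two_ne_zero, add_zero]
  refine integral_congr_ae (Eventually.of_forall fun ξ => ?_)
  simp only [norm_mul, norm_pow, Complex.norm_real, Complex.norm_ofNat, Real.norm_eq_abs,
    abs_of_pos (jap_pos ξ)]
  ring

/-- Realness of the wave makes the mixed term equal to the pure ones, which gives the factor `1 + 4
+ 1 = 6` and `6/(24π²) = 1/(4π²)`. -/
theorem le_lintegral_expWave :
    ENNReal.ofReal (1 / (4 * π ^ 2) * (energy (expAmplitude a) ^ 2 -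
      3 * halfOrderEnergy (expAmplitude a) ^ 2)) ≤
    ∫⁻ p : ℝ × Space5, ‖expWave a p.1 p.2‖ₑ ^ 4 := by
  have h := lintegral_real_wave_pow_four (niceAmplitude_expAmplitude ha)
    (conjAmplitude_expAmplitude a)
  refine le_trans (le_of_eq ?_) ((mul_le_mul_right (le_lintegral_halfWave_expAmplitude ha) 6).trans_eq
    h.symm)
  rw [← ENNReal.ofReal_mul (by positivity), show (6 : ℝ≥0∞) = ENNReal.ofReal 6 by simp,
    ← ENNReal.ofReal_mul (by positivity)]
  congr 1
  ring

end ExponentialWave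

/-! ### The sharp constant and the absence of extremisers. -/

noncomputable section SharpConstant

theorem spaceTimeL4Norm_pow_four (u : ℝ → Space5 → ℂ) :
    spaceTimeL4Norm u ^ 4 = ∫⁻ p : ℝ × Space5, ‖u p.1 p.2‖ₑ ^ 4 := by
  have := eLpNorm_nnreal_pow_eq_lintegral (f := fun p : ℝ × Space5 => u p.1 p.2) (p := 4)
    (μ := volume) (by norm_num)
  simpa [spaceTimeL4Norm] using this

theorem sqrt_one_div_mul_pow_four (D : ℝ) :
    (√(1 / (8 * π)) * D) ^ 4 = 1 / (64 * π ^ 2) * D ^ 4 := by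
  rw [mul_pow, show √(1 / (8 * π)) ^ 4 = (√(1 / (8 * π)) ^ 2) ^ 2 by ring,
    Real.sq_sqrt (by positivity)]
  congr 1
  field_simp
  norm_num

theorem IsKleinGordonSolution.spaceTimeL4Norm_le {u : ℝ → Space5 → ℂ}
    (hu : IsKleinGordonSolution u) :
    spaceTimeL4Norm u ≤ ENNReal.ofReal (√(1 / (8 * π)) * hu.dataNorm) := by
  obtain ⟨N, hN, -, h, -⟩ := hu.exists_lintegral_pow_four_le
  have hD : 0 ≤ hu.dataNorm := Real.sqrt_nonneg _
  refine (ENNReal.pow_le_pow_left_iff four_ne_zero).1 ?_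
  rw [spaceTimeL4Norm_pow_four, ← ENNReal.ofReal_pow (by positivity), sqrt_one_div_mul_pow_four]
  exact h.trans (ENNReal.ofReal_le_ofReal (by linarith))

/-- Equality leaves no room for the remainder `N`, and `N = 0` forces both amplitudes to vanish. -/
theorem IsKleinGordonSolution.ae_eq_zero_of_eq {u : ℝ → Space5 → ℂ}
    (hu : IsKleinGordonSolution u)
    (heq : spaceTimeL4Norm u = ENNReal.ofReal (√(1 / (8 * π)) * hu.dataNorm)) (t : ℝ) :
    u t =ᵐ[volume] 0 := by
  obtain ⟨N, hN, hN', h, h0⟩ := hu.exists_lintegral_pow_four_le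
  have hD : 0 ≤ hu.dataNorm := Real.sqrt_nonneg _
  rw [← spaceTimeL4Norm_pow_four, heq, ← ENNReal.ofReal_pow (by positivity),
    sqrt_one_div_mul_pow_four] at h
  refine h0 ?_ t
  have := (ENNReal.ofReal_le_ofReal_iff (sub_nonneg.2 hN')).1 h
  linarith

theorem sqrt_le_of_forall_spaceTimeL4Norm_le {C : ℝ}
    (hC : ∀ (u : ℝ → Space5 → ℂ) (hu : IsKleinGordonSolution u),
      spaceTimeL4Norm u ≤ ENNReal.ofReal (C * hu.dataNorm)) : √(1 / (8 * π)) ≤ C := by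
  -- `max C 0` allows fourth powers to be taken before the sign of `C` is known. Here `ε` bounds the
  -- ratio of half-order energy to energy.
  have key : ∀ ε : ℝ, 0 < ε → 1 - 3 * ε ^ 2 ≤ 64 * π ^ 2 * (max C 0) ^ 4 := by
    intro ε hε
    obtain ⟨a, ha, hN⟩ := exists_halfOrderEnergy_le hε
    have hu := isKleinGordonSolution_expWave ha
    have hA := energy_expAmplitude_pos ha
    have hN0 : 0 ≤ halfOrderEnergy (expAmplitude a) := halfOrderEnergy_nonneg _
    have hD : 0 ≤ hu.dataNorm := Real.sqrt_nonneg _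
    have h1 := (hC _ hu).trans (ENNReal.ofReal_le_ofReal
      (mul_le_mul_of_nonneg_right (le_max_left C 0) hD))
    have h2 := pow_le_pow_left' h1 4
    rw [spaceTimeL4Norm_pow_four, ← ENNReal.ofReal_pow (by positivity)] at h2
    have h3 := (ENNReal.ofReal_le_ofReal_iff (by positivity)).1 ((le_lintegral_expWave ha).trans h2)
    rw [mul_pow, show hu.dataNorm ^ 4 = (hu.dataNorm ^ 2) ^ 2 by ring, dataNorm_expWave ha] at h3
    have h4 : halfOrderEnergy (expAmplitude a) ^ 2 ≤ ε ^ 2 * energy (expAmplitude a) ^ 2 := by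
      rw [← mul_pow]; gcongr
    rw [one_div, inv_mul_le_iff₀ (by positivity)] at h3
    have hA2 : 0 < energy (expAmplitude a) ^ 2 := by positivity
    refine le_of_mul_le_mul_right ?_ hA2
    linarith
  have hlim : (1 : ℝ) ≤ 64 * π ^ 2 * (max C 0) ^ 4 := by
    refine le_of_tendsto (x := nhdsWithin (0 : ℝ) (Set.Ioi 0)) (f := fun ε => 1 - 3 * ε ^ 2) ?_
      (eventually_nhdsWithin_of_forall fun ε hε => key ε hε)
    refine tendsto_nhdsWithin_of_tendsto_nhds ?_
    have : Continuous fun ε : ℝ => 1 - 3 * ε ^ 2 := by fun_prop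
    simpa using this.tendsto 0
  have hpow : √(1 / (8 * π)) ^ 4 ≤ (max C 0) ^ 4 := by
    have := sqrt_one_div_mul_pow_four 1
    rw [mul_one, one_pow, mul_one] at this
    rw [this, div_le_iff₀ (by positivity)]
    linarith
  have hle := le_of_pow_le_pow_left₀ four_ne_zero (le_max_right C 0) hpow
  have hpos : 0 < √(1 / (8 * π)) := by positivity
  exact (le_max_iff.1 hle).resolve_right (not_le.2 hpos)

end SharpConstant

theorem corollary1 :
    (∀ (u : ℝ → Space5 → ℂ) (hu : IsKleinGordonSolution u),
      spaceTimeL4Norm u ≤ ENNReal.ofReal (√(1 / (8 * π)) * hu.dataNorm)) ∧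
    (∀ C : ℝ,
      (∀ (u : ℝ → Space5 → ℂ) (hu : IsKleinGordonSolution u),
        spaceTimeL4Norm u ≤ ENNReal.ofReal (C * hu.dataNorm)) →
      √(1 / (8 * π)) ≤ C) ∧
    (∀ (u : ℝ → Space5 → ℂ) (hu : IsKleinGordonSolution u),
      spaceTimeL4Norm u = ENNReal.ofReal (√(1 / (8 * π)) * hu.dataNorm) →
      ∀ t : ℝ, u t =ᵐ[volume] 0) :=
  ⟨fun _ hu => hu.spaceTimeL4Norm_le, fun _ hC => sqrt_le_of_forall_spaceTimeL4Norm_le hC,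
    fun _ hu h => hu.ae_eq_zero_of_eq h⟩
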